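/- Let $\mathbb K$ be a field of characteristic zero. A *complete $L_\infty$ algebra* is a $\mathbb Z$-graded $\mathbb K$-vector space $L=\bigoplus_k L^k$ with graded symmetric multilinear maps $q_i:L[1]^{\odot i}\to L[1]$ of degree $1$, $i\ge 1$, which are the Taylor coefficients of a coderivation of square zero of the symmetric coalgebra of $L[1]$, and with a descending filtration $L=F^1L\supseteq F^2L\supseteq\cdots$ by graded subspaces such that $L^k\to\varprojlim_p L^k/F^pL^k$ is an isomorphism for every $k$ and $q_i(F^{p_1}L,\dots,F^{p_i}L)\subseteq F^{p_1+\cdots+p_i}L$. A *strict morphism* $f:L\to M$ of complete $L_\infty$ algebras is a linear map of degree zero with $f(F^pL)\subseteq F^pM$ for all $p\ge 1$ and $f(q_i(x_1,\dots,x_i))=q_i(f(x_1),\dots,f(x_i))$ for all $i\geq 1$. The set of Maurer–Cartan elements of $L$ is $\mathrm{MC}(L)=\{x\in L^1 : \sum_{i\ge1}\frac1{i!}q_i(x,\dots,x)=0\}$, the series being convergent in the topology of the filtration. For $n\ge0$ let $\Omega^*(\Delta_n)$ be the differential graded algebra of polynomial differential forms on the standard $n$-simplex over $\mathbb K$, and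 let $C^*(\Delta_n;L)$ be the graded space of non-degenerate (normalized) simplicial cochains on $\Delta_n$ with values in $L$, with the filtration $F^pC^*(\Delta_n;L)=C^*(\Delta_n;F^pL)$. The $L_\infty$ structure of $L$ extends to $\Omega^*(\Delta_n)\otimes L$ by extension of scalars. The space $C^*(\Delta_n;L)$, with the sum of the simplicial coboundary and the differential of $L$, is a contraction of $\Omega^*(\Delta_n)\otimes L$: the inclusion is given by Whitney's elementary forms $\omega_{i_0\cdots i_k}=k!\sum_j(-1)^jt_{i_j}dt_{i_0}\cdots\widehat{dt_{i_j}}\cdots dt_{i_k}$, the projection by integration over the faces, and the homotopy by Dupont's operator $\sum_{k}\sum_{i_0<\cdots<i_k}\omega_{i_0\cdots i_k}\wedge h_{i_k}\cdots h_{i_0}$, where $h_i$ is the Poincaré homotopy for the linear contraction of $\Delta_n$ onto its $i$-th vertex. Thus homotopy transfer along this contraction makes $C^*(\Delta_n;L)$ a complete $L_\infty$ algebra, compatibly with pull-back along simplicial maps $\Delta_m\to\Delta_n$ and with strict morphisms in $L$. Let $\mathrm{Del}_\infty(L)$ be the simplicial set with $$\mathrm{Del}_\infty(L)_n=\mathrm{MC}(C^*(\Delta_n;L)),$$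 the structure maps being pull-back of cochains; a strict morphism $f:L\to M$ induces a map $\mathrm{Del}_\infty(f):\mathrm{Del}_\infty(L)\to\mathrm{Del}_\infty(M)$ by applying $f$ to the values of cochains. **Corollary.** Let $f:L\to M$ be a strict morphism of complete $L_\infty$ algebras. Then $\mathrm{Del}_\infty(f)$ is a Kan fibration if and only if $f:L^k\to M^k$ is surjective for every $k\le 0$. In particular, $\mathrm{Del}_\infty(L)$ is a Kan complex for every complete $L_\infty$ algebra $L$. -/

import Mathlib

open CategoryTheory
open scoped TensorProduct

universe u v

namespace DeligneGetzler

/-! ## Complete L∞ algebras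

All signs are Koszul signs for the shifted grading `L[1]`: an element of degree `d` in `L` has
degree `d - 1` in `L[1]`.  The letter `e` always denotes a list of shifted degrees. -/

/-- The restriction of a tuple to a set of positions, listed in increasing order. -/
def restrict {X : Type*} {n : ℕ} (S : Finset (Fin n)) (x : Fin n → X) : Fin S.card → X :=
  fun a => x (S.orderEmbOfFin rfl a)

/-- The exponent of the Koszul sign of the unshuffle which moves the entries in `S` to the left of
the others, the entries having degrees `e`. -/
def unshuffleSign {n : ℕ} (e : Fin n → ℤ) (S : Finset (Fin n)) : ℤ :=
  ∑ a ∈ S, ∑ b ∈ Sᶜ with b < a, e a * e b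

/-- A complete `L∞` algebra over `K`: a graded space `L = ⨁ Lᵏ` with a complete descending
filtration `L = F¹L ⊇ F²L ⊇ ⋯` by graded subspaces, and continuous Taylor coefficients
`qₙ : L[1]^{⊙n} → L[1]` of degree one, `n ≥ 1`, of a coderivation of square zero. -/
structure CompleteLInfty (K : Type v) [Field K] where
  /-- the underlying space -/
  carrier : Type u
  [addCommGroup : AddCommGroup carrier]
  [module : Module K carrier]
  /-- the homogeneous components -/
  deg : ℤ → Submodule K carrier
  isInternal : DirectSum.IsInternal deg
  /-- the filtration; only the indices `p ≥ 1` matter -/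
  filt : ℕ → Submodule K carrier
  filt_one : filt 1 = ⊤
  filt_antitone : Antitone filt
  filt_graded : ∀ p, filt p ≤ ⨆ k, filt p ⊓ deg k
  /-- injectivity of `Lᵏ → lim Lᵏ / FᵖLᵏ` -/
  separated : ∀ k, ∀ x ∈ deg k, (∀ p, x ∈ filt p) → x = 0
  /-- surjectivity of `Lᵏ → lim Lᵏ / FᵖLᵏ` -/
  complete : ∀ k, ∀ s : ℕ → carrier, (∀ p, s p ∈ deg k) → (∀ p, s (p + 1) - s p ∈ filt p) →
    ∃ x ∈ deg k, ∀ p, x - s p ∈ filt p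
  /-- the Taylor coefficients -/
  q : ∀ n : ℕ, MultilinearMap K (fun _ : Fin n => carrier) carrier
  q_zero : q 0 = 0
  /-- `qₙ` has degree one with respect to the shifted grading -/
  q_deg : ∀ (n : ℕ) (e : Fin n → ℤ) (x : Fin n → carrier), (∀ a, x a ∈ deg (e a + 1)) →
    q n x ∈ deg ((∑ a, e a) + 2)
  /-- `qₙ` is graded symmetric with respect to the shifted grading -/
  q_symm : ∀ (n : ℕ) (e : Fin n → ℤ) (x : Fin n → carrier), (∀ a, x a ∈ deg (e a + 1)) →
    ∀ a b : Fin n, (b : ℕ) = a + 1 →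
      q n (x ∘ Equiv.swap a b) = (e a * e b).negOnePow • q n x
  /-- the coderivation with Taylor coefficients `qₙ` squares to zero -/
  q_square : ∀ (n : ℕ) (e : Fin n → ℤ) (x : Fin n → carrier), (∀ a, x a ∈ deg (e a + 1)) →
    ∑ S : Finset (Fin n) with S.Nonempty, (unshuffleSign e S).negOnePow •
      q (Sᶜ.card + 1) (Fin.cons (q S.card (restrict S x)) (restrict Sᶜ x)) = 0
  /-- continuity -/
  q_filt : ∀ (n : ℕ) (p : Fin n → ℕ) (x : Fin n → carrier), (∀ a, 1 ≤ p a) →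
    (∀ a, x a ∈ filt (p a)) → q n x ∈ filt (∑ a, p a)

attribute [instance] CompleteLInfty.addCommGroup CompleteLInfty.module

instance {K : Type v} [Field K] : CoeSort (CompleteLInfty.{u} K) (Type u) where
  coe L := L.carrier

/-- A (continuous) strict `L∞` morphism of complete `L∞` algebras. -/
@[ext]
structure StrictHom {K : Type v} [Field K] (L M : CompleteLInfty.{u} K) where
  /-- the underlying linear map -/
  toLin : L →ₗ[K] M
  map_deg : ∀ k, ∀ x ∈ L.deg k, toLin x ∈ M.deg k
  map_filt : ∀ p, 1 ≤ p → ∀ x ∈ L.filt p, toLin x ∈ M.filt p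
  map_q : ∀ (n : ℕ) (x : Fin n → L), toLin (L.q n x) = M.q n (fun a => toLin (x a))

instance {K : Type v} [Field K] : Category (CompleteLInfty.{u} K) where
  Hom := StrictHom
  id L := ⟨LinearMap.id, fun _ _ h => h, fun _ _ _ h => h, fun _ _ => rfl⟩
  comp f g := ⟨g.toLin ∘ₗ f.toLin, fun k x h => g.map_deg k _ (f.map_deg k x h),
    fun p hp x h => g.map_filt p hp _ (f.map_filt p hp x h), fun n x => by
      simp [f.map_q, g.map_q]⟩

/-- Let `W` carry a grading, a filtration and operations `r n e` of arity `n` (evaluated on elements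
of shifted degrees `e`).  The element `x` is Maurer-Cartan if it has degree one (so that its
shifted degree is `0`) and its curvature `∑_{i ≥ 1} (1/i!) rᵢ(x, …, x)` converges to zero in the
topology given by the filtration. -/
def IsMaurerCartan (K : Type v) [Field K] {W : Type u} [AddCommGroup W] [Module K W]
    (deg : ℤ → Submodule K W) (filt : ℕ → Submodule K W)
    (r : (n : ℕ) → (Fin n → ℤ) → (Fin n → W) → W) (x : W) : Prop :=
  x ∈ deg 1 ∧ ∀ p, ∃ N, ∀ m ≥ N,
    ∑ i ∈ Finset.Icc 1 m, (i.factorial : K)⁻¹ • r i (fun _ => 0) (fun _ => x) ∈ filt p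

/-! ## Homotopy transfer -/

section Transfer

variable {K : Type v} [Field K]

/-- The positions in the `j`-th block of an ordered partition. -/
def block {n k : ℕ} (π : Fin n → Fin k) (j : Fin k) : Finset (Fin n) :=
  Finset.univ.filter fun a => π a = j

/-- The exponent of the Koszul sign of the unshuffle which sorts `n` entries of degrees `e` into
the blocks of `π`. -/
def blockSign {n k : ℕ} (e : Fin n → ℤ) (π : Fin n → Fin k) : ℤ :=
  ∑ a, ∑ b with a < b ∧ π b < π a, e a * e b

theorem card_block_lt {n k : ℕ} (π : {π : Fin n → Fin (k + 2) // Function.Surjective π})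
    (j : Fin (k + 2)) : (block π.1 j).card < n := by
  obtain ⟨i, hi⟩ : ∃ i : Fin (k + 2), i ≠ j := exists_ne j
  obtain ⟨a, ha⟩ := π.2 i
  have : block π.1 j ⊂ Finset.univ := by
    refine Finset.ssubset_univ_iff.2 fun h => hi ?_
    have h2 : a ∈ block π.1 j := by rw [h]; exact Finset.mem_univ a
    rw [← ha]
    exact (Finset.mem_filter.1 h2).2
  simpa using Finset.card_lt_card this

variable {V W : Type*} [AddCommGroup V] [Module K V] [AddCommGroup W] [Module K W]

/-- The sum `∑_{k=2}^{n} q_k F^k_n`, where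
`F^k_n (w₁, …, wₙ) = (1/k!) ∑ ± f(block 1) ⊙ ⋯ ⊙ f(block k)`, the sum being over all ordered
partitions of `{1, …, n}` into `k` nonempty blocks, i.e. over `n = i₁ + ⋯ + i_k` and the
`(i₁, …, i_k)`-unshuffles. -/
noncomputable def transferSum (Q : (n : ℕ) → (Fin n → ℤ) → (Fin n → V) → V) (n : ℕ)
    (f : (m : ℕ) → m < n → (Fin m → ℤ) → (Fin m → W) → V) (e : Fin n → ℤ) (w : Fin n → W) : V :=
  ∑ k ∈ Finset.range (n - 1), ((k + 2).factorial : K)⁻¹ •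
    ∑ π : {π : Fin n → Fin (k + 2) // Function.Surjective π}, (blockSign e π.1).negOnePow •
      Q (k + 2) (fun j => ∑ a ∈ block π.1 j, e a)
        (fun j => f _ (card_block_lt π j) (restrict (block π.1 j) e) (restrict (block π.1 j) w))

/-- The Taylor coefficients `fₙ` of the `L∞` morphism `W → V` given by homotopy transfer, where
`inc : W → V` is the linear inclusion, `htp` the contracting homotopy of `V`, and `Q` the `L∞`
structure of `V`: `f₁ = inc` and `fₙ = ∑_{k=2}^{n} htp q_k F^k_n`. -/
noncomputable def transferMap (inc : W →ₗ[K] V) (htp : V →ₗ[K] V)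
    (Q : (n : ℕ) → (Fin n → ℤ) → (Fin n → V) → V) (n : ℕ) (e : Fin n → ℤ) (w : Fin n → W) : V :=
  if h : n = 1 then inc (w ⟨0, by omega⟩)
  else htp (transferSum (K := K) Q n (fun m _ => transferMap inc htp Q m) e w)
termination_by n

/-- The `L∞` structure on `W` given by homotopy transfer: `r₁` is the differential `d` of `W` and
`rₙ = ∑_{k=2}^{n} proj q_k F^k_n`, where `proj : V → W` is the linear projection. -/
noncomputable def transferOp (inc : W →ₗ[K] V) (proj : V →ₗ[K] W) (htp : V →ₗ[K] V) (d : W → W)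
    (Q : (n : ℕ) → (Fin n → ℤ) → (Fin n → V) → V) (n : ℕ) (e : Fin n → ℤ) (w : Fin n → W) : W :=
  if h : n = 1 then d (w ⟨0, by omega⟩)
  else proj (transferSum (K := K) Q n (fun m _ => transferMap inc htp Q m) e w)

variable {V' W' : Type*} [AddCommGroup V'] [Module K V'] [AddCommGroup W'] [Module K W']

theorem map_transferSum {Q : (n : ℕ) → (Fin n → ℤ) → (Fin n → V) → V}
    {Q' : (n : ℕ) → (Fin n → ℤ) → (Fin n → V') → V'} (φ : V →ₗ[K] V') (ψ : W →ₗ[K] W')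
    (hQ : ∀ n e x, φ (Q n e x) = Q' n e (fun a => φ (x a))) {n : ℕ}
    {f : (m : ℕ) → m < n → (Fin m → ℤ) → (Fin m → W) → V}
    {f' : (m : ℕ) → m < n → (Fin m → ℤ) → (Fin m → W') → V'}
    (hf : ∀ m h e w, φ (f m h e w) = f' m h e (fun a => ψ (w a))) (e : Fin n → ℤ)
    (w : Fin n → W) :
    φ (transferSum (K := K) Q n f e w) = transferSum (K := K) Q' n f' e (fun a => ψ (w a)) := by
  simp only [transferSum, map_sum, map_smul, Units.smul_def, map_zsmul, hQ, hf]
  rfl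

/-- Homotopy transfer is natural with respect to morphisms of contractions. -/
theorem map_transferMap {Q : (n : ℕ) → (Fin n → ℤ) → (Fin n → V) → V}
    {Q' : (n : ℕ) → (Fin n → ℤ) → (Fin n → V') → V'} {inc : W →ₗ[K] V} {inc' : W' →ₗ[K] V'}
    {htp : V →ₗ[K] V} {htp' : V' →ₗ[K] V'} (φ : V →ₗ[K] V') (ψ : W →ₗ[K] W')
    (hQ : ∀ n e x, φ (Q n e x) = Q' n e (fun a => φ (x a)))
    (hinc : ∀ w, φ (inc w) = inc' (ψ w)) (hhtp : ∀ x, φ (htp x) = htp' (φ x)) (n : ℕ)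
    (e : Fin n → ℤ) (w : Fin n → W) :
    φ (transferMap inc htp Q n e w) = transferMap inc' htp' Q' n e (fun a => ψ (w a)) := by
  induction n using Nat.strong_induction_on with
  | _ n ih =>
    rw [transferMap, transferMap]
    split_ifs with h
    · exact hinc _
    · rw [hhtp, map_transferSum φ ψ hQ (fun m hm e w => ih m hm e w)]

theorem map_transferOp {Q : (n : ℕ) → (Fin n → ℤ) → (Fin n → V) → V}
    {Q' : (n : ℕ) → (Fin n → ℤ) → (Fin n → V') → V'} {inc : W →ₗ[K] V} {inc' : W' →ₗ[K] V'}
    {proj : V →ₗ[K] W} {proj' : V' →ₗ[K] W'} {d : W → W} {d' : W' → W'}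
    {htp : V →ₗ[K] V} {htp' : V' →ₗ[K] V'} (φ : V →ₗ[K] V') (ψ : W →ₗ[K] W')
    (hQ : ∀ n e x, φ (Q n e x) = Q' n e (fun a => φ (x a)))
    (hinc : ∀ w, φ (inc w) = inc' (ψ w)) (hhtp : ∀ x, φ (htp x) = htp' (φ x))
    (hproj : ∀ x, ψ (proj x) = proj' (φ x)) (hd : ∀ w, ψ (d w) = d' (ψ w)) (n : ℕ)
    (e : Fin n → ℤ) (w : Fin n → W) :
    ψ (transferOp inc proj htp d Q n e w) =
      transferOp inc' proj' htp' d' Q' n e (fun a => ψ (w a)) := by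
  rw [transferOp, transferOp]
  split_ifs with h
  · exact hd _
  · rw [hproj, map_transferSum φ ψ hQ (fun m _ e w => map_transferMap φ ψ hQ hinc hhtp m e w)]

end Transfer

/-! ## Polynomial differential forms on the simplex -/

section Forms

variable (K : Type v) [Field K]

/-- The algebra `Ω*(Δₙ) = K[t₀, …, tₙ, dt₀, …, dtₙ] / (∑ tᵢ = 1, ∑ dtᵢ = 0)` of polynomial
differential forms on the `n`-simplex, in the coordinates `t₁, …, tₙ`: polynomials in these tensor
the exterior algebra on `dt₁, …, dtₙ`. -/
abbrev Form (n : ℕ) : Type v := MvPolynomial (Fin n) K ⊗[K] ExteriorAlgebra K (Fin n → K)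

variable {n m : ℕ}

/-- The barycentric coordinates `t₀ = 1 - t₁ - ⋯ - tₙ, t₁, …, tₙ`. -/
noncomputable def bary : Fin (n + 1) → MvPolynomial (Fin n) K :=
  Fin.cons (1 - ∑ j, MvPolynomial.X j) MvPolynomial.X

/-- The differentials `dt₀ = - dt₁ - ⋯ - dtₙ, dt₁, …, dtₙ` of the barycentric coordinates. -/
def dBary : Fin (n + 1) → (Fin n → K) := Fin.cons (fun _ => -1) (fun j => Pi.single j 1)

/-- The pull-back of polynomials along the affine map `Δₘ → Δₙ` which is `θ` on vertices:
`tⱼ ↦ ∑_{θ l = j} tₗ`. -/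
noncomputable def polyPull (θ : Fin (m + 1) → Fin (n + 1)) :
    MvPolynomial (Fin n) K →ₐ[K] MvPolynomial (Fin m) K :=
  MvPolynomial.aeval fun j => ∑ l with θ l = j.succ, bary K l

/-- The pull-back of constant one-forms: `dtⱼ ↦ ∑_{θ l = j} dtₗ`. -/
noncomputable def covPull (θ : Fin (m + 1) → Fin (n + 1)) : (Fin n → K) →ₗ[K] (Fin m → K) :=
  Fintype.linearCombination K fun j => ∑ l with θ l = j.succ, dBary K l

/-- The pull-back of forms along the affine map `Δₘ → Δₙ` which is `θ` on vertices. -/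
noncomputable def formPull (θ : Fin (m + 1) → Fin (n + 1)) : Form K n →ₐ[K] Form K m :=
  Algebra.TensorProduct.map (polyPull K θ) (ExteriorAlgebra.map (covPull K θ))

/-- The parity involution `ω ↦ (-1)^{|ω|} ω`. -/
noncomputable def formParity (n : ℕ) : Form K n →ₐ[K] Form K n :=
  Algebra.TensorProduct.map (AlgHom.id K _)
    (CliffordAlgebra.involute (Q := (0 : QuadraticForm K (Fin n → K))))

/-- The integral `∫_{Δₙ} p dt₁ ⋯ dtₙ` of a polynomial; on monomials it is given by Dirichlet's
formula `∫_{Δₙ} t₁^{a₁} ⋯ tₙ^{aₙ} dt₁ ⋯ dtₙ = a₁! ⋯ aₙ! / (a₁ + ⋯ + aₙ + n)!`. -/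
noncomputable def polyIntegral (n : ℕ) : MvPolynomial (Fin n) K →ₗ[K] K :=
  (MvPolynomial.basisMonomials (Fin n) K).constr K fun a =>
    (∏ i, ((a i).factorial : K)) / ((∑ i, a i + n).factorial : K)

/-- The coefficient of `dt₁ ⋯ dtₙ`. -/
noncomputable def topCoeff (n : ℕ) : ExteriorAlgebra K (Fin n → K) →ₗ[K] K :=
  ExteriorAlgebra.liftAlternating (Pi.single n Matrix.detRowAlternating)

/-- The integral of a form over the oriented simplex `Δₙ`. -/
noncomputable def formIntegral (n : ℕ) : Form K n →ₗ[K] K :=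
  LinearMap.mul' K K ∘ₗ TensorProduct.map (polyIntegral K n) (topCoeff K n)

/-- The contraction of forms with the vector field `∑ⱼ (tⱼ - δᵢⱼ) ∂ⱼ`, the Euler vector field
centered at the `i`-th vertex. -/
noncomputable def eulerContract (i : Fin (n + 1)) : Form K n →ₗ[K] Form K n :=
  ∑ j : Fin n, TensorProduct.map
    (LinearMap.mulLeft K (MvPolynomial.X j - if i = j.succ then 1 else 0))
    (CliffordAlgebra.contractLeft (Q := (0 : QuadraticForm K (Fin n → K))) (LinearMap.proj j))

/-- The substitution `p(t) ↦ p(u t + (1 - u) eᵢ)` in polynomials, with `u` the variable of the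
outer polynomial ring and `eᵢ` the `i`-th vertex. -/
noncomputable def polyDilate (i : Fin (n + 1)) :
    MvPolynomial (Fin n) K →ₐ[K] Polynomial (MvPolynomial (Fin n) K) :=
  MvPolynomial.aeval fun j => Polynomial.X * Polynomial.C (MvPolynomial.X j) +
    (1 - Polynomial.X) * (if i = j.succ then 1 else 0)

/-- The substitution `dtⱼ ↦ u dtⱼ` in constant forms. -/
noncomputable def extDilate (n : ℕ) :
    ExteriorAlgebra K (Fin n → K) →ₐ[K] Polynomial (Form K n) :=
  ExteriorAlgebra.lift K ⟨LinearMap.mulLeft K Polynomial.X ∘ₗ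
      (Polynomial.CAlgHom (R := K)).toLinearMap ∘ₗ
      (Algebra.TensorProduct.includeRight (R := K) (A := MvPolynomial (Fin n) K)).toLinearMap ∘ₗ
      ExteriorAlgebra.ι K, fun x => by
    have : ∀ y : Form K n, y * y = 0 → (Polynomial.X * Polynomial.C y) *
        (Polynomial.X * Polynomial.C y) = 0 := fun y hy => by
      rw [mul_assoc, ← mul_assoc (Polynomial.C y), ← Polynomial.X_mul_C, mul_assoc,
        ← Polynomial.C_mul, hy]
      simp
    exact this _ (by simp)⟩

/-- The pull-back of forms under the dilation `t ↦ u t + (1 - u) eᵢ` with fixed `u`. -/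
noncomputable def dilate (i : Fin (n + 1)) : Form K n →ₗ[K] Polynomial (Form K n) :=
  TensorProduct.lift <| LinearMap.flip <| (LinearMap.mul K (Polynomial (Form K n))).compl₁₂
    (extDilate K n).toLinearMap
    ((Polynomial.mapAlgHom (Algebra.TensorProduct.includeLeft (R := K) (S := K))).comp
      (polyDilate K i)).toLinearMap

/-- The homotopy `hᵢ ω = - ∫₀¹ u⁻¹ (dilate_u (E ⌟ ω)) du`, with `E` the Euler vector field
centered at the `i`-th vertex (the integrand is polynomial in `u`).  This is Poincaré's homotopy
for the contraction of the simplex onto its `i`-th vertex, i.e. up to sign the integral over `u` of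
the pull-back of `ω` along `(u, t) ↦ u t + (1 - u) eᵢ`; it satisfies
`hᵢ d + d hᵢ = (evaluation at eᵢ) - id`. -/
noncomputable def coneHomotopy (i : Fin (n + 1)) : Module.End K (Form K n) :=
  -(Polynomial.lsum (fun k : ℕ => (k : K)⁻¹ • (LinearMap.id : Form K n →ₗ[K] Form K n)) ∘ₗ
    dilate K i ∘ₗ eulerContract K i)

/-- For vertices `v₀, …, v_k`, Whitney's elementary form
`k! ∑ⱼ (-1)ʲ t_{vⱼ} dt_{v₀} ⋯ dt_{v_{j-1}} dt_{v_{j+1}} ⋯ dt_{v_k}`.  Here `c = k + 1`. -/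
noncomputable def whitney {c : ℕ} (v : Fin c → Fin (n + 1)) : Form K n :=
  ((c - 1).factorial : K) • ∑ j : Fin c, (-1 : K) ^ (j : ℕ) •
    (List.ofFn fun a => if a = j then bary K (v a) ⊗ₜ[K] (1 : ExteriorAlgebra K (Fin n → K))
      else (1 : MvPolynomial (Fin n) K) ⊗ₜ[K] ExteriorAlgebra.ι K (dBary K (v a))).prod

/-- The composition `h_{v_k} ⋯ h_{v₀}`. -/
noncomputable def iterHomotopy {c : ℕ} (v : Fin c → Fin (n + 1)) : Module.End K (Form K n) :=
  (List.ofFn fun a => coneHomotopy K (v a)).reverse.prod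

/-- The (nonempty) faces of the `n`-simplex, i.e. its nondegenerate simplices, as sets of
vertices.  The face `I` has dimension `I.card - 1`. -/
abbrev Face (n : ℕ) : Type := {I : Finset (Fin (n + 1)) // I.Nonempty}

/-- The dimension of a face. -/
def Face.dim (I : Face n) : ℕ := I.1.card - 1

/-- The vertices of a face, in increasing order. -/
def Face.vertex (I : Face n) : Fin (I.dim + 1) → Fin (n + 1) :=
  I.1.orderEmbOfFin (Nat.succ_pred_eq_of_pos I.2.card_pos).symm

/-- Dupont's contracting homotopy
`∑_k ∑_{i₀ < ⋯ < i_k} ω_{i₀ ⋯ i_k} ∧ h_{i_k} ⋯ h_{i₀}`, where `ω_{i₀ ⋯ i_k}` are Whitney's forms.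
In particular it satisfies `s d + d s = (projection onto Whitney forms) - id`. -/
noncomputable def dupont (n : ℕ) : Form K n →ₗ[K] Form K n :=
  ∑ I : Face n, LinearMap.mulLeft K (whitney K I.vertex) ∘ₗ iterHomotopy K I.vertex

/-! ### Naturality under pull-back -/

variable {K}

theorem sum_bary : ∑ l : Fin (n + 1), bary K l = 1 := by
  simp [bary, Fin.sum_univ_succ]

theorem sum_dBary : ∑ l : Fin (n + 1), dBary K l = 0 := by
  ext j
  simp [dBary, Fin.sum_univ_succ, Finset.sum_apply, Pi.single_apply]

theorem polyPull_bary (θ : Fin (m + 1) → Fin (n + 1)) (i : Fin (n + 1)) :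
    polyPull K θ (bary K i) = ∑ l with θ l = i, bary K l := by
  have h : ∀ j : Fin n, polyPull K θ (bary K j.succ) = ∑ l with θ l = j.succ, bary K l := by
    intro j
    simp [polyPull, bary]
  refine Fin.cases ?_ h i
  have h1 : polyPull K θ (∑ i, bary K i) = ∑ i, ∑ l with θ l = i, bary K l := by
    rw [sum_bary, map_one, Finset.sum_fiberwise, sum_bary]
  rw [map_sum, Fin.sum_univ_succ, Fin.sum_univ_succ, Finset.sum_congr rfl fun j _ => h j] at h1
  exact add_right_cancel h1

theorem covPull_dBary (θ : Fin (m + 1) → Fin (n + 1)) (i : Fin (n + 1)) :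
    covPull K θ (dBary K i) = ∑ l with θ l = i, dBary K l := by
  have h : ∀ j : Fin n, covPull K θ (dBary K j.succ) = ∑ l with θ l = j.succ, dBary K l := by
    intro j
    simp only [covPull, dBary, Fin.cons_succ]
    exact Fintype.linearCombination_apply_single _ _ _ _ |>.trans (one_smul _ _)
  refine Fin.cases ?_ h i
  have h1 : covPull K θ (∑ i, dBary K i) = ∑ i, ∑ l with θ l = i, dBary K l := by
    rw [sum_dBary, map_zero, Finset.sum_fiberwise, sum_dBary]
  rw [map_sum, Fin.sum_univ_succ, Fin.sum_univ_succ, Finset.sum_congr rfl fun j _ => h j] at h1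
  exact add_right_cancel h1

theorem cov_ext {N : Type*} [AddCommGroup N] [Module K N] {f g : (Fin n → K) →ₗ[K] N}
    (h : ∀ i : Fin (n + 1), f (dBary K i) = g (dBary K i)) : f = g := by
  refine LinearMap.pi_ext' fun j => LinearMap.ext_ring ?_
  exact h j.succ

theorem poly_ext {A : Type*} [CommRing A] [Algebra K A] {f g : MvPolynomial (Fin n) K →ₐ[K] A}
    (h : ∀ i : Fin (n + 1), f (bary K i) = g (bary K i)) : f = g := by
  refine MvPolynomial.algHom_ext fun j => ?_
  exact h j.succ

theorem sum_filter_comp {X Y Z M : Type*} [Fintype X] [Fintype Y] [DecidableEq Y] [DecidableEq Z]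
    [AddCommMonoid M] (θ : Y → Z) (ψ : X → Y) (g : X → M) (z : Z) :
    ∑ y with θ y = z, ∑ x with ψ x = y, g x = ∑ x with θ (ψ x) = z, g x := by
  rw [← Finset.sum_fiberwise_of_maps_to (s := Finset.univ.filter fun x => θ (ψ x) = z)
    (t := Finset.univ.filter fun y => θ y = z) (g := ψ) (by simp)]
  refine Finset.sum_congr rfl fun y hy => Finset.sum_congr ?_ fun _ _ => rfl
  ext x
  simp only [Finset.mem_filter, Finset.mem_univ, true_and] at hy ⊢
  constructor
  · rintro rfl; exact ⟨hy, rfl⟩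
  · exact fun h => h.2

theorem formPull_comp {k : ℕ} (θ : Fin (m + 1) → Fin (n + 1)) (ψ : Fin (k + 1) → Fin (m + 1)) :
    (formPull K ψ).comp (formPull K θ) = formPull K (θ ∘ ψ) := by
  have h1 : (polyPull K ψ).comp (polyPull K θ) = polyPull K (θ ∘ ψ) := poly_ext fun i => by
    simp [polyPull_bary, sum_filter_comp]
  have h2 : (covPull K ψ).comp (covPull K θ) = covPull K (θ ∘ ψ) := cov_ext fun i => by
    simp [covPull_dBary, sum_filter_comp]
  rw [formPull, formPull, formPull, ← h1, ← h2, ← ExteriorAlgebra.map_comp_map]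
  ext <;> simp

theorem formPull_parity (θ : Fin (m + 1) → Fin (n + 1)) :
    (formPull K θ).comp (formParity K n) = (formParity K m).comp (formPull K θ) := by
  ext x
  · simp [formPull, formParity]
  · simp only [formPull, formParity]
    simp

/-- Pulling back the expansions of Whitney's forms. -/
theorem formPull_whitney {c : ℕ} (θ : Fin (m + 1) → Fin (n + 1)) (v : Fin c → Fin (n + 1)) :
    formPull K θ (whitney K v) =
      ∑ l ∈ Fintype.piFinset (fun a => Finset.univ.filter fun l => θ l = v a), whitney K l := by
  have hb : ∀ i, formPull K θ (bary K i ⊗ₜ[K] 1) = ∑ l with θ l = i, bary K l ⊗ₜ[K] 1 := by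
    intro i
    simp [formPull, polyPull_bary, TensorProduct.sum_tmul]
  have hd : ∀ i, formPull K θ (1 ⊗ₜ[K] ExteriorAlgebra.ι K (dBary K i)) =
      ∑ l with θ l = i, 1 ⊗ₜ[K] ExteriorAlgebra.ι K (dBary K l) := by
    intro i
    simp [formPull, covPull_dBary, TensorProduct.tmul_sum]
  simp only [whitney, map_smul, map_sum, map_list_prod, List.map_ofFn]
  rw [← Finset.smul_sum, Finset.sum_comm]
  congr 1
  refine Finset.sum_congr rfl fun j _ => ?_
  rw [← Finset.smul_sum]
  congr 1
  have := MultilinearMap.map_sum_finset (MultilinearMap.mkPiAlgebraFin K c (Form K m))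
    (fun a l => if a = j then bary K l ⊗ₜ[K] (1 : ExteriorAlgebra K (Fin m → K))
      else (1 : MvPolynomial (Fin m) K) ⊗ₜ[K] ExteriorAlgebra.ι K (dBary K l))
    (fun a => Finset.univ.filter fun l => θ l = v a)
  simp only [MultilinearMap.mkPiAlgebraFin_apply] at this
  rw [← this]
  congr 2
  ext a
  simp only [Function.comp]
  split_ifs <;> simp [hb, hd]

/-- The pairing of the Euler vector field centered at a vertex with constant one-forms. -/
noncomputable def eulerPair (i : Fin (n + 1)) : (Fin n → K) →ₗ[K] MvPolynomial (Fin n) K :=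
  Fintype.linearCombination K fun j => MvPolynomial.X j - if i = j.succ then 1 else 0

theorem eulerPair_dBary (i l : Fin (n + 1)) :
    eulerPair i (dBary K l) = bary K l - if i = l then 1 else 0 := by
  have h : ∀ j : Fin n, eulerPair i (dBary K j.succ) =
      bary K j.succ - if i = j.succ then 1 else 0 := by
    intro j
    simp only [eulerPair, dBary, bary, Fin.cons_succ]
    exact Fintype.linearCombination_apply_single _ _ _ _ |>.trans (one_smul _ _)
  refine Fin.cases ?_ h l
  have h1 : eulerPair i (∑ l, dBary K l) = ∑ l, (bary K l - if i = l then 1 else 0) := by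
    rw [sum_dBary, map_zero, Finset.sum_sub_distrib, sum_bary]
    simp
  rw [map_sum, Fin.sum_univ_succ, Fin.sum_univ_succ, Finset.sum_congr rfl fun j _ => h j] at h1
  exact add_right_cancel h1

theorem polyPull_eulerPair (θ : Fin (m + 1) → Fin (n + 1)) (i : Fin (m + 1)) (x : Fin n → K) :
    polyPull K θ (eulerPair (θ i) x) = eulerPair i (covPull K θ x) := by
  suffices h : (polyPull K θ).toLinearMap ∘ₗ eulerPair (θ i) = eulerPair i ∘ₗ covPull K θ from
    LinearMap.congr_fun h x
  refine cov_ext fun l => ?_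
  simp only [LinearMap.comp_apply, eulerPair_dBary, covPull_dBary, map_sum, AlgHom.toLinearMap_apply,
    map_sub, polyPull_bary, Finset.sum_sub_distrib]
  congr 1
  by_cases h : θ i = l
  · simp [h, Finset.sum_ite_eq]
  · simp [h, Finset.sum_ite_eq]

theorem eulerContract_tmul_algebraMap (i : Fin (n + 1)) (p : MvPolynomial (Fin n) K) (r : K) :
    eulerContract K i (p ⊗ₜ algebraMap K _ r) = 0 := by
  simp [eulerContract, LinearMap.sum_apply]

theorem eulerContract_tmul_ι_mul (i : Fin (n + 1)) (p : MvPolynomial (Fin n) K) (x : Fin n → K)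
    (y : ExteriorAlgebra K (Fin n → K)) :
    eulerContract K i (p ⊗ₜ (ExteriorAlgebra.ι K x * y)) =
      (eulerPair i x ⊗ₜ 1) * (p ⊗ₜ y) -
        (1 ⊗ₜ ExteriorAlgebra.ι K x) * eulerContract K i (p ⊗ₜ y) := by
  simp only [eulerContract, LinearMap.sum_apply, TensorProduct.map_tmul, LinearMap.mulLeft_apply]
  have : ∀ j, CliffordAlgebra.contractLeft (Q := (0 : QuadraticForm K (Fin n → K)))
      (LinearMap.proj j) (ExteriorAlgebra.ι K x * y) = x j • y - ExteriorAlgebra.ι K x *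
        CliffordAlgebra.contractLeft (Q := (0 : QuadraticForm K (Fin n → K)))
          (LinearMap.proj j) y := fun j => CliffordAlgebra.contractLeft_ι_mul _ _ _
  simp only [this, TensorProduct.tmul_sub, Finset.sum_sub_distrib, Finset.mul_sum,
    Algebra.TensorProduct.tmul_mul_tmul, one_mul, eulerPair, Fintype.linearCombination_apply,
    Finset.sum_mul, TensorProduct.sum_tmul]
  congr 1
  refine Finset.sum_congr rfl fun j _ => ?_
  rw [TensorProduct.tmul_smul, smul_mul_assoc, TensorProduct.smul_tmul']

theorem tmul_one_comm (p : MvPolynomial (Fin n) K) (ω : Form K n) :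
    (p ⊗ₜ 1) * ω = ω * (p ⊗ₜ 1) := by
  induction ω using TensorProduct.induction_on with
  | zero => simp
  | add x y hx hy => rw [mul_add, add_mul, hx, hy]
  | tmul a b => simp [mul_comm]

theorem eulerContract_poly_mul (i : Fin (n + 1)) (p : MvPolynomial (Fin n) K) (ω : Form K n) :
    eulerContract K i ((p ⊗ₜ 1) * ω) = (p ⊗ₜ 1) * eulerContract K i ω := by
  induction ω using TensorProduct.induction_on with
  | zero => simp
  | add x y hx hy => rw [mul_add, map_add, map_add, mul_add, hx, hy]
  | tmul a b =>
    simp only [eulerContract, LinearMap.sum_apply, TensorProduct.map_tmul, LinearMap.mulLeft_apply,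
      Algebra.TensorProduct.tmul_mul_tmul, one_mul, Finset.mul_sum]
    exact Finset.sum_congr rfl fun j _ => by rw [mul_left_comm]

theorem eulerContract_ι_mul (i : Fin (n + 1)) (x : Fin n → K) (ω : Form K n) :
    eulerContract K i ((1 ⊗ₜ ExteriorAlgebra.ι K x) * ω) =
      (eulerPair i x ⊗ₜ 1) * ω - (1 ⊗ₜ ExteriorAlgebra.ι K x) * eulerContract K i ω := by
  induction ω using TensorProduct.induction_on with
  | zero => simp
  | add y z hy hz => simp only [mul_add, map_add, hy, hz]; abel
  | tmul a b =>
    rw [Algebra.TensorProduct.tmul_mul_tmul, one_mul, eulerContract_tmul_ι_mul]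

/-- Induction over forms: they are generated by polynomials under left multiplication by
constant one-forms. -/
theorem form_induction {P : Form K n → Prop} (poly : ∀ p : MvPolynomial (Fin n) K, P (p ⊗ₜ 1))
    (add : ∀ x y, P x → P y → P (x + y))
    (mul : ∀ (x : Fin n → K) (ω : Form K n), P ω → P ((1 ⊗ₜ ExteriorAlgebra.ι K x) * ω))
    (ω : Form K n) : P ω := by
  have zero : P 0 := by simpa using poly 0
  induction ω using TensorProduct.induction_on with
  | zero => exact zero
  | add x y hx hy => exact add x y hx hy
  | tmul p y =>
    induction y using CliffordAlgebra.left_induction generalizing p with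
    | algebraMap r =>
      rw [Algebra.algebraMap_eq_smul_one, TensorProduct.tmul_smul, TensorProduct.smul_tmul']
      exact poly _
    | add y z hy hz => rw [TensorProduct.tmul_add]; exact add _ _ (hy p) (hz p)
    | ι_mul y x hy =>
      have := mul x _ (hy p)
      rwa [Algebra.TensorProduct.tmul_mul_tmul, one_mul] at this

theorem formPull_ι (θ : Fin (m + 1) → Fin (n + 1)) (x : Fin n → K) :
    formPull K θ (1 ⊗ₜ ExteriorAlgebra.ι K x) = 1 ⊗ₜ ExteriorAlgebra.ι K (covPull K θ x) := by
  simp [formPull]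

theorem formPull_poly (θ : Fin (m + 1) → Fin (n + 1)) (p : MvPolynomial (Fin n) K) :
    formPull K θ (p ⊗ₜ 1) = polyPull K θ p ⊗ₜ 1 := by
  simp [formPull]

theorem eulerContract_poly (i : Fin (n + 1)) (p : MvPolynomial (Fin n) K) :
    eulerContract K i (p ⊗ₜ 1) = 0 := by
  simpa using eulerContract_tmul_algebraMap i p 1

theorem formPull_eulerContract (θ : Fin (m + 1) → Fin (n + 1)) (i : Fin (m + 1)) (ω : Form K n) :
    formPull K θ (eulerContract K (θ i) ω) = eulerContract K i (formPull K θ ω) := by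
  induction ω using form_induction with
  | poly p => rw [formPull_poly, eulerContract_poly, eulerContract_poly, map_zero]
  | add x y hx hy => simp only [map_add, hx, hy]
  | mul x ω h =>
    rw [map_mul (formPull K θ), formPull_ι, eulerContract_ι_mul, eulerContract_ι_mul, map_sub, map_mul, map_mul,
      formPull_ι, formPull_poly, h, polyPull_eulerPair]

theorem eulerContract_eulerContract (i : Fin (n + 1)) (ω : Form K n) :
    eulerContract K i (eulerContract K i ω) = 0 := by
  induction ω using form_induction with
  | poly p => rw [eulerContract_poly, map_zero]
  | add x y hx hy => simp only [map_add, hx, hy, add_zero]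
  | mul x ω h =>
    rw [eulerContract_ι_mul, map_sub, eulerContract_poly_mul, eulerContract_ι_mul, h]
    simp

theorem dilate_poly (i : Fin (n + 1)) (p : MvPolynomial (Fin n) K) :
    dilate K i (p ⊗ₜ 1) = (polyDilate K i p).map
      (Algebra.TensorProduct.includeLeft (R := K) (S := K)
        (B := ExteriorAlgebra K (Fin n → K))).toRingHom := by
  simp [dilate]

theorem dilate_ι_mul (i : Fin (n + 1)) (x : Fin n → K) (ω : Form K n) :
    dilate K i ((1 ⊗ₜ ExteriorAlgebra.ι K x) * ω) =
      Polynomial.X * (Polynomial.C (1 ⊗ₜ ExteriorAlgebra.ι K x) * dilate K i ω) := by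
  induction ω using TensorProduct.induction_on with
  | zero => simp
  | add y z hy hz => simp only [mul_add, map_add, hy, hz]
  | tmul a b =>
    simp only [Algebra.TensorProduct.tmul_mul_tmul, one_mul, dilate, TensorProduct.lift.tmul,
      LinearMap.flip_apply, LinearMap.compl₁₂_apply, LinearMap.mul_apply', map_mul,
      AlgHom.toLinearMap_apply]
    have : extDilate K n (ExteriorAlgebra.ι K x) =
        Polynomial.X * Polynomial.C (1 ⊗ₜ ExteriorAlgebra.ι K x) := by simp [extDilate]
    rw [this]
    simp only [mul_assoc]

theorem polyDilate_bary (i l : Fin (n + 1)) :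
    polyDilate K i (bary K l) = Polynomial.X * Polynomial.C (bary K l) +
      (1 - Polynomial.X) * (if i = l then 1 else 0) := by
  have h : ∀ j : Fin n, polyDilate K i (bary K j.succ) = Polynomial.X * Polynomial.C (bary K j.succ)
      + (1 - Polynomial.X) * (if i = j.succ then 1 else 0) := by
    intro j
    simp [polyDilate, bary]
  refine Fin.cases ?_ h l
  have h1 : polyDilate K i (∑ l, bary K l) = ∑ l, (Polynomial.X * Polynomial.C (bary K l) +
      (1 - Polynomial.X) * (if i = l then 1 else 0)) := by
    rw [sum_bary, map_one, Finset.sum_add_distrib, ← Finset.mul_sum, ← Finset.mul_sum, ← map_sum,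
      sum_bary]
    simp
  rw [map_sum, Fin.sum_univ_succ, Fin.sum_univ_succ, Finset.sum_congr rfl fun j _ => h j] at h1
  exact add_right_cancel h1

theorem polyPull_polyDilate (θ : Fin (m + 1) → Fin (n + 1)) (i : Fin (m + 1))
    (p : MvPolynomial (Fin n) K) :
    (polyDilate K (θ i) p).map (polyPull K θ).toRingHom = polyDilate K i (polyPull K θ p) := by
  suffices h : (Polynomial.mapAlgHom (polyPull K θ)).comp (polyDilate K (θ i)) =
      (polyDilate K i).comp (polyPull K θ) from DFunLike.congr_fun h p
  refine poly_ext fun l => ?_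
  simp only [AlgHom.comp_apply, polyDilate_bary, polyPull_bary, map_sum, map_add, map_mul, map_sub,
    map_one, Finset.sum_add_distrib, ← Finset.mul_sum]
  have hX : Polynomial.mapAlgHom (polyPull K θ) Polynomial.X = Polynomial.X := by simp
  have hC : ∀ a, Polynomial.mapAlgHom (polyPull K θ) (Polynomial.C a) =
      Polynomial.C (polyPull K θ a) := by simp
  rw [hX, hC, polyPull_bary, map_sum]
  congr 2
  by_cases h : θ i = l
  · simp [h, Finset.sum_ite_eq]
  · simp [h, Finset.sum_ite_eq]

theorem formPull_dilate (θ : Fin (m + 1) → Fin (n + 1)) (i : Fin (m + 1)) (ω : Form K n) :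
    (dilate K (θ i) ω).map (formPull K θ).toRingHom = dilate K i (formPull K θ ω) := by
  induction ω using form_induction with
  | poly p =>
    rw [formPull_poly, dilate_poly, dilate_poly, ← polyPull_polyDilate, Polynomial.map_map,
      Polynomial.map_map]
    congr 1
    ext <;> simp [formPull]
  | add x y hx hy => simp only [map_add, Polynomial.map_add, hx, hy]
  | mul x ω h =>
    rw [map_mul (formPull K θ), formPull_ι, dilate_ι_mul, dilate_ι_mul, Polynomial.map_mul, Polynomial.map_mul, h]
    simp [formPull_ι]

theorem coneHomotopy_apply (i : Fin (n + 1)) (ω : Form K n) :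
    coneHomotopy K i ω = -(dilate K i (eulerContract K i ω)).sum fun k y => (k : K)⁻¹ • y := rfl

theorem formPull_coneHomotopy (θ : Fin (m + 1) → Fin (n + 1)) (i : Fin (m + 1)) (ω : Form K n) :
    formPull K θ (coneHomotopy K (θ i) ω) = coneHomotopy K i (formPull K θ ω) := by
  rw [coneHomotopy_apply, coneHomotopy_apply, ← formPull_eulerContract, ← formPull_dilate, map_neg]
  congr 1
  rw [Polynomial.sum_over_range' _ (by simp) _ (Nat.lt_succ_self _),
    Polynomial.sum_over_range' _ (by simp) _ (Nat.lt_succ_of_le Polynomial.natDegree_map_le)]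
  simp

theorem polyDilate_eulerPair (i : Fin (n + 1)) (x : Fin n → K) :
    polyDilate K i (eulerPair i x) = Polynomial.X * Polynomial.C (eulerPair i x) := by
  suffices h : (polyDilate K i).toLinearMap ∘ₗ eulerPair i = LinearMap.mulLeft K Polynomial.X ∘ₗ
      (Polynomial.CAlgHom (R := K)).toLinearMap ∘ₗ eulerPair i from LinearMap.congr_fun h x
  refine cov_ext fun l => ?_
  simp only [LinearMap.comp_apply, AlgHom.toLinearMap_apply, eulerPair_dBary, map_sub,
    polyDilate_bary, LinearMap.mulLeft_apply, Polynomial.CAlgHom_apply]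
  split_ifs <;> simp
  ring

theorem dilate_eulerPair_mul (i : Fin (n + 1)) (x : Fin n → K) (ω : Form K n) :
    dilate K i ((eulerPair i x ⊗ₜ 1) * ω) =
      Polynomial.X * (Polynomial.C (eulerPair i x ⊗ₜ 1) * dilate K i ω) := by
  have hc : ∀ (p : MvPolynomial (Fin n) K) (y : Polynomial (Form K n)),
      y * Polynomial.C (p ⊗ₜ 1) = Polynomial.C (p ⊗ₜ 1) * y := by
    intro p y
    ext1 k
    rw [Polynomial.coeff_mul_C, Polynomial.coeff_C_mul, tmul_one_comm]
  induction ω using TensorProduct.induction_on with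
  | zero => simp
  | add y z hy hz => simp only [mul_add, map_add, hy, hz]
  | tmul a b =>
    rw [Algebra.TensorProduct.tmul_mul_tmul, one_mul]
    simp only [dilate, TensorProduct.lift.tmul, LinearMap.flip_apply, LinearMap.compl₁₂_apply,
      LinearMap.mul_apply', AlgHom.toLinearMap_apply, map_mul, AlgHom.comp_apply,
      polyDilate_eulerPair]
    have : ∀ y : MvPolynomial (Fin n) K, Polynomial.mapAlgHom (Algebra.TensorProduct.includeLeft
        (R := K) (S := K) (A := MvPolynomial (Fin n) K) (B := ExteriorAlgebra K (Fin n → K)))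
        (Polynomial.C y) = Polynomial.C (y ⊗ₜ 1) := by simp
    rw [this]
    have hX : Polynomial.mapAlgHom (Algebra.TensorProduct.includeLeft
        (R := K) (S := K) (A := MvPolynomial (Fin n) K) (B := ExteriorAlgebra K (Fin n → K)))
        Polynomial.X = Polynomial.X := by simp
    rw [hX, ← mul_assoc, ← mul_assoc, ← Polynomial.X_mul, mul_assoc Polynomial.X, hc]
    simp only [mul_assoc]

theorem eulerContract_dilate (i : Fin (n + 1)) (ω : Form K n) (k : ℕ) :
    eulerContract K i ((dilate K i ω).coeff k) = (dilate K i (eulerContract K i ω)).coeff k := by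
  induction ω using form_induction generalizing k with
  | poly p =>
    rw [eulerContract_poly, map_zero, Polynomial.coeff_zero, dilate_poly, Polynomial.coeff_map]
    exact eulerContract_poly _ _
  | add x y hx hy => simp only [map_add, Polynomial.coeff_add, hx, hy]
  | mul x ω h =>
    rw [eulerContract_ι_mul, map_sub, dilate_eulerPair_mul, dilate_ι_mul, dilate_ι_mul]
    cases k with
    | zero => simp
    | succ k => simp [Polynomial.coeff_X_mul, eulerContract_ι_mul, h]

theorem coneHomotopy_coneHomotopy (i : Fin (n + 1)) :
    coneHomotopy K i * coneHomotopy K i = 0 := by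
  refine LinearMap.ext fun ω => ?_
  have : eulerContract K i (coneHomotopy K i ω) = 0 := by
    rw [coneHomotopy_apply, Polynomial.sum_def, map_neg, map_sum]
    simp [eulerContract_dilate, eulerContract_eulerContract]
  rw [Module.End.mul_apply, coneHomotopy_apply, this]
  simp

theorem formPull_iterHomotopy {c : ℕ} (θ : Fin (m + 1) → Fin (n + 1)) (v : Fin c → Fin (m + 1))
    (ω : Form K n) :
    formPull K θ (iterHomotopy K (θ ∘ v) ω) = iterHomotopy K v (formPull K θ ω) := by
  induction c generalizing ω with
  | zero => simp [iterHomotopy]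
  | succ c ih =>
    have h : ∀ {n : ℕ} (w : Fin (c + 1) → Fin (n + 1)) (ω : Form K n), iterHomotopy K w ω =
        iterHomotopy K (fun a => w a.succ) (coneHomotopy K (w 0) ω) := by
      intro n w ω
      simp [iterHomotopy, List.ofFn_succ]
    rw [h, h]
    have := ih (fun a => v a.succ) (coneHomotopy K (θ (v 0)) ω)
    rw [formPull_coneHomotopy] at this
    exact this

theorem iterHomotopy_eq_zero {c : ℕ} (v : Fin c → Fin (n + 1)) (hv : Monotone v)
    (h : ¬ Function.Injective v) : iterHomotopy K v = 0 := by
  induction c with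
  | zero => exact absurd (Function.injective_of_subsingleton v) h
  | succ c ih =>
    have hs : iterHomotopy K v = iterHomotopy K (fun a => v a.succ) * coneHomotopy K (v 0) := by
      simp [iterHomotopy, List.ofFn_succ]
    by_cases ht : Function.Injective fun a : Fin c => v a.succ
    · have : ∃ b : Fin c, v b.succ = v 0 := by
        by_contra! hb
        apply h
        intro a b
        refine Fin.cases ?_ (fun a => ?_) a <;> refine Fin.cases ?_ (fun b => ?_) b
        · simp
        · exact fun h => absurd h.symm (hb b)
        · exact fun h => absurd h (hb a)
        · exact fun h => congrArg Fin.succ (ht h)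
      obtain ⟨b, hb⟩ := this
      cases c with
      | zero => exact b.elim0
      | succ c =>
        have h1 : v (Fin.succ 0) = v 0 := le_antisymm
          ((hv (Fin.succ_le_succ_iff.2 (Fin.zero_le b))).trans hb.le) (hv (Fin.zero_le _))
        have hs' : iterHomotopy K (fun a => v a.succ) =
            iterHomotopy K (fun a => v a.succ.succ) * coneHomotopy K (v (Fin.succ 0)) := by
          simp [iterHomotopy, List.ofFn_succ]
        rw [hs, hs', h1, mul_assoc, coneHomotopy_coneHomotopy, mul_zero]
    · rw [hs, ih _ (fun a b hab => hv (Fin.succ_le_succ_iff.2 hab)) ht, zero_mul]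

theorem Face.card_eq (I : Face n) : I.1.card = I.dim + 1 :=
  (Nat.succ_pred_eq_of_pos I.2.card_pos).symm

theorem Face.vertex_strictMono (I : Face n) : StrictMono I.vertex :=
  (I.1.orderEmbOfFin _).strictMono

theorem Face.vertex_mem (I : Face n) (a) : I.vertex a ∈ I.1 :=
  I.1.orderEmbOfFin_mem _ a

theorem Face.image_vertex (I : Face n) : Finset.univ.image I.vertex = I.1 :=
  I.1.image_orderEmbOfFin_univ _

theorem whitney_face {c : ℕ} (I : Face n) (h : I.1.card = c) :
    whitney K (I.1.orderEmbOfFin h) = whitney K I.vertex := by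
  obtain rfl : c = I.dim + 1 := h.symm.trans I.card_eq
  rfl

theorem iterHomotopy_face {c : ℕ} (I : Face n) (h : I.1.card = c) :
    iterHomotopy K (I.1.orderEmbOfFin h) = iterHomotopy K I.vertex := by
  obtain rfl : c = I.dim + 1 := h.symm.trans I.card_eq
  rfl

theorem formPull_whitney_face (θ : Fin (m + 1) → Fin (n + 1)) (hθ : Monotone θ) (I : Face n) :
    formPull K θ (whitney K I.vertex) =
      ∑ J : Face m with J.1.image θ = I.1 ∧ J.1.card = I.1.card, whitney K J.vertex := by
  rw [formPull_whitney]
  have hm : ∀ l ∈ Fintype.piFinset (fun a => Finset.univ.filter fun l => θ l = I.vertex a),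
      θ ∘ l = I.vertex := by
    intro l hl
    ext1 a
    simpa using Fintype.mem_piFinset.1 hl a
  have hs : ∀ l ∈ Fintype.piFinset (fun a => Finset.univ.filter fun l => θ l = I.vertex a),
      StrictMono l := by
    intro l hl a b hab
    have h := I.vertex_strictMono hab
    rw [← hm l hl] at h
    exact hθ.reflect_lt h
  have hc : ∀ l ∈ Fintype.piFinset (fun a => Finset.univ.filter fun l => θ l = I.vertex a),
      (Finset.univ.image l).card = I.dim + 1 := by
    intro l hl
    rw [Finset.card_image_of_injective _ (hs l hl).injective, Finset.card_univ, Fintype.card_fin]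
  refine Finset.sum_bij (fun l _ => ⟨Finset.univ.image l, Finset.univ_nonempty.image l⟩) ?_ ?_ ?_ ?_
  · intro l hl
    simp only [Finset.mem_filter, Finset.mem_univ, true_and]
    rw [hc l hl, I.card_eq, Finset.image_image, hm l hl, I.image_vertex]
    exact ⟨rfl, rfl⟩
  · intro l hl l' hl' h
    have h := congrArg Subtype.val h
    simp only at h
    have e1 := Finset.orderEmbOfFin_unique (hc l hl) (fun x => by simp) (hs l hl)
    have e2 := Finset.orderEmbOfFin_unique (hc l hl) (f := l') (fun x => by rw [h]; simp)
      (hs l' hl')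
    rw [e1, e2]
  · intro J hJ
    simp only [Finset.mem_filter, Finset.mem_univ, true_and] at hJ
    have hJ2 : J.1.card = I.dim + 1 := hJ.2.trans I.card_eq
    have hinj : Set.InjOn θ J.1 := Finset.card_image_iff.1 (by rw [hJ.1, hJ.2])
    have hmono : StrictMono (θ ∘ J.1.orderEmbOfFin hJ2) := by
      refine (hθ.comp (J.1.orderEmbOfFin hJ2).monotone).strictMono_of_injective ?_
      intro a b hab
      exact (J.1.orderEmbOfFin hJ2).injective
        (hinj (J.1.orderEmbOfFin_mem _ _) (J.1.orderEmbOfFin_mem _ _) hab)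
    have he : θ ∘ J.1.orderEmbOfFin hJ2 = I.vertex :=
      Finset.orderEmbOfFin_unique I.card_eq (fun x => by
        rw [← hJ.1]
        exact Finset.mem_image_of_mem θ (J.1.orderEmbOfFin_mem _ _)) hmono
    refine ⟨J.1.orderEmbOfFin hJ2, ?_, ?_⟩
    · rw [Fintype.mem_piFinset]
      intro a
      simp [← he]
    · exact Subtype.ext (J.1.image_orderEmbOfFin_univ hJ2)
  · intro l hl
    rw [← whitney_face _ (hc l hl)]
    congr 1
    exact Finset.orderEmbOfFin_unique (hc l hl) (fun x => by simp) (hs l hl)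

theorem sum_faces {M : Type*} [AddCommMonoid M] (θ : Fin (m + 1) → Fin (n + 1))
    (F : Face m → Face n → M) :
    ∑ I : Face n, ∑ J : Face m with J.1.image θ = I.1 ∧ J.1.card = I.1.card, F J I =
      ∑ J : Face m, if (J.1.image θ).card = J.1.card then F J ⟨J.1.image θ, J.2.image θ⟩ else 0 := by
  simp only [Finset.sum_filter]
  rw [Finset.sum_comm]
  refine Finset.sum_congr rfl fun J _ => ?_
  rw [Finset.sum_eq_single ⟨J.1.image θ, J.2.image θ⟩]
  · simp [eq_comm]
  · intro I _ hI
    rw [if_neg]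
    rintro ⟨h, -⟩
    exact hI (Subtype.ext h.symm)
  · simp

theorem comp_vertex (θ : Fin (m + 1) → Fin (n + 1)) (hθ : Monotone θ) (J : Face m)
    (h : (J.1.image θ).card = J.1.card) :
    θ ∘ J.vertex = (J.1.image θ).orderEmbOfFin (h.trans J.card_eq) := by
  have hinj : Set.InjOn θ J.1 := Finset.card_image_iff.1 h
  refine Finset.orderEmbOfFin_unique _ (fun a => Finset.mem_image_of_mem θ (J.vertex_mem a)) ?_
  refine (hθ.comp J.vertex_strictMono.monotone).strictMono_of_injective ?_
  intro a b hab
  exact J.vertex_strictMono.injective (hinj (J.vertex_mem a) (J.vertex_mem b) hab)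

theorem not_injective_comp_vertex (θ : Fin (m + 1) → Fin (n + 1)) (J : Face m)
    (h : (J.1.image θ).card ≠ J.1.card) : ¬ Function.Injective (θ ∘ J.vertex) := by
  intro hi
  apply h
  rw [← J.image_vertex, Finset.image_image, Finset.card_image_of_injective _ hi,
    Finset.card_image_of_injective _ J.vertex_strictMono.injective]

theorem formPull_dupont (θ : Fin (m + 1) → Fin (n + 1)) (hθ : Monotone θ) (ω : Form K n) :
    formPull K θ (dupont K n ω) = dupont K m (formPull K θ ω) := by
  simp only [dupont, LinearMap.sum_apply, map_sum, LinearMap.comp_apply, LinearMap.mulLeft_apply,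
    map_mul, formPull_whitney_face θ hθ, Finset.sum_mul]
  rw [sum_faces θ fun J I => whitney K J.vertex * formPull K θ (iterHomotopy K I.vertex ω)]
  refine Finset.sum_congr rfl fun J _ => ?_
  rw [← formPull_iterHomotopy]
  split_ifs with h
  · rw [comp_vertex θ hθ J h, ← iterHomotopy_face ⟨J.1.image θ, J.2.image θ⟩ (h.trans J.card_eq)]
  · rw [iterHomotopy_eq_zero _ (hθ.comp J.vertex_strictMono.monotone)
      (not_injective_comp_vertex θ J h)]
    simp

theorem formIntegral_eq_zero (θ : Fin (m + 1) → Fin (n + 1)) (h : ¬ Function.Injective θ)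
    (ω : Form K n) : formIntegral K m (formPull K θ ω) = 0 := by
  obtain ⟨a, b, hab, hne⟩ := Function.not_injective_iff.1 h
  -- the vector from the vertex `b` to the vertex `a`
  let w : Fin m → K := fun j => (if a = j.succ then 1 else 0) - if b = j.succ then 1 else 0
  have hw : w ≠ 0 := by
    intro hw
    by_cases ha : a = 0
    · obtain ⟨j, rfl⟩ := Fin.exists_succ_eq_of_ne_zero (x := b) (by rintro rfl; exact hne ha)
      have := congrFun hw j
      simp [w, hne] at this
    · obtain ⟨j, rfl⟩ := Fin.exists_succ_eq_of_ne_zero ha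
      have := congrFun hw j
      simp [w, hne.symm] at this
  have hpair : ∀ x : Fin n → K, ∑ j, covPull K θ x j * w j = 0 := by
    intro x
    let P : (Fin m → K) →ₗ[K] K := Fintype.linearCombination K w
    have hP : ∀ l, P (dBary K l) = (if a = l then 1 else 0) - if b = l then 1 else 0 := by
      have h : ∀ j : Fin m, P (dBary K j.succ) =
          (if a = j.succ then 1 else 0) - if b = j.succ then 1 else 0 := fun j =>
        (Fintype.linearCombination_apply_single _ _ _ _).trans (one_smul _ _)
      intro l
      refine Fin.cases ?_ h l
      have h1 : P (∑ l, dBary K l) = ∑ l, ((if a = l then 1 else 0) - if b = l then 1 else 0) := by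
        rw [sum_dBary, map_zero, Finset.sum_sub_distrib]
        simp
      rw [map_sum, Fin.sum_univ_succ, Fin.sum_univ_succ,
        Finset.sum_congr rfl fun j _ => h j] at h1
      exact add_right_cancel h1
    suffices hz : P ∘ₗ covPull K θ = 0 from LinearMap.congr_fun hz x
    refine cov_ext fun i => ?_
    simp only [LinearMap.comp_apply, covPull_dBary, map_sum, hP, Finset.sum_sub_distrib]
    simp [Finset.sum_ite_eq, hab]
  have htop : topCoeff K m ∘ₗ (ExteriorAlgebra.map (covPull K θ)).toLinearMap = 0 := by
    refine ExteriorAlgebra.lhom_ext fun i => ?_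
    ext v
    simp only [LinearMap.compAlternatingMap_apply, LinearMap.comp_apply, AlgHom.toLinearMap_apply,
      ExteriorAlgebra.map_apply_ιMulti, topCoeff, ExteriorAlgebra.liftAlternating_apply_ιMulti]
    by_cases hi : i = m
    · subst hi
      rw [Pi.single_eq_same]
      refine Matrix.exists_mulVec_eq_zero_iff.1 ⟨w, hw, ?_⟩
      ext r
      exact hpair (v r)
    · rw [Pi.single_eq_of_ne hi]
      simp
  induction ω using TensorProduct.induction_on with
  | zero => simp
  | add x y hx hy => simp [hx, hy]
  | tmul p y =>
    have := LinearMap.congr_fun htop y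
    simp only [LinearMap.comp_apply, AlgHom.toLinearMap_apply, LinearMap.zero_apply] at this
    simp [formPull, formIntegral, this]

end Forms

/-! ## Coefficients -/

section Coefficients

variable (K : Type v) [Field K]

/-- The extension of a multilinear operation `q` on `V` to `A ⊗ V`, for an algebra `A`:
`(a₁ ⊗ v₁, …, a_k ⊗ v_k) ↦ a_k ⋯ a₁ ⊗ q(v₁, …, v_k)`, cf. `extend_tmul` (in reversed order, since
this makes the Koszul signs below simple). -/
noncomputable def extend {A : Type*} [Ring A] [Algebra K A] {V : Type u} [AddCommGroup V]
    [Module K V] : (k : ℕ) → (Fin k → A ⊗[K] V) →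
      MultilinearMap K (fun _ : Fin k => V) V →ₗ[K] A ⊗[K] V
  | 0, _ =>
    { toFun := fun q => 1 ⊗ₜ q Fin.elim0
      map_add' := fun _ _ => by simp [TensorProduct.tmul_add]
      map_smul' := fun _ _ => by simp }
  | k + 1, x => TensorProduct.lift (LinearMap.mk₂ K
      (fun a v => (LinearMap.mulRight K a).rTensor V ∘ₗ extend k (Fin.tail x) ∘ₗ
        LinearMap.applyₗ v ∘ₗ (multilinearCurryLeftEquiv K (fun _ : Fin (k + 1) => V) V).toLinearMap)
      (fun a b v => by
        have : LinearMap.mulRight K (a + b) = LinearMap.mulRight K a + LinearMap.mulRight K b := by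
          ext; simp [mul_add]
        rw [this, LinearMap.rTensor_add, LinearMap.add_comp])
      (fun c a v => by
        have : LinearMap.mulRight K (c • a) = c • LinearMap.mulRight K a := by ext; simp
        rw [this, LinearMap.rTensor_smul, LinearMap.smul_comp])
      (fun a v w => by ext q; simp)
      (fun c a v => by ext q; simp)) (x 0)

theorem extend_tmul {A : Type*} [Ring A] [Algebra K A] {V : Type u} [AddCommGroup V]
    [Module K V] {k : ℕ} (a : Fin k → A) (x : Fin k → V)
    (q : MultilinearMap K (fun _ : Fin k => V) V) :
    extend K k (fun j => a j ⊗ₜ x j) q = (List.ofFn a).reverse.prod ⊗ₜ q x := by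
  induction k with
  | zero => simp [extend, Subsingleton.elim x Fin.elim0]
  | succ k ih =>
    have h : Fin.tail (fun j => a j ⊗ₜ[K] x j) = fun j => Fin.tail a j ⊗ₜ[K] Fin.tail x j := rfl
    simp only [extend, TensorProduct.lift.tmul, LinearMap.mk₂_apply, LinearMap.comp_apply, h, ih]
    simp [List.ofFn_succ]
    rfl

theorem map_extend {A B : Type*} [Ring A] [Algebra K A] [Ring B] [Algebra K B] {V V' : Type u}
    [AddCommGroup V] [Module K V] [AddCommGroup V'] [Module K V'] (φ : A →ₐ[K] B)
    (f : V →ₗ[K] V') {k : ℕ} (x : Fin k → A ⊗[K] V)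
    (q : MultilinearMap K (fun _ : Fin k => V) V) (q' : MultilinearMap K (fun _ : Fin k => V') V')
    (h : ∀ v, f (q v) = q' (fun j => f (v j))) :
    TensorProduct.map φ.toLinearMap f (extend K k x q) =
      extend K k (fun j => TensorProduct.map φ.toLinearMap f (x j)) q' := by
  induction k with
  | zero =>
    simp [extend, h, Subsingleton.elim (fun j : Fin 0 => f (Fin.elim0 j)) Fin.elim0]
  | succ k ih =>
    have key : ∀ (y : A ⊗[K] V) (x' : Fin k → A ⊗[K] V), TensorProduct.map φ.toLinearMap f
        (extend K (k + 1) (Fin.cons y x') q) = extend K (k + 1)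
          (Fin.cons (TensorProduct.map φ.toLinearMap f y)
            (fun j => TensorProduct.map φ.toLinearMap f (x' j))) q' := by
      intro y x'
      simp only [extend, Fin.cons_zero, Fin.tail_cons]
      induction y with
      | zero => simp
      | add y z hy hz => simp only [map_add, LinearMap.add_apply, hy, hz]
      | tmul a v =>
        simp only [TensorProduct.lift.tmul, TensorProduct.map_tmul, LinearMap.mk₂_apply,
          LinearMap.comp_apply]
        have e := ih x' (q.curryLeft v) (q'.curryLeft (f v)) (fun w => by
          simp only [MultilinearMap.curryLeft_apply, h]
          congr 1
          ext j
          refine Fin.cases ?_ (fun j => ?_) j <;> simp)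
        change _ = (LinearMap.mulRight K (φ a)).rTensor V' (extend K k _ (q'.curryLeft (f v)))
        rw [← e]
        change TensorProduct.map φ.toLinearMap f
          ((LinearMap.mulRight K a).rTensor V (extend K k x' (q.curryLeft v))) = _
        generalize extend K k x' (q.curryLeft v) = z
        induction z with
        | zero => simp
        | add y z hy hz => simp only [map_add, hy, hz]
        | tmul b w => simp
    have := key (x 0) (Fin.tail x)
    rw [Fin.cons_self_tail] at this
    rw [this]
    congr 1

variable {K}

/-- The pull-back of nondegenerate cochains (with values in `V`) along the simplicial map
`Δₘ → Δₙ` which is `θ` on vertices: `(θ^* α)_J = α_{θ(J)}` if `θ` is injective on `J`, and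
`0` otherwise. -/
def cochainPull {m n : ℕ} {V : Type u} [AddCommGroup V] [Module K V]
    (θ : Fin (m + 1) → Fin (n + 1)) : (Face n → V) →ₗ[K] (Face m → V) where
  toFun α J := if (J.1.image θ).card = J.1.card then α ⟨J.1.image θ, J.2.image θ⟩ else 0
  map_add' α β := by ext J; simp only [Pi.add_apply]; split_ifs <;> simp
  map_smul' c α := by ext J; simp only [Pi.smul_apply, RingHom.id_apply]; split_ifs <;> simp

variable (L : CompleteLInfty.{u} K) (n : ℕ)

/-- The cochains of degree `k` in `C*(Δₙ; L)`: their values on a face of dimension `i` have degree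
`k - i`. -/
def cochainDeg (k : ℤ) : Submodule K (Face n → L) :=
  Submodule.pi Set.univ fun I => L.deg (k - I.dim)

/-- The filtration `FᵖC*(Δₙ; L) = C*(Δₙ; FᵖL)`. -/
def cochainFilt (p : ℕ) : Submodule K (Face n → L) :=
  Submodule.pi Set.univ fun _ => L.filt p

variable {n} in
/-- The differential of `C*(Δₙ; L)[1] = C*(Δₙ) ⊗ L[1]`:
`(dα)_{i₀ ⋯ i_k} = ∑ⱼ (-1)ʲ α_{i₀ ⋯ i_{j-1} i_{j+1} ⋯ i_k} + (-1)ᵏ q₁(α_{i₀ ⋯ i_k})`. -/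
def cochainD (α : Face n → L) : Face n → L := fun I =>
  (∑ j, if h : (I.1.erase (I.vertex j)).Nonempty then (-1 : ℤ) ^ (j : ℕ) • α ⟨_, h⟩ else 0) +
    (-1 : ℤ) ^ I.dim • L.q 1 (fun _ => α I)

/-- The inclusion of cochains into forms by Whitney's elementary forms. -/
noncomputable def whitneyMap : (Face n → L) →ₗ[K] Form K n ⊗[K] L :=
  ∑ I : Face n, TensorProduct.mk K (Form K n) L (whitney K I.vertex) ∘ₗ LinearMap.proj I

/-- The projection of forms onto cochains by integration over the faces. -/
noncomputable def integralMap : Form K n ⊗[K] L →ₗ[K] (Face n → L) :=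
  LinearMap.pi fun I => (TensorProduct.lid K L).toLinearMap ∘ₗ
    LinearMap.rTensor L (formIntegral K I.dim ∘ₗ (formPull K I.vertex).toLinearMap)

/-- The `L∞` structure (in arities `≥ 2`) of `Ω*(Δₙ; L)[1] = Ω*(Δₙ) ⊗ L[1]` obtained from that of
`L` by extension of scalars: for homogeneous forms `ωⱼ` and elements `lⱼ` of `L`,
`q_k(ω₁ ⊗ l₁, …, ω_k ⊗ l_k) = ± ω₁ ⋯ ω_k ⊗ q_k(l₁, …, l_k)`, where `±` is the Koszul sign, with
exponent `∑ⱼ |ωⱼ| + ∑_{i < j} |lᵢ| |ωⱼ|`.  If the total degrees are `eᵢ = |ωᵢ| + |lᵢ|`, this can be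
rewritten as `± ω_k ⋯ ω₁ ⊗ q_k(l₁, …, l_k)`, where `±` has exponent
`∑ⱼ |ωⱼ| (1 + ∑_{i < j} eᵢ)`. -/
noncomputable def formOp (k : ℕ) (e : Fin k → ℤ) (x : Fin k → Form K n ⊗[K] L) : Form K n ⊗[K] L :=
  extend K k (fun j => if Even (1 + ∑ i with i < j, e i) then x j
    else LinearMap.rTensor L (formParity K n).toLinearMap (x j)) (L.q k)

/-- The `L∞` structure of `C*(Δₙ; L)` induced from that of `Ω*(Δₙ; L)` via homotopy transfer along
Dupont's contraction. -/
noncomputable def cochainOp : (k : ℕ) → (Fin k → ℤ) → (Fin k → (Face n → L)) → (Face n → L) :=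
  transferOp (whitneyMap L n) (integralMap L n) (LinearMap.rTensor L (dupont K n)) (cochainD L)
    (formOp L n)

/-- The set of Maurer-Cartan cochains on `Δₙ` with coefficients in `L`. -/
def mcCochains : Set (Face n → L) :=
  {α | IsMaurerCartan K (cochainDeg L n) (cochainFilt L n) (cochainOp L n) α}

/-! ### Functoriality in the simplex and in the coefficients -/

variable {n} {m : ℕ}

theorem map_formOp {L M : CompleteLInfty.{u} K} (f : L →ₗ[K] M)
    (hf : ∀ (k : ℕ) (x : Fin k → L), f (L.q k x) = M.q k (fun a => f (x a)))
    (φ : Form K n →ₐ[K] Form K m) (hφ : φ.comp (formParity K n) = (formParity K m).comp φ)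
    (k : ℕ) (e : Fin k → ℤ) (x : Fin k → Form K n ⊗[K] L) :
    TensorProduct.map φ.toLinearMap f (formOp L n k e x) =
      formOp M m k e (fun j => TensorProduct.map φ.toLinearMap f (x j)) := by
  rw [formOp, formOp, map_extend K φ f _ _ (M.q k) (hf k)]
  congr 1
  congr 1
  ext1 j
  split_ifs
  · rfl
  · have h1 : TensorProduct.map φ.toLinearMap f ∘ₗ LinearMap.rTensor L (formParity K n).toLinearMap =
        LinearMap.rTensor M (formParity K m).toLinearMap ∘ₗ TensorProduct.map φ.toLinearMap f := by
      refine TensorProduct.ext' fun a v => ?_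
      have := DFunLike.congr_fun hφ a
      simp only [AlgHom.comp_apply] at this
      simp [this]
    exact LinearMap.congr_fun h1 (x j)

theorem cochainPull_cochainD (θ : Fin (m + 1) → Fin (n + 1)) (hθ : Monotone θ) (α : Face n → L) :
    cochainPull (K := K) θ (cochainD L α) = cochainD L (cochainPull (K := K) θ α) := by
  ext1 J
  -- the cochain `θ^* α` on the `j`-th facet of `J`
  have hterm : ∀ j, (if h : (J.1.erase (J.vertex j)).Nonempty then
      (-1 : ℤ) ^ (j : ℕ) • cochainPull (K := K) θ α ⟨_, h⟩ else 0) = (-1 : ℤ) ^ (j : ℕ) •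
        if h : (J.1.erase (J.vertex j)).Nonempty then cochainPull (K := K) θ α ⟨_, h⟩ else 0 := by
    intro j
    split_ifs <;> simp
  by_cases h : (J.1.image θ).card = J.1.card
  · have hinj : Set.InjOn θ J.1 := Finset.card_image_iff.1 h
    have hl : cochainPull (K := K) θ (cochainD L α) J = cochainD L α ⟨J.1.image θ, J.2.image θ⟩ := by
      simp only [cochainPull, LinearMap.coe_mk, AddHom.coe_mk, if_pos h]
    have hr : cochainPull (K := K) θ α J = α ⟨J.1.image θ, J.2.image θ⟩ := by
      simp only [cochainPull, LinearMap.coe_mk, AddHom.coe_mk, if_pos h]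
    have hdim : Face.dim (n := n) ⟨J.1.image θ, J.2.image θ⟩ = J.dim := by simp only [Face.dim, h]
    rw [hl, cochainD, cochainD, hr]
    refine congrArg₂ _ ?_ (by rw [hdim])
    have hsum : ∀ {c : ℕ} (I : Face n) (hc : I.1.card = c + 1),
        (∑ j, if h : (I.1.erase (I.vertex j)).Nonempty then (-1 : ℤ) ^ (j : ℕ) • α ⟨_, h⟩ else 0) =
        ∑ j : Fin (c + 1), if h : (I.1.erase (I.1.orderEmbOfFin hc j)).Nonempty then
          (-1 : ℤ) ^ (j : ℕ) • α ⟨_, h⟩ else 0 := by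
      intro c I hc
      obtain rfl : I.dim = c := by have := I.card_eq; omega
      rfl
    rw [hsum ⟨J.1.image θ, J.2.image θ⟩ (h.trans J.card_eq)]
    refine Finset.sum_congr rfl fun j _ => ?_
    have hv : (J.1.image θ).orderEmbOfFin (h.trans J.card_eq) j = θ (J.vertex j) :=
      (congrFun (comp_vertex θ hθ J h) j).symm
    have he : (J.1.image θ).erase (θ (J.vertex j)) = (J.1.erase (J.vertex j)).image θ := by
      ext i
      simp only [Finset.mem_erase, Finset.mem_image]
      constructor
      · rintro ⟨h1, x, hx, rfl⟩
        exact ⟨x, ⟨fun hxj => h1 (by rw [hxj]), hx⟩, rfl⟩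
      · rintro ⟨x, ⟨h1, hx⟩, rfl⟩
        exact ⟨fun hxj => h1 (hinj hx (J.vertex_mem j) hxj), x, hx, rfl⟩
    have hcard : ((J.1.erase (J.vertex j)).image θ).card = (J.1.erase (J.vertex j)).card :=
      Finset.card_image_iff.2 (hinj.mono fun x hx => Finset.mem_of_mem_erase hx)
    simp only [hv, he, Finset.image_nonempty, cochainPull, LinearMap.coe_mk, AddHom.coe_mk,
      if_pos hcard]
  · have hl : cochainPull (K := K) θ (cochainD L α) J = 0 := by
      simp only [cochainPull, LinearMap.coe_mk, AddHom.coe_mk, if_neg h]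
    have hr : cochainPull (K := K) θ α J = 0 := by
      simp only [cochainPull, LinearMap.coe_mk, AddHom.coe_mk, if_neg h]
    have hq : L.q 1 (fun _ => (0 : L)) = 0 := (L.q 1).map_zero
    rw [hl, cochainD, hr, hq, smul_zero, add_zero]
    simp only [hterm]
    -- two consecutive vertices of `J` with the same image
    obtain ⟨a, ha⟩ : ∃ a : Fin J.dim, θ (J.vertex a.castSucc) = θ (J.vertex a.succ) := by
      by_contra! hne
      refine not_injective_comp_vertex θ J h (StrictMono.injective ?_)
      rw [Fin.strictMono_iff_lt_succ]
      exact fun a => lt_of_le_of_ne (hθ (J.vertex_strictMono.monotone a.castSucc_lt_succ.le)) (hne a)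
    have hzero : ∀ j, j ≠ a.castSucc → j ≠ a.succ → (if h : (J.1.erase (J.vertex j)).Nonempty then
        cochainPull (K := K) θ α ⟨_, h⟩ else 0) = 0 := by
      intro j h1 h2
      split_ifs with hne
      · simp only [cochainPull, LinearMap.coe_mk, AddHom.coe_mk]
        rw [if_neg]
        intro hc
        have hinj := Finset.card_image_iff.1 hc
        have hm : ∀ b, j ≠ b → J.vertex b ∈ ((J.1.erase (J.vertex j) : Finset (Fin (m + 1))) :
            Set (Fin (m + 1))) := fun b hb => by
          rw [Finset.mem_coe, Finset.mem_erase]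
          exact ⟨fun h => hb (J.vertex_strictMono.injective h).symm, J.vertex_mem b⟩
        have := J.vertex_strictMono.injective (hinj (hm _ h1) (hm _ h2) ha)
        exact absurd this a.castSucc_lt_succ.ne
      · rfl
    have himg : (J.1.erase (J.vertex a.castSucc)).image θ = (J.1.erase (J.vertex a.succ)).image θ := by
      have hlt := J.vertex_strictMono a.castSucc_lt_succ
      ext i
      simp only [Finset.mem_image, Finset.mem_erase]
      constructor
      · rintro ⟨x, ⟨_, hx⟩, rfl⟩
        by_cases hxa : x = J.vertex a.succ
        · exact ⟨J.vertex a.castSucc, ⟨hlt.ne, J.vertex_mem _⟩, by rw [hxa, ha]⟩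
        · exact ⟨x, ⟨hxa, hx⟩, rfl⟩
      · rintro ⟨x, ⟨_, hx⟩, rfl⟩
        by_cases hxa : x = J.vertex a.castSucc
        · exact ⟨J.vertex a.succ, ⟨hlt.ne', J.vertex_mem _⟩, by rw [hxa, ha]⟩
        · exact ⟨x, ⟨hxa, hx⟩, rfl⟩
    have hcard : (J.1.erase (J.vertex a.castSucc)).card = (J.1.erase (J.vertex a.succ)).card := by
      rw [Finset.card_erase_of_mem (J.vertex_mem _), Finset.card_erase_of_mem (J.vertex_mem _)]
    have heq : (if h : (J.1.erase (J.vertex a.castSucc)).Nonempty then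
        cochainPull (K := K) θ α ⟨_, h⟩ else 0) = if h : (J.1.erase (J.vertex a.succ)).Nonempty then
        cochainPull (K := K) θ α ⟨_, h⟩ else 0 := by
      have hne : (J.1.erase (J.vertex a.castSucc)).Nonempty ↔
          (J.1.erase (J.vertex a.succ)).Nonempty := by
        rw [← Finset.card_pos, ← Finset.card_pos, hcard]
      by_cases h1 : (J.1.erase (J.vertex a.castSucc)).Nonempty
      · rw [dif_pos h1, dif_pos (hne.1 h1)]
        simp only [cochainPull, LinearMap.coe_mk, AddHom.coe_mk, himg, hcard]
      · rw [dif_neg h1, dif_neg fun h2 => h1 (hne.2 h2)]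
    rw [Finset.sum_eq_add a.castSucc a.succ a.castSucc_lt_succ.ne
      (fun j _ hj => by rw [hzero j hj.1 hj.2, smul_zero]) (by simp) (by simp), heq,
      Fin.val_castSucc, Fin.val_succ, pow_succ, mul_neg_one, neg_smul, add_neg_cancel]

/-- Pull-back of cochains along simplicial maps between simplices preserves the transferred
structure. -/
theorem cochainPull_cochainOp (θ : Fin (m + 1) → Fin (n + 1)) (hθ : Monotone θ) (k : ℕ)
    (e : Fin k → ℤ) (w : Fin k → Face n → L) :
    cochainPull (K := K) θ (cochainOp L n k e w) =
      cochainOp L m k e (fun a => cochainPull (K := K) θ (w a)) := by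
  refine map_transferOp (V := Form K n ⊗[K] L) (V' := Form K m ⊗[K] L) (W := Face n → L)
    (W' := Face m → L) (TensorProduct.map (formPull K θ).toLinearMap (LinearMap.id : L →ₗ[K] L))
    (cochainPull (K := K) θ) ?_ ?_ ?_ ?_ ?_ k e w
  · exact map_formOp LinearMap.id (fun _ _ => rfl) (formPull K θ) (formPull_parity θ)
  · intro α
    simp only [whitneyMap, LinearMap.sum_apply, LinearMap.comp_apply, LinearMap.proj_apply,
      TensorProduct.mk_apply, map_sum, TensorProduct.map_tmul, AlgHom.toLinearMap_apply,
      LinearMap.id_apply, formPull_whitney_face θ hθ, TensorProduct.sum_tmul]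
    rw [sum_faces θ fun J I => whitney K J.vertex ⊗ₜ[K] α I]
    refine Finset.sum_congr rfl fun J _ => ?_
    simp only [cochainPull, LinearMap.coe_mk, AddHom.coe_mk]
    split_ifs <;> simp
  · intro x
    induction x using TensorProduct.induction_on with
    | zero => simp
    | add x y hx hy => simp only [map_add, hx, hy]
    | tmul a v => simp [formPull_dupont θ hθ]
  · intro x
    have hcomp : ∀ {k : ℕ} (ψ : Fin (k + 1) → Fin (m + 1)) (a : Form K n),
        formPull K ψ (formPull K θ a) = formPull K (θ ∘ ψ) a := fun ψ a =>
      DFunLike.congr_fun (formPull_comp (K := K) θ ψ) a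
    induction x using TensorProduct.induction_on with
    | zero => simp
    | add x y hx hy => simp only [map_add, hx, hy]
    | tmul a v =>
      ext1 J
      simp only [cochainPull, integralMap, LinearMap.coe_mk, AddHom.coe_mk, LinearMap.pi_apply,
        LinearMap.comp_apply, LinearMap.rTensor_tmul, TensorProduct.map_tmul,
        AlgHom.toLinearMap_apply, hcomp, LinearEquiv.coe_coe, TensorProduct.lid_tmul,
        LinearMap.id_apply]
      split_ifs with h
      · rw [comp_vertex θ hθ J h]
        have : ∀ {c : ℕ} (I : Face n) (hc : I.1.card = c + 1),
            formIntegral K I.dim (formPull K I.vertex a) =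
              formIntegral K c (formPull K (I.1.orderEmbOfFin hc) a) := by
          intro c I hc
          obtain rfl : I.dim = c := by have := I.card_eq; omega
          rfl
        rw [← this ⟨J.1.image θ, J.2.image θ⟩ (h.trans J.card_eq)]
      · rw [formIntegral_eq_zero _ (not_injective_comp_vertex θ J h), zero_smul]
  · exact cochainPull_cochainD L θ hθ

theorem cochainPull_mem (θ : Fin (m + 1) → Fin (n + 1)) (hθ : Monotone θ) {α : Face n → L}
    (hα : α ∈ mcCochains L n) : cochainPull (K := K) θ α ∈ mcCochains L m := by
  refine ⟨?_, fun p => ?_⟩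
  · rw [cochainDeg, Submodule.mem_pi]
    intro J _
    simp only [cochainPull, LinearMap.coe_mk, AddHom.coe_mk]
    split_ifs with h
    · have := Submodule.mem_pi.1 hα.1 ⟨J.1.image θ, J.2.image θ⟩ trivial
      simpa only [Face.dim, h] using this
    · exact zero_mem _
  · obtain ⟨N, hN⟩ := hα.2 p
    refine ⟨N, fun i hi => ?_⟩
    have h := hN i hi
    simp only [← cochainPull_cochainOp L θ hθ, ← map_smul, ← map_sum]
    rw [cochainFilt, Submodule.mem_pi] at h ⊢
    intro J _
    simp only [cochainPull, LinearMap.coe_mk, AddHom.coe_mk]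
    split_ifs
    · exact h _ trivial
    · exact zero_mem _

theorem cochainPull_id (α : Face n → L) : cochainPull (K := K) id α = α := by
  ext J
  simp [cochainPull]

theorem cochainPull_comp {k : ℕ} (θ : Fin (m + 1) → Fin (n + 1)) (ψ : Fin (k + 1) → Fin (m + 1))
    (α : Face n → L) : cochainPull (K := K) ψ (cochainPull (K := K) θ α) =
      cochainPull (K := K) (θ ∘ ψ) α := by
  ext J
  simp only [cochainPull, LinearMap.coe_mk, AddHom.coe_mk, Finset.image_image]
  have h1 : (J.1.image (θ ∘ ψ)).card ≤ (J.1.image ψ).card := by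
    rw [← Finset.image_image]; exact Finset.card_image_le
  have h2 : (J.1.image ψ).card ≤ J.1.card := Finset.card_image_le
  split_ifs <;> first | rfl | omega

/-- Push-forward of cochains along strict morphisms preserves the transferred structure. -/
theorem push_cochainOp {L M : CompleteLInfty.{u} K} (f : StrictHom L M) (k : ℕ)
    (e : Fin k → ℤ) (w : Fin k → Face n → L) :
    f.toLin.compLeft (Face n) (cochainOp L n k e w) =
      cochainOp M n k e (fun a => f.toLin.compLeft (Face n) (w a)) := by
  refine map_transferOp (TensorProduct.map (AlgHom.id K (Form K n)).toLinearMap f.toLin)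
    (f.toLin.compLeft (Face n)) ?_ ?_ ?_ ?_ ?_ k e w
  · exact map_formOp f.toLin f.map_q (AlgHom.id K _) (by ext <;> simp)
  · intro α
    simp [whitneyMap, LinearMap.sum_apply]
  · intro x
    induction x using TensorProduct.induction_on with
    | zero => simp
    | add x y hx hy => simp only [map_add, hx, hy]
    | tmul a v => simp
  · intro x
    induction x using TensorProduct.induction_on with
    | zero => simp
    | add x y hx hy => simp only [map_add, hx, hy]
    | tmul a v => ext1 J; simp [integralMap]
  · intro α
    ext1 J
    simp only [cochainD, LinearMap.compLeft_apply, Function.comp, map_add, map_sum, map_zsmul,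
      f.map_q]
    congr 1
    refine Finset.sum_congr rfl fun j _ => ?_
    split_ifs <;> simp

theorem push_mem {L M : CompleteLInfty.{u} K} (f : StrictHom L M) {α : Face n → L}
    (hα : α ∈ mcCochains L n) : (fun I => f.toLin (α I)) ∈ mcCochains M n := by
  refine ⟨Submodule.mem_pi.2 fun I _ => f.map_deg _ _ (Submodule.mem_pi.1 hα.1 I trivial),
    fun p => ?_⟩
  obtain ⟨N, hN⟩ := hα.2 p
  refine ⟨N, fun i hi => ?_⟩
  have h := hN i hi
  have e : ∀ k, cochainOp M n k (fun _ => 0) (fun _ => fun I => f.toLin (α I)) =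
      f.toLin.compLeft (Face n) (cochainOp L n k (fun _ => 0) (fun _ => α)) := fun k =>
    (push_cochainOp f k _ _).symm
  simp only [e, ← map_smul, ← map_sum]
  rw [cochainFilt, Submodule.mem_pi] at h ⊢
  intro I _
  rcases Nat.eq_zero_or_pos p with rfl | hp
  · exact M.filt_antitone (Nat.zero_le 1) (by rw [M.filt_one]; trivial)
  · exact f.map_filt p hp _ (h I trivial)

end Coefficients

/-- The functor `Del_∞` from complete `L∞` algebras and strict morphisms to simplicial sets:
`Del_∞(L)ₙ = MC(C*(Δₙ; L))`. -/
noncomputable def delInfty (K : Type v) [Field K] : CompleteLInfty.{u} K ⥤ SSet.{u} where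
  obj L :=
    { obj := fun Δ => mcCochains L Δ.unop.len
      map := fun θ => TypeCat.ofHom fun α =>
        ⟨cochainPull (K := K) θ.unop.toOrderHom α.1,
          cochainPull_mem L _ θ.unop.toOrderHom.monotone α.2⟩
      map_id := fun Δ => ConcreteCategory.hom_ext _ _ fun α => Subtype.ext (cochainPull_id L α.1)
      map_comp := fun θ ψ => ConcreteCategory.hom_ext _ _ fun α => Subtype.ext
        (cochainPull_comp L θ.unop.toOrderHom ψ.unop.toOrderHom α.1).symm }
  map {L M} f :=
    { app := fun Δ => TypeCat.ofHom fun α => ⟨fun I => StrictHom.toLin f (α.1 I), push_mem f α.2⟩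
      naturality := fun Δ Δ' θ => ConcreteCategory.hom_ext _ _ fun α => Subtype.ext <| by
        ext1 J
        change StrictHom.toLin f (cochainPull (K := K) θ.unop.toOrderHom α.1 J) = _
        change _ = cochainPull (K := K) θ.unop.toOrderHom (fun I => StrictHom.toLin f (α.1 I)) J
        simp only [cochainPull, LinearMap.coe_mk, AddHom.coe_mk]
        split_ifs <;> simp }
  map_id _ := rfl
  map_comp _ _ := rfl

end DeligneGetzler

open scoped SSet.modelCategoryQuillen

/-!
The proof rests on one fact: a horn `Λ[n+1, i] → Del_∞(L)` together with an element of `L` of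
degree `-n` has exactly one filler whose value on the top face is this element
(`exists_horn_filler`, `horn_filler_ext`). In particular `Del_∞(L)` is a Kan complex. If `f` is
surjective in the degrees `-n`, a lifting problem is solved by choosing a preimage of the value on
the top face and filling the horn in `L`: the image of the filler is the given simplex of
`Del_∞(M)`, since both fill the same horn and agree on the top face. Conversely, a simplex of
`Del_∞(M)` with trivial horn and top value `y` lifts to a simplex with trivial horn, whose top value
is a preimage of `y`.

A horn and a top value leave open only the value `z` on the facet opposite to the vertex `i`, which
occurs in the simplicial coboundary of the top face with coefficient `±1`. All other contributions
of `z` to the curvature on the top face are of higher filtration (`cochainCurv_add`), so that a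
Newton iteration, convergent by completeness, finds the unique `z` for which the curvature vanishes
on the top face (`exists_mcCochains`, `mcCochains_ext`). It remains to see that the curvature then
vanishes on the missing facet as well. This is a consequence of the Bianchi identity
(`cochainCurv_mem_of_horn`): if the curvature is in `Fᵖ`, then its differential is in `F^{p+1}`
(`cochainD_cochainCurv`), and on the top face this differential is, up to sign and terms known
to be small, the curvature on the missing facet.

The square-zero relation for the transferred operations is not needed for the Bianchi identity of
cochains. Instead, let `Φ` be the image of the cochain `α` under the transferred morphism. With
`D` the total differential of `Ω*(Δₙ) ⊗ L` and `h` Dupont's homotopy, the recursion of homotopy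
transfer and the homotopy formula `D h + h D = ι p - 1` (`dupontMap_totalD`, from `dupont_formD`)
express the curvature of the form `Φ` by that of `α` and by `h D` of the nonlinear part of the
former (`formCurv_diagPhi`). The Bianchi identity for forms (`bianchi`) makes the term with `h D`
small and carries over to `α`. It follows from the square-zero relation for the operations extended
to `Ω*(Δₙ) ⊗ L` (`sum_extendMulti_square`), evaluated on constant tuples, from their graded symmetry
(`extendMulti_eq_opLin`), and from the derivation property of the de Rham differential
(`tensorD_extendMulti`).

Only operations on constant tuples of degree one occur. There the sums over ordered partitions in
homotopy transfer become sums over block sizes weighted by multinomial coefficients (`diagSum_eq`),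
which is exactly the statement that `Φ = ι α + h ∑_{k ≥ 2} q_k(Φ, …, Φ) / k!`. All identities of
power series are used for truncations, modulo terms of higher filtration.

The contraction itself is the polynomial form of Dupont's theorem: the Poincaré lemma for the cone
onto a vertex (`poincare`), Stokes' theorem for polynomial forms (`stokes`), the differential of
Whitney's forms (`formD_whitney`), and the expression of the integral over a face by iterated cone
homotopies (`coneListEval_ofFn`).
-/

namespace DeligneGetzler

/-! ### The de Rham algebra of the simplex -/

section DeRham

variable {K : Type v} [Field K] {n m : ℕ}

variable (K n) in
/-- The forms of degree `d` on the `n`-simplex. -/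
noncomputable def formDeg (d : ℕ) : Submodule K (Form K n) :=
  Submodule.map₂ (TensorProduct.mk K _ _) ⊤ (⋀[K]^d (Fin n → K))

/-- The constant one-form `x`. -/
noncomputable abbrev cov (x : Fin n → K) : Form K n := 1 ⊗ₜ ExteriorAlgebra.ι K x

/-- The function `p`, as a form of degree zero. -/
noncomputable abbrev fn (p : MvPolynomial (Fin n) K) : Form K n := p ⊗ₜ 1

theorem ι_mem_exteriorPower_one (x : Fin n → K) :
    ExteriorAlgebra.ι K x ∈ ⋀[K]^1 (Fin n → K) := by
  have : ExteriorAlgebra.ι K x ∈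
      LinearMap.range (ExteriorAlgebra.ι K : (Fin n → K) →ₗ[K] _) ^ 1 := by
    rw [pow_one]
    exact LinearMap.mem_range_self _ x
  exact this

theorem fn_mem (p : MvPolynomial (Fin n) K) : fn p ∈ formDeg K n 0 :=
  Submodule.apply_mem_map₂ _ trivial (SetLike.GradedOne.one_mem
    (A := fun i : ℕ => ⋀[K]^i (Fin n → K)))

theorem mul_mem_formDeg {a b : ℕ} {x y : Form K n} (hx : x ∈ formDeg K n a)
    (hy : y ∈ formDeg K n b) : x * y ∈ formDeg K n (a + b) := by
  have h : Submodule.map₂ (LinearMap.mul K (Form K n)) (formDeg K n a) (formDeg K n b) ≤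
      formDeg K n (a + b) := by
    rw [Submodule.map₂_le]
    intro x hx y hy
    revert x
    change formDeg K n a ≤ (formDeg K n (a + b)).comap ((LinearMap.mul K (Form K n)).flip y)
    rw [formDeg, Submodule.map₂_le]
    intro p _ w hw
    revert y
    change formDeg K n b ≤ (formDeg K n (a + b)).comap (LinearMap.mul K (Form K n) (p ⊗ₜ w))
    rw [formDeg, Submodule.map₂_le]
    intro p' _ w' hw'
    simp only [Submodule.mem_comap, TensorProduct.mk_apply, LinearMap.mul_apply',
      Algebra.TensorProduct.tmul_mul_tmul]
    exact Submodule.apply_mem_map₂ _ trivial (SetLike.mul_mem_graded hw hw')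
  exact h (Submodule.apply_mem_map₂ _ hx hy)

theorem cov_mem (x : Fin n → K) : cov x ∈ formDeg K n 1 :=
  Submodule.apply_mem_map₂ _ trivial (ι_mem_exteriorPower_one x)

theorem cov_mul_mem {d : ℕ} (x : Fin n → K) {ω : Form K n} (h : ω ∈ formDeg K n d) :
    cov x * ω ∈ formDeg K n (d + 1) := by
  rw [add_comm]
  exact mul_mem_formDeg (cov_mem x) h

/-- Induction over homogeneous forms. -/
theorem formDeg_induction {P : (d : ℕ) → (ω : Form K n) → ω ∈ formDeg K n d → Prop}
    (poly : ∀ p : MvPolynomial (Fin n) K, P 0 (fn p) (fn_mem p))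
    (add : ∀ d x y hx hy, P d x hx → P d y hy → P d (x + y) (add_mem hx hy))
    (mul : ∀ (d : ℕ) (x : Fin n → K) (ω : Form K n) (h : ω ∈ formDeg K n d), P d ω h →
      P (d + 1) (cov x * ω) (cov_mul_mem x h)) {d : ℕ} {ω : Form K n} (h : ω ∈ formDeg K n d) :
    P d ω h := by
  have key : ∀ (d : ℕ) (w : ExteriorAlgebra K (Fin n → K)), w ∈ ⋀[K]^d (Fin n → K) →
      ∀ p : MvPolynomial (Fin n) K, ∃ h, P d (p ⊗ₜ w) h := by
    intro d w hw
    induction hw using Submodule.pow_induction_on_left' with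
    | algebraMap r =>
      intro p
      rw [Algebra.algebraMap_eq_smul_one, TensorProduct.tmul_smul, TensorProduct.smul_tmul']
      exact ⟨_, poly _⟩
    | add x y i hx hy ihx ihy =>
      intro p
      rw [TensorProduct.tmul_add]
      exact ⟨_, add _ _ _ _ _ (ihx p).2 (ihy p).2⟩
    | mem_mul x hx i y hy ih =>
      intro p
      obtain ⟨x, rfl⟩ := hx
      have := mul i x (p ⊗ₜ y) _ (ih p).2
      simp only [Algebra.TensorProduct.tmul_mul_tmul, one_mul] at this
      exact ⟨_, this⟩
  suffices hs : ∀ c : K, ∃ h, P d (c • ω) h by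
    have := hs 1
    simp only [one_smul] at this
    exact this.2
  rw [formDeg, Submodule.map₂_eq_span_image2] at h
  induction h using Submodule.span_induction with
  | mem x hx =>
    obtain ⟨p, _, w, hw, rfl⟩ := hx
    exact fun c => key d w hw (c • p)
  | zero =>
    intro c
    have := key d 0 (zero_mem _) 0
    rw [TensorProduct.tmul_zero] at this
    rw [smul_zero]
    exact this
  | add x y _ _ hx hy =>
    intro c
    rw [smul_add]
    exact ⟨_, add _ _ _ _ _ (hx c).2 (hy c).2⟩
  | smul a x _ hx =>
    intro c
    rw [smul_smul]
    exact hx _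

/-! The two additive group structures on `Form K n`, as a tensor product of modules and as a ring,
agree definitionally but not syntactically. -/

/-- This and the following ring identities are restated for forms, because rewriting with the
general lemmas does not identify the two negations on the tensor product `Form K n`. -/
theorem form_neg_mul (x y : Form K n) : -x * y = -(x * y) := neg_mul x y

theorem form_mul_neg (x y : Form K n) : x * -y = -(x * y) := mul_neg x y

theorem form_neg_smul (c : K) (x : Form K n) : -c • x = -(c • x) := neg_smul c x

theorem form_smul_sub (c : K) (x y : Form K n) : c • (x - y) = c • x - c • y := smul_sub c x y

theorem form_mul_sub (x y z : Form K n) : x * (y - z) = x * y - x * z := mul_sub x y z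

theorem parity_fn (p : MvPolynomial (Fin n) K) : formParity K n (fn p) = fn p := by
  simp [formParity]

theorem parity_cov (x : Fin n → K) : formParity K n (cov x) = -cov x := by
  have : CliffordAlgebra.involute (Q := (0 : QuadraticForm K (Fin n → K)))
      (ExteriorAlgebra.ι K x) = -ExteriorAlgebra.ι K x := CliffordAlgebra.involute_ι x
  simp [formParity, this, TensorProduct.tmul_neg]

theorem parity_of_mem {d : ℕ} {ω : Form K n} (h : ω ∈ formDeg K n d) :
    formParity K n ω = (-1 : K) ^ d • ω := by
  induction h using formDeg_induction with
  | poly p => simp [parity_fn]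
  | add d x y _ _ hx hy => rw [map_add, hx, hy, smul_add]
  | mul d x ω _ h => rw [map_mul, h, parity_cov, pow_succ, mul_neg_one, form_neg_smul, form_neg_mul,
      mul_smul_comm]

theorem parity_parity (ω : Form K n) : formParity K n (formParity K n ω) = ω := by
  induction ω using form_induction with
  | poly p => rw [parity_fn, parity_fn]
  | add x y hx hy => simp only [map_add, hx, hy]
  | mul x ω h => rw [map_mul, map_mul, h, parity_cov, map_neg, parity_cov, neg_neg]

theorem cov_mul_cov (x y : Fin n → K) : cov x * cov y = -(cov y * cov x) := by
  have h : ExteriorAlgebra.ι K x * ExteriorAlgebra.ι K y +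
      ExteriorAlgebra.ι K y * ExteriorAlgebra.ι K x = 0 := ExteriorAlgebra.ι_add_mul_swap x y
  rw [eq_neg_iff_add_eq_zero, Algebra.TensorProduct.tmul_mul_tmul,
    Algebra.TensorProduct.tmul_mul_tmul, ← TensorProduct.tmul_add, h, TensorProduct.tmul_zero]

theorem cov_mul_self (x : Fin n → K) : cov x * cov x = 0 := by
  simp [Algebra.TensorProduct.tmul_mul_tmul]

theorem cov_mul_comm (x : Fin n → K) (ω : Form K n) :
    cov x * ω = formParity K n ω * cov x := by
  induction ω using form_induction with
  | poly p => rw [parity_fn, tmul_one_comm]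
  | add y z hy hz => rw [mul_add, hy, hz, map_add, add_mul]
  | mul y ω h =>
    rw [map_mul, parity_cov, ← mul_assoc, cov_mul_cov, form_neg_mul, mul_assoc, h, form_neg_mul,
        form_neg_mul,
      mul_assoc]

/-- Forms commute in the graded sense. -/
theorem form_mul_comm {a b : ℕ} {x y : Form K n} (hx : x ∈ formDeg K n a)
    (hy : y ∈ formDeg K n b) : x * y = (-1 : K) ^ (a * b) • (y * x) := by
  induction hx using formDeg_induction with
  | poly p => rw [zero_mul, pow_zero, one_smul, tmul_one_comm]
  | add d x z _ _ hx hz => rw [add_mul, hx, hz, mul_add, smul_add]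
  | mul d z x _ h =>
    rw [mul_assoc, h, mul_smul_comm, ← mul_assoc, cov_mul_comm, parity_of_mem hy, smul_mul_assoc,
      smul_mul_assoc, smul_smul, mul_assoc, ← pow_add]
    congr 2
    ring

/-- Forms decompose into homogeneous components. -/
theorem iSup_formDeg : ⨆ d, formDeg K n d = ⊤ := by
  rw [eq_top_iff]
  intro ω hω
  clear hω
  induction ω using form_induction with
  | poly p => exact Submodule.mem_iSup_of_mem 0 (fn_mem p)
  | add x y hx hy => exact add_mem hx hy
  | mul x ω h =>
    induction h using Submodule.iSup_induction' with
    | mem d ω h => exact Submodule.mem_iSup_of_mem (d + 1) (cov_mul_mem x h)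
    | zero => rw [mul_zero]; exact zero_mem _
    | add y z _ _ hy hz => rw [mul_add]; exact add_mem hy hz

/-- A statement on forms can be checked on homogeneous ones. -/
theorem form_homogeneous_induction {P : Form K n → Prop}
    (hom : ∀ d, ∀ ω ∈ formDeg K n d, P ω) (add : ∀ x y, P x → P y → P (x + y)) (ω : Form K n) :
    P ω := by
  have h : ω ∈ ⨆ d, formDeg K n d := by rw [iSup_formDeg]; trivial
  induction h using Submodule.iSup_induction' with
  | mem d ω h => exact hom d ω h
  | zero => exact hom 0 0 (zero_mem _)
  | add y z _ _ hy hz => exact add _ _ hy hz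

/-- There are no nonzero forms of degree greater than the dimension. -/
theorem formDeg_eq_zero {d : ℕ} (hd : n < d) {ω : Form K n} (h : ω ∈ formDeg K n d) : ω = 0 := by
  have hz : ⋀[K]^d (Fin n → K) = ⊥ := by
    rw [← ExteriorAlgebra.ιMulti_span_fixedDegree, Submodule.span_eq_bot]
    rintro _ ⟨w, rfl⟩
    refine AlternatingMap.map_linearDependent _ w fun hw => ?_
    have := hw.fintype_card_le_finrank
    simp at this
    omega
  rw [formDeg, hz, Submodule.map₂_bot_right] at h
  simpa using h

variable (K n) in
/-- The de Rham differential. -/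
noncomputable def formD : Form K n →ₗ[K] Form K n :=
  ∑ j : Fin n, TensorProduct.map (MvPolynomial.pderiv j).toLinearMap
    (LinearMap.mulLeft K (ExteriorAlgebra.ι K (Pi.single j 1)))

theorem formD_fn (p : MvPolynomial (Fin n) K) :
    formD K n (fn p) = ∑ j, MvPolynomial.pderiv j p ⊗ₜ ExteriorAlgebra.ι K (Pi.single j 1) := by
  simp [formD, LinearMap.sum_apply]

theorem formD_fn_mul (p : MvPolynomial (Fin n) K) (ω : Form K n) :
    formD K n (fn p * ω) = formD K n (fn p) * ω + fn p * formD K n ω := by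
  induction ω using TensorProduct.induction_on with
  | zero => simp
  | add x y hx hy => simp only [mul_add, map_add, hx, hy]; abel
  | tmul q w =>
    rw [formD_fn]
    simp only [formD, LinearMap.sum_apply, Algebra.TensorProduct.tmul_mul_tmul, one_mul,
      TensorProduct.map_tmul, Derivation.coeFn_coe, Derivation.leibniz, LinearMap.mulLeft_apply,
      Finset.sum_mul, Finset.mul_sum, ← Finset.sum_add_distrib, smul_eq_mul, TensorProduct.add_tmul]
    refine Finset.sum_congr rfl fun j _ => ?_
    rw [add_comm, mul_comm q]

theorem formD_cov_mul (x : Fin n → K) (ω : Form K n) :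
    formD K n (cov x * ω) = -(cov x * formD K n ω) := by
  induction ω using TensorProduct.induction_on with
  | zero => simp
  | add y z hy hz => simp only [mul_add, map_add, hy, hz, neg_add]
  | tmul q w =>
    simp only [formD, LinearMap.sum_apply, Algebra.TensorProduct.tmul_mul_tmul, one_mul,
      TensorProduct.map_tmul, LinearMap.mulLeft_apply, Finset.mul_sum, ← Finset.sum_neg_distrib]
    refine Finset.sum_congr rfl fun j _ => ?_
    have h := eq_neg_of_add_eq_zero_left
      (ExteriorAlgebra.ι_add_mul_swap (R := K) (Pi.single j (1 : K)) x)
    rw [← mul_assoc, h, neg_mul, TensorProduct.tmul_neg, mul_assoc]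

theorem formD_one : formD K n 1 = 0 := by
  have : formD K n (fn 1) = 0 := by rw [formD_fn]; simp
  exact this

theorem formD_cov (x : Fin n → K) : formD K n (cov x) = 0 := by
  have := formD_cov_mul x (1 : Form K n)
  rwa [mul_one, formD_one, mul_zero, neg_zero] at this

/-- The Leibniz rule. -/
theorem formD_mul (x y : Form K n) :
    formD K n (x * y) = formD K n x * y + formParity K n x * formD K n y := by
  induction x using form_induction with
  | poly p => rw [formD_fn_mul, parity_fn]
  | add x z hx hz => simp only [map_add, add_mul, hx, hz]; abel
  | mul z x h =>
    rw [mul_assoc, formD_cov_mul, h, formD_cov_mul, map_mul, parity_cov]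
    rw [form_neg_mul, form_neg_mul, mul_add, neg_add, ← mul_assoc, ← mul_assoc, form_neg_mul,
        mul_assoc]

theorem formD_C (c : K) : formD K n (fn (MvPolynomial.C c)) = 0 := by
  rw [formD_fn]; simp

theorem formD_X (j : Fin n) : formD K n (fn (MvPolynomial.X j)) = cov (Pi.single j 1) := by
  rw [formD_fn, Finset.sum_eq_single j]
  · simp
  · intro i _ hi
    rw [MvPolynomial.pderiv_X_of_ne hi.symm, TensorProduct.zero_tmul]
  · simp

theorem fn_mul (p q : MvPolynomial (Fin n) K) : fn (p * q) = fn p * fn q := by simp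

theorem fn_add (p q : MvPolynomial (Fin n) K) : fn (p + q) = fn p + fn q :=
  TensorProduct.add_tmul _ _ _

theorem formD_mem {d : ℕ} {ω : Form K n} (h : ω ∈ formDeg K n d) :
    formD K n ω ∈ formDeg K n (d + 1) := by
  induction h using formDeg_induction with
  | poly p =>
    rw [formD_fn]
    refine sum_mem fun j _ => Submodule.apply_mem_map₂ _ trivial ?_
    exact ι_mem_exteriorPower_one _
  | add d x y _ _ hx hy => rw [map_add]; exact add_mem hx hy
  | mul d x ω _ h => rw [formD_cov_mul]; exact neg_mem (cov_mul_mem x h)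

theorem formD_formD (ω : Form K n) : formD K n (formD K n ω) = 0 := by
  induction ω using form_induction with
  | poly p =>
    change formD K n (formD K n (fn p)) = 0
    induction p using MvPolynomial.induction_on with
    | C c => rw [formD_C, map_zero]
    | add p q hp hq => rw [fn_add, map_add, map_add, hp, hq, add_zero]
    | mul_X p j hp =>
      have h1 : formParity K n (formD K n (fn p)) = -formD K n (fn p) := by
        rw [parity_of_mem (formD_mem (fn_mem p)), zero_add, pow_one, form_neg_smul, one_smul]
      rw [fn_mul, formD_mul, formD_X, map_add, formD_mul, hp, formD_mul, formD_cov, h1, parity_fn,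
        formD_X, form_neg_mul]
      simp
  | add x y hx hy => simp only [map_add, hx, hy, add_zero]
  | mul x ω h => rw [formD_cov_mul, map_neg, formD_cov_mul, h, mul_zero, neg_zero, neg_zero]

theorem parity_formD (ω : Form K n) :
    formParity K n (formD K n ω) = -formD K n (formParity K n ω) := by
  induction ω using form_homogeneous_induction with
  | hom d ω h => rw [parity_of_mem (formD_mem h), parity_of_mem h, map_smul, pow_succ, mul_neg_one,
      form_neg_smul]
  | add x y hx hy => simp only [map_add, hx, hy, neg_add]

/-- The form `tᵢ`. -/
noncomputable abbrev tF (i : Fin (n + 1)) : Form K n := fn (bary K i)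

/-- The form `dtᵢ`. -/
noncomputable abbrev dtF (i : Fin (n + 1)) : Form K n := cov (dBary K i)

theorem sum_tF : ∑ i : Fin (n + 1), (tF i : Form K n) = 1 := by
  rw [← TensorProduct.sum_tmul, sum_bary]
  rfl

theorem sum_dtF : ∑ i : Fin (n + 1), (dtF i : Form K n) = 0 := by
  rw [← TensorProduct.tmul_sum, ← map_sum, sum_dBary, map_zero, TensorProduct.tmul_zero]

theorem formD_tF (i : Fin (n + 1)) : formD K n (tF i) = dtF i := by
  have h : ∀ j : Fin n, formD K n (tF j.succ) = dtF j.succ := fun j => formD_X j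
  refine Fin.cases ?_ h i
  have h1 : formD K n (∑ i, tF i) = ∑ i, dtF i := by rw [sum_tF, formD_one, sum_dtF]
  rw [map_sum, Fin.sum_univ_succ, Fin.sum_univ_succ, Finset.sum_congr rfl fun j _ => h j] at h1
  exact add_right_cancel h1

theorem formPull_fn (θ : Fin (m + 1) → Fin (n + 1)) (p : MvPolynomial (Fin n) K) :
    formPull K θ (fn p) = fn (polyPull K θ p) := formPull_poly θ p

theorem formPull_cov (θ : Fin (m + 1) → Fin (n + 1)) (x : Fin n → K) :
    formPull K θ (cov x) = cov (covPull K θ x) := formPull_ι θ x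

theorem formPull_tF (θ : Fin (m + 1) → Fin (n + 1)) (i : Fin (n + 1)) :
    formPull K θ (tF i) = ∑ l with θ l = i, tF l := by
  rw [formPull_fn, polyPull_bary]
  exact TensorProduct.sum_tmul _ _ _

theorem formPull_dtF (θ : Fin (m + 1) → Fin (n + 1)) (i : Fin (n + 1)) :
    formPull K θ (dtF i) = ∑ l with θ l = i, dtF l := by
  rw [formPull_cov, covPull_dBary]
  change 1 ⊗ₜ ExteriorAlgebra.ι K (∑ l with θ l = i, dBary K l) = _
  rw [map_sum, TensorProduct.tmul_sum]

theorem formPull_formD (θ : Fin (m + 1) → Fin (n + 1)) (ω : Form K n) :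
    formPull K θ (formD K n ω) = formD K m (formPull K θ ω) := by
  induction ω using form_induction with
  | poly p =>
    change formPull K θ (formD K n (fn p)) = formD K m (formPull K θ (fn p))
    induction p using MvPolynomial.induction_on with
    | C c =>
      have : polyPull K θ (MvPolynomial.C c) = MvPolynomial.C c := (polyPull K θ).commutes c
      rw [formD_C, formPull_fn, this, formD_C, map_zero]
    | add p q hp hq => rw [fn_add, map_add, map_add, map_add, map_add, hp, hq]
    | mul_X p j hp =>
      have hX : formPull K θ (formD K n (fn (MvPolynomial.X j))) =
          formD K m (formPull K θ (fn (MvPolynomial.X j))) := by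
        change formPull K θ (formD K n (tF j.succ)) = formD K m (formPull K θ (tF j.succ))
        rw [formD_tF, formPull_tF, map_sum, formPull_dtF]
        exact Finset.sum_congr rfl fun l _ => (formD_tF l).symm
      rw [fn_mul, formD_mul, map_add, map_mul (formPull K θ), map_mul (formPull K θ),
        map_mul (formPull K θ), formD_mul, hp, hX]
      congr 2
      exact DFunLike.congr_fun (formPull_parity (K := K) θ) (fn p)
  | add x y hx hy => simp only [map_add, hx, hy]
  | mul x ω h => rw [map_mul (formPull K θ), formPull_cov, formD_cov_mul, formD_cov_mul, map_neg,
      map_mul (formPull K θ), h, formPull_cov]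

theorem formPull_mem (θ : Fin (m + 1) → Fin (n + 1)) {d : ℕ} {ω : Form K n}
    (h : ω ∈ formDeg K n d) : formPull K θ ω ∈ formDeg K m d := by
  induction h using formDeg_induction with
  | poly p => rw [formPull_fn]; exact fn_mem _
  | add d x y _ _ hx hy => rw [map_add]; exact add_mem hx hy
  | mul d x ω _ h => rw [map_mul, formPull_cov]; exact cov_mul_mem _ h

end DeRham

/-! ### The Poincaré lemma -/

section Poincare

variable {K : Type v} [Field K] {n m : ℕ}

/-- Induction over forms: they are generated by the constants under multiplication by the
coordinates centered at the `i`-th vertex and by constant one-forms. -/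
theorem centered_induction (i : Fin (n + 1)) {P : Form K n → Prop}
    (const : ∀ c : K, P (fn (MvPolynomial.C c))) (add : ∀ x y, P x → P y → P (x + y))
    (coord : ∀ (x : Fin n → K) (ω : Form K n), P ω → P (fn (eulerPair i x) * ω))
    (mul : ∀ (x : Fin n → K) (ω : Form K n), P ω → P (cov x * ω)) (ω : Form K n) : P ω := by
  induction ω using form_induction with
  | poly p =>
    change P (fn p)
    induction p using MvPolynomial.induction_on with
    | C c => exact const c
    | add p q hp hq => rw [fn_add]; exact add _ _ hp hq
    | mul_X p j hp =>
      have h1 := coord (dBary K j.succ) (fn p) hp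
      rw [eulerPair_dBary, ← fn_mul] at h1
      have hb : bary K j.succ = MvPolynomial.X j := rfl
      split_ifs at h1
      · have h2 := add _ _ h1 hp
        rw [← fn_add] at h2
        convert h2 using 2
        rw [hb]
        ring
      · convert h1 using 2
        rw [hb]
        ring
  | add x y hx hy => exact add x y hx hy
  | mul x ω h => exact mul x ω h

theorem formD_eulerPair (i : Fin (n + 1)) (x : Fin n → K) :
    formD K n (fn (eulerPair i x)) = cov x := by
  suffices h : formD K n ∘ₗ (Algebra.TensorProduct.includeLeft (R := K) (S := K)
      (A := MvPolynomial (Fin n) K) (B := ExteriorAlgebra K (Fin n → K))).toLinearMap ∘ₗ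
      eulerPair i = (Algebra.TensorProduct.includeRight (R := K) (A := MvPolynomial (Fin n) K)
      (B := ExteriorAlgebra K (Fin n → K))).toLinearMap ∘ₗ ExteriorAlgebra.ι K from
    LinearMap.congr_fun h x
  refine cov_ext fun l => ?_
  change formD K n (fn (eulerPair i (dBary K l))) = dtF l
  rw [eulerPair_dBary]
  have hs : ∀ p q : MvPolynomial (Fin n) K, (fn (p - q) : Form K n) = fn p - fn q := fun p q =>
    TensorProduct.sub_tmul p q _
  split_ifs
  · have h1 : formD K n (fn 1) = 0 := formD_one
    rw [hs, map_sub, h1, formD_tF, sub_zero]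
  · rw [sub_zero, formD_tF]

theorem eulerContract_fn_mul (i : Fin (n + 1)) (p : MvPolynomial (Fin n) K) (ω : Form K n) :
    eulerContract K i (fn p * ω) = fn p * eulerContract K i ω := eulerContract_poly_mul i p ω

theorem eulerContract_cov_mul (i : Fin (n + 1)) (x : Fin n → K) (ω : Form K n) :
    eulerContract K i (cov x * ω) = fn (eulerPair i x) * ω - cov x * eulerContract K i ω :=
  eulerContract_ι_mul i x ω

theorem eulerContract_const (i : Fin (n + 1)) (p : MvPolynomial (Fin n) K) :
    eulerContract K i (fn p) = 0 := eulerContract_poly i p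

theorem dilate_const (i : Fin (n + 1)) (c : K) :
    dilate K i (fn (MvPolynomial.C c)) = Polynomial.C (fn (MvPolynomial.C c)) := by
  have : polyDilate K i (MvPolynomial.C c) = Polynomial.C (MvPolynomial.C c) :=
    (polyDilate K i).commutes c
  rw [dilate_poly, this, Polynomial.map_C]
  rfl

theorem coeff_dilate_coord_zero (i : Fin (n + 1)) (x : Fin n → K) (ω : Form K n) :
    (dilate K i (fn (eulerPair i x) * ω)).coeff 0 = 0 := by
  rw [dilate_eulerPair_mul, Polynomial.coeff_X_mul_zero]

theorem coeff_dilate_coord_succ (i : Fin (n + 1)) (x : Fin n → K) (ω : Form K n) (k : ℕ) :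
    (dilate K i (fn (eulerPair i x) * ω)).coeff (k + 1) =
      fn (eulerPair i x) * (dilate K i ω).coeff k := by
  rw [dilate_eulerPair_mul, Polynomial.coeff_X_mul, Polynomial.coeff_C_mul]

theorem coeff_dilate_cov_zero (i : Fin (n + 1)) (x : Fin n → K) (ω : Form K n) :
    (dilate K i (cov x * ω)).coeff 0 = 0 := by
  rw [dilate_ι_mul, Polynomial.coeff_X_mul_zero]

theorem coeff_dilate_cov_succ (i : Fin (n + 1)) (x : Fin n → K) (ω : Form K n) (k : ℕ) :
    (dilate K i (cov x * ω)).coeff (k + 1) = cov x * (dilate K i ω).coeff k := by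
  rw [dilate_ι_mul, Polynomial.coeff_X_mul, Polynomial.coeff_C_mul]

/-- Pull-back along dilations commutes with the de Rham differential. -/
theorem formD_dilate (i : Fin (n + 1)) (ω : Form K n) (k : ℕ) :
    formD K n ((dilate K i ω).coeff k) = (dilate K i (formD K n ω)).coeff k := by
  induction ω using centered_induction i generalizing k with
  | const c =>
    rw [formD_C, map_zero, Polynomial.coeff_zero, dilate_const, Polynomial.coeff_C]
    split_ifs
    · exact formD_C c
    · exact map_zero _
  | add x y hx hy => simp only [map_add, Polynomial.coeff_add, hx, hy]
  | coord x ω h =>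
    rw [formD_fn_mul, formD_eulerPair, map_add, Polynomial.coeff_add]
    cases k with
    | zero => rw [coeff_dilate_coord_zero, coeff_dilate_coord_zero, coeff_dilate_cov_zero, map_zero,
        add_zero]
    | succ k => rw [coeff_dilate_coord_succ, coeff_dilate_coord_succ, coeff_dilate_cov_succ,
        formD_fn_mul, formD_eulerPair, h]
  | mul x ω h =>
    rw [formD_cov_mul, map_neg, Polynomial.coeff_neg]
    cases k with
    | zero =>
      rw [coeff_dilate_cov_zero, coeff_dilate_cov_zero, map_zero]
      exact neg_zero.symm
    | succ k => rw [coeff_dilate_cov_succ, coeff_dilate_cov_succ, formD_cov_mul, h]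

/-- Cartan's formula: the Lie derivative along the Euler vector field is the derivative of the
pull-back along dilations. -/
theorem dilate_cartan (i : Fin (n + 1)) (ω : Form K n) (k : ℕ) :
    (dilate K i (eulerContract K i (formD K n ω) + formD K n (eulerContract K i ω))).coeff k =
      (k : K) • (dilate K i ω).coeff k := by
  induction ω using centered_induction i generalizing k with
  | const c =>
    rw [formD_C, eulerContract_const, map_zero, map_zero, add_zero, map_zero, Polynomial.coeff_zero,
      dilate_const, Polynomial.coeff_C]
    split_ifs with h
    · simp [h]
    · rw [smul_zero]
  | add x y hx hy =>
    have e : eulerContract K i (formD K n (x + y)) + formD K n (eulerContract K i (x + y)) =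
        (eulerContract K i (formD K n x) + formD K n (eulerContract K i x)) +
        (eulerContract K i (formD K n y) + formD K n (eulerContract K i y)) := by
      simp only [map_add]
      abel
    rw [e, map_add, Polynomial.coeff_add, hx, hy, map_add, Polynomial.coeff_add, smul_add]
  | coord x ω h =>
    have e : eulerContract K i (formD K n (fn (eulerPair i x) * ω)) +
        formD K n (eulerContract K i (fn (eulerPair i x) * ω)) = fn (eulerPair i x) * ω +
        fn (eulerPair i x) *
          (eulerContract K i (formD K n ω) + formD K n (eulerContract K i ω)) := by
      rw [formD_fn_mul, formD_eulerPair, map_add, eulerContract_cov_mul, eulerContract_fn_mul,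
        eulerContract_fn_mul, formD_fn_mul, formD_eulerPair, mul_add]
      abel
    rw [e, map_add, Polynomial.coeff_add]
    cases k with
    | zero => rw [coeff_dilate_coord_zero, coeff_dilate_coord_zero, add_zero, smul_zero]
    | succ k =>
      rw [coeff_dilate_coord_succ, coeff_dilate_coord_succ, h, mul_smul_comm, Nat.cast_succ,
        add_smul, one_smul, add_comm]
  | mul x ω h =>
    have e : eulerContract K i (formD K n (cov x * ω)) +
        formD K n (eulerContract K i (cov x * ω)) = cov x * ω +
        cov x * (eulerContract K i (formD K n ω) + formD K n (eulerContract K i ω)) := by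
      rw [formD_cov_mul, map_neg, eulerContract_cov_mul, eulerContract_cov_mul, map_sub,
        formD_fn_mul, formD_eulerPair, formD_cov_mul, mul_add]
      abel
    rw [e, map_add, Polynomial.coeff_add]
    cases k with
    | zero => rw [coeff_dilate_cov_zero, coeff_dilate_cov_zero, add_zero, smul_zero]
    | succ k =>
      rw [coeff_dilate_cov_succ, coeff_dilate_cov_succ, h, mul_smul_comm, Nat.cast_succ,
        add_smul, one_smul, add_comm]

theorem eval_one_dilate (i : Fin (n + 1)) (ω : Form K n) : (dilate K i ω).eval 1 = ω := by
  induction ω using centered_induction i with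
  | const c => rw [dilate_const, Polynomial.eval_C]
  | add x y hx hy => rw [map_add, Polynomial.eval_add, hx, hy]
  | coord x ω h =>
    rw [dilate_eulerPair_mul, Polynomial.X_mul, Polynomial.eval_mul_X, mul_one,
      Polynomial.eval_C_mul, h]
  | mul x ω h =>
    rw [dilate_ι_mul, Polynomial.X_mul, Polynomial.eval_mul_X, mul_one, Polynomial.eval_C_mul, h]

variable (K) in
/-- The value of a form at the `i`-th vertex, i.e. its integral over this vertex. -/
noncomputable def vertexEval (i : Fin (n + 1)) : Form K n →ₗ[K] K :=
  formIntegral K 0 ∘ₗ (formPull K fun _ : Fin 1 => i).toLinearMap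

theorem formIntegral_zero_const (c : K) :
    formIntegral K 0 (fn (MvPolynomial.C c)) = c := by
  have h1 : polyIntegral K 0 (MvPolynomial.C c) = c := by
    have : (MvPolynomial.C c : MvPolynomial (Fin 0) K) =
        c • (MvPolynomial.basisMonomials (Fin 0) K) 0 := by
      simp [MvPolynomial.smul_eq_C_mul]
    rw [this, map_smul, polyIntegral, Module.Basis.constr_basis]
    simp
  have h2 : topCoeff K 0 1 = 1 := by
    have : (1 : ExteriorAlgebra K (Fin 0 → K)) = ExteriorAlgebra.ιMulti K 0 Fin.elim0 := by simp
    rw [this, topCoeff, ExteriorAlgebra.liftAlternating_apply_ιMulti, Pi.single_eq_same]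
    exact Matrix.det_isEmpty
  simp [formIntegral, h1, h2]

theorem vertexEval_const (i : Fin (n + 1)) (c : K) :
    vertexEval K i (fn (MvPolynomial.C c)) = c := by
  have : polyPull K (fun _ : Fin 1 => i) (MvPolynomial.C c) = MvPolynomial.C c :=
    (polyPull K _).commutes c
  rw [vertexEval, LinearMap.comp_apply, AlgHom.toLinearMap_apply, formPull_fn, this,
    formIntegral_zero_const]

/-- The dilation by `0` is the evaluation at the vertex. -/
theorem coeff_zero_dilate (i : Fin (n + 1)) (ω : Form K n) :
    (dilate K i ω).coeff 0 = fn (MvPolynomial.C (vertexEval K i ω)) := by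
  induction ω using centered_induction i with
  | const c => rw [dilate_const, Polynomial.coeff_C_zero, vertexEval_const]
  | add x y hx hy => rw [map_add, Polynomial.coeff_add, hx, hy, map_add, map_add, fn_add]
  | coord x ω h =>
    have : polyPull K (fun _ : Fin 1 => i) (eulerPair i x) = 0 := by
      have := polyPull_eulerPair (fun _ : Fin 1 => i) 0 x
      rw [this, Subsingleton.elim (covPull K _ x) 0, map_zero]
    rw [coeff_dilate_coord_zero, vertexEval, LinearMap.comp_apply, AlgHom.toLinearMap_apply,
      map_mul, formPull_fn, this]
    simp
  | mul x ω h =>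
    rw [coeff_dilate_cov_zero, vertexEval, LinearMap.comp_apply, AlgHom.toLinearMap_apply,
      map_mul, formPull_cov, Subsingleton.elim (covPull K _ x) 0]
    have h0 : (cov 0 : Form K 0) = 0 := by simp
    have h1 : (fn 0 : Form K n) = 0 := by simp
    rw [h0, zero_mul, map_zero, map_zero, h1]

variable (K) in
/-- The value of a form at the `i`-th vertex, as a constant function. -/
noncomputable def vertexConst (i : Fin (n + 1)) : Module.End K (Form K n) :=
  Algebra.linearMap K (Form K n) ∘ₗ vertexEval K i

theorem vertexConst_apply (i : Fin (n + 1)) (ω : Form K n) :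
    vertexConst K i ω = fn (MvPolynomial.C (vertexEval K i ω)) := rfl

theorem coneHomotopy_eq_sum (i : Fin (n + 1)) (ω : Form K n) (N : ℕ)
    (hN : (dilate K i (eulerContract K i ω)).natDegree < N) :
    coneHomotopy K i ω =
      -∑ k ∈ Finset.range N, (k : K)⁻¹ • (dilate K i (eulerContract K i ω)).coeff k := by
  rw [coneHomotopy_apply, Polynomial.sum_over_range' _ (by simp) _ hN]

/-- The Poincaré lemma for the contraction of the simplex onto its `i`-th vertex. -/
theorem poincare [CharZero K] (i : Fin (n + 1)) (ω : Form K n) :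
    coneHomotopy K i (formD K n ω) = vertexConst K i ω - ω - formD K n (coneHomotopy K i ω) := by
  set N := (dilate K i (eulerContract K i (formD K n ω))).natDegree +
    (dilate K i (eulerContract K i ω)).natDegree + (dilate K i ω).natDegree + 1 with hN
  have e : (dilate K i ω).coeff 0 + ∑ k ∈ Finset.range N, (k : K)⁻¹ •
      (dilate K i (eulerContract K i (formD K n ω) + formD K n (eulerContract K i ω))).coeff k
      = ω := by
    conv_rhs => rw [← eval_one_dilate i ω, Polynomial.eval_eq_sum_range' (n := N) (by omega)]
    rw [hN, Finset.sum_range_succ', Finset.sum_range_succ']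
    simp only [dilate_cartan, one_pow, mul_one]
    rw [add_comm]
    congr 1
    rw [Nat.cast_zero, zero_smul, smul_zero, add_zero]
    refine Finset.sum_congr rfl fun k _ => ?_
    rw [smul_smul, inv_mul_cancel₀ (Nat.cast_ne_zero.2 k.succ_ne_zero), one_smul]
  rw [coneHomotopy_eq_sum i _ N (by omega), coneHomotopy_eq_sum i _ N (by omega), map_neg, map_sum,
    sub_neg_eq_add, vertexConst_apply, ← coeff_zero_dilate]
  simp only [map_smul, formD_dilate]
  conv_rhs => enter [1, 2]; rw [← e]
  simp only [map_add, Polynomial.coeff_add, smul_add, Finset.sum_add_distrib]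
  abel

theorem eulerContract_mem (i : Fin (n + 1)) {d : ℕ} {ω : Form K n} (h : ω ∈ formDeg K n d) :
    eulerContract K i ω ∈ formDeg K n (d - 1) ∧ (d = 0 → eulerContract K i ω = 0) := by
  induction h using formDeg_induction with
  | poly p => rw [eulerContract_const]; exact ⟨zero_mem _, fun _ => rfl⟩
  | add d x y _ _ hx hy =>
    rw [map_add]
    exact ⟨add_mem hx.1 hy.1, fun h => by rw [hx.2 h, hy.2 h, add_zero]⟩
  | mul d x ω hω h =>
    rw [eulerContract_cov_mul]
    refine ⟨sub_mem ?_ ?_, by simp⟩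
    · simpa using mul_mem_formDeg (fn_mem (eulerPair i x)) hω
    · rcases Nat.eq_zero_or_pos d with rfl | hd
      · rw [h.2 rfl, mul_zero]; exact zero_mem _
      · have := cov_mul_mem x h.1
        rwa [Nat.sub_add_cancel hd] at this

theorem dilate_mem (i : Fin (n + 1)) {d : ℕ} {ω : Form K n} (h : ω ∈ formDeg K n d) (k : ℕ) :
    (dilate K i ω).coeff k ∈ formDeg K n d := by
  induction h using formDeg_induction generalizing k with
  | poly p => rw [dilate_poly, Polynomial.coeff_map]; exact fn_mem _
  | add d x y _ _ hx hy => rw [map_add, Polynomial.coeff_add]; exact add_mem (hx k) (hy k)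
  | mul d x ω hω h =>
    cases k with
    | zero => rw [coeff_dilate_cov_zero]; exact zero_mem _
    | succ k => rw [coeff_dilate_cov_succ]; exact cov_mul_mem _ (h k)

theorem coneHomotopy_mem (i : Fin (n + 1)) {d : ℕ} {ω : Form K n} (h : ω ∈ formDeg K n d) :
    coneHomotopy K i ω ∈ formDeg K n (d - 1) := by
  rw [coneHomotopy_eq_sum i ω _ (Nat.lt_succ_self _)]
  exact neg_mem (sum_mem fun k _ =>
      Submodule.smul_mem _ _ (dilate_mem i (eulerContract_mem i h).1 k))

theorem coneHomotopy_zero_of_mem (i : Fin (n + 1)) {ω : Form K n} (h : ω ∈ formDeg K n 0) :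
    coneHomotopy K i ω = 0 := by
  rw [coneHomotopy_apply, (eulerContract_mem i h).2 rfl, map_zero, Polynomial.sum_zero_index,
    neg_zero]

theorem coneHomotopy_vertexConst (i j : Fin (n + 1)) :
    coneHomotopy K i * vertexConst K j = 0 :=
  LinearMap.ext fun _ => coneHomotopy_zero_of_mem i (fn_mem _)

end Poincare

/-! ### Whitney forms -/

section Whitney

variable {K : Type v} [Field K] {n m : ℕ}

variable (K) in
/-- The constant form `dt_{v₀} ⋯ dt_{v_k}`. -/
noncomputable def dtList : List (Fin (n + 1)) → Form K n
  | [] => 1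
  | i :: v => dtF i * dtList v

variable (K) in
/-- Whitney's form without the factor `k!`, by recursion on the list of vertices:
`∑ⱼ (-1)ʲ t_{vⱼ} dt_{v₀} ⋯ dt_{v_{j-1}} dt_{v_{j+1}} ⋯ dt_{v_k}`. -/
noncomputable def whitneyList : List (Fin (n + 1)) → Form K n
  | [] => 0
  | i :: v => tF i * dtList K v - dtF i * whitneyList v

theorem prod_dtF {c : ℕ} (v : Fin c → Fin (n + 1)) :
    (List.ofFn fun a => (dtF (v a) : Form K n)).prod = dtList K (List.ofFn v) := by
  induction c with
  | zero => simp [dtList]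
  | succ c ih => rw [List.ofFn_succ, List.prod_cons, ih, List.ofFn_succ, dtList]

theorem whitney_eq {c : ℕ} (v : Fin c → Fin (n + 1)) :
    whitney K v = ((c - 1).factorial : K) • whitneyList K (List.ofFn v) := by
  rw [whitney]
  congr 1
  change ∑ j : Fin c, (-1 : K) ^ (j : ℕ) • (List.ofFn fun a =>
    if a = j then (tF (v a) : Form K n) else dtF (v a)).prod = _
  induction c with
  | zero => simp [whitneyList]
  | succ c ih =>
    rw [Fin.sum_univ_succ, List.ofFn_succ (f := v), whitneyList, ← prod_dtF,
      ← ih (fun a => v a.succ), Finset.mul_sum, sub_eq_add_neg, ← Finset.sum_neg_distrib]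
    congr 1
    · rw [Fin.val_zero, pow_zero, one_smul, List.ofFn_succ, List.prod_cons, if_pos rfl]
      simp
    · refine Finset.sum_congr rfl fun j _ => ?_
      rw [List.ofFn_succ, List.prod_cons, if_neg (Fin.succ_ne_zero j).symm, Fin.val_succ, pow_succ,
        mul_neg_one, form_neg_smul, mul_smul_comm]
      simp only [Fin.succ_inj]

theorem dtF_mul_self (i : Fin (n + 1)) : (dtF i * dtF i : Form K n) = 0 := cov_mul_self _

theorem dtList_swap (i j : Fin (n + 1)) (v : List (Fin (n + 1))) :
    dtList K (i :: j :: v) = -dtList K (j :: i :: v) := by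
  rw [dtList, dtList, dtList, dtList, ← mul_assoc, cov_mul_cov, form_neg_mul, mul_assoc]

theorem whitneyList_swap (i j : Fin (n + 1)) (v : List (Fin (n + 1))) :
    whitneyList K (i :: j :: v) = -whitneyList K (j :: i :: v) := by
  have h1 : ∀ x : Form K n, dtF i * (tF j * x) = tF j * (dtF i * x) := fun x => by
    rw [← mul_assoc, ← tmul_one_comm, mul_assoc]
  have h2 : ∀ x : Form K n, dtF j * (tF i * x) = tF i * (dtF j * x) := fun x => by
    rw [← mul_assoc, ← tmul_one_comm, mul_assoc]
  have h3 : ∀ x : Form K n, dtF i * (dtF j * x) = -(dtF j * (dtF i * x)) := fun x => by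
    rw [← mul_assoc, cov_mul_cov, form_neg_mul, mul_assoc]
  simp only [whitneyList, dtList, form_mul_sub, h1, h2, h3]
  abel

theorem dtList_of_mem {i : Fin (n + 1)} {v : List (Fin (n + 1))} (h : i ∈ v) :
    dtList K (i :: v) = 0 := by
  induction v with
  | nil => simp at h
  | cons j v ih =>
    rcases List.mem_cons.1 h with rfl | h
    · rw [dtList, dtList, ← mul_assoc, dtF_mul_self, zero_mul]
    · rw [dtList_swap, dtList, ih h, mul_zero, neg_zero]

theorem whitneyList_of_mem {i : Fin (n + 1)} {v : List (Fin (n + 1))} (h : i ∈ v) :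
    whitneyList K (i :: v) = 0 := by
  induction v with
  | nil => simp at h
  | cons j v ih =>
    rcases List.mem_cons.1 h with rfl | h
    · have h1 : ∀ x : Form K n, dtF i * (tF i * x) = tF i * (dtF i * x) := fun x => by
        rw [← mul_assoc, ← tmul_one_comm, mul_assoc]
      rw [whitneyList, whitneyList, dtList, form_mul_sub, h1, ← mul_assoc (dtF i) (dtF i),
        dtF_mul_self, zero_mul, sub_zero, sub_self]
    · rw [whitneyList_swap, whitneyList, ih h, dtList_of_mem h, mul_zero, mul_zero, sub_zero,
        neg_zero]

theorem dtList_orderedInsert (i : Fin (n + 1)) (v : List (Fin (n + 1)))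
    (hv : v.Pairwise (· ≤ ·)) (hi : i ∉ v) :
    dtList K (i :: v) = (-1 : K) ^ (v.countP (· < i)) • dtList K (v.orderedInsert (· ≤ ·) i) := by
  induction v with
  | nil => simp
  | cons j v ih =>
    rw [List.orderedInsert]
    rw [List.mem_cons, not_or] at hi
    split_ifs with hij
    · rw [List.countP_eq_zero.2, pow_zero, one_smul]
      intro a ha
      rcases List.mem_cons.1 ha with rfl | ha
      · simpa using hij
      · simpa using hij.trans (List.rel_of_pairwise_cons hv ha)
    · have hji : j < i := lt_of_not_ge hij
      rw [dtList_swap, dtList, ih hv.of_cons hi.2, mul_smul_comm,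
        List.countP_cons_of_pos (by simpa using hji), pow_succ, mul_neg_one, form_neg_smul, dtList]

theorem whitneyList_orderedInsert (i : Fin (n + 1)) (v : List (Fin (n + 1)))
    (hv : v.Pairwise (· ≤ ·)) (hi : i ∉ v) : whitneyList K (i :: v) =
      (-1 : K) ^ (v.countP (· < i)) • whitneyList K (v.orderedInsert (· ≤ ·) i) := by
  induction v with
  | nil => simp
  | cons j v ih =>
    rw [List.orderedInsert]
    have hi' := hi
    rw [List.mem_cons, not_or] at hi
    split_ifs with hij
    · rw [List.countP_eq_zero.2, pow_zero, one_smul]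
      intro a ha
      rcases List.mem_cons.1 ha with rfl | ha
      · simpa using hij
      · simpa using hij.trans (List.rel_of_pairwise_cons hv ha)
    · have hji : j < i := lt_of_not_ge hij
      rw [whitneyList_swap, whitneyList, ih hv.of_cons hi.2,
        dtList_orderedInsert i v hv.of_cons hi.2, mul_smul_comm, mul_smul_comm, ← form_smul_sub,
        List.countP_cons_of_pos (by simpa using hji), pow_succ, mul_neg_one, form_neg_smul,
        whitneyList]

theorem formD_dtList (v : List (Fin (n + 1))) : formD K n (dtList K v) = 0 := by
  induction v with
  | nil => exact formD_one
  | cons i v ih => rw [dtList, formD_cov_mul, ih, mul_zero, neg_zero]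

theorem formD_whitneyList (v : List (Fin (n + 1))) :
    formD K n (whitneyList K v) = (v.length : K) • dtList K v := by
  induction v with
  | nil => rw [whitneyList, map_zero, List.length_nil, Nat.cast_zero, zero_smul]
  | cons i v ih =>
    rw [whitneyList, map_sub, formD_fn_mul, formD_tF, formD_dtList, mul_zero, add_zero,
      formD_cov_mul, ih, mul_smul_comm, List.length_cons, Nat.cast_succ, add_smul, one_smul, dtList]
    abel

theorem sum_whitneyList_cons (v : List (Fin (n + 1))) :
    ∑ i, whitneyList K (i :: v) = dtList K v := by
  simp only [whitneyList]
  rw [Finset.sum_sub_distrib, ← Finset.sum_mul, ← Finset.sum_mul, sum_tF, sum_dtF, one_mul,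
    zero_mul, sub_zero]

theorem dtList_mem (v : List (Fin (n + 1))) : dtList K v ∈ formDeg K n v.length := by
  induction v with
  | nil => exact fn_mem 1
  | cons i v ih => exact cov_mul_mem _ ih

theorem whitneyList_mem (v : List (Fin (n + 1))) :
    whitneyList K v ∈ formDeg K n (v.length - 1) := by
  induction v with
  | nil => exact zero_mem _
  | cons i v ih =>
    refine sub_mem ?_ ?_
    · simpa using mul_mem_formDeg (fn_mem (bary K i)) (dtList_mem (K := K) v)
    · cases v with
      | nil => rw [whitneyList, mul_zero]; exact zero_mem _
      | cons j v => exact cov_mul_mem _ ih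

/-- The list of vertices of a face. -/
abbrev Face.list (I : Face n) : List (Fin (n + 1)) := I.1.sort (· ≤ ·)

theorem Face.ofFn_vertex (I : Face n) : List.ofFn I.vertex = I.list := by
  refine List.ext_getElem ?_ fun a h1 h2 => ?_
  · simp [I.card_eq]
  · rw [List.getElem_ofFn]
    rfl

theorem whitney_vertex (I : Face n) :
    whitney K I.vertex = (I.dim.factorial : K) • whitneyList K I.list := by
  rw [whitney_eq, I.ofFn_vertex, Nat.add_sub_cancel]

theorem Face.length_list (I : Face n) : I.list.length = I.dim + 1 := by
  rw [Finset.length_sort, I.card_eq]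

theorem whitney_mem (I : Face n) : whitney K I.vertex ∈ formDeg K n I.dim := by
  rw [whitney_vertex]
  refine Submodule.smul_mem _ _ ?_
  have := whitneyList_mem (K := K) I.list
  rwa [I.length_list, Nat.add_sub_cancel] at this

/-- The face spanned by `J` and the vertex `i`. -/
def Face.insert (J : Face n) (i : Fin (n + 1)) : Face n :=
  ⟨Insert.insert i J.1, Finset.insert_nonempty i J.1⟩

/-- The number of vertices of `J` before `i`. -/
def Face.below (J : Face n) (i : Fin (n + 1)) : ℕ := (J.1.filter (· < i)).card

theorem sort_insert_eq (s : Finset (Fin (n + 1))) {i : Fin (n + 1)} (hi : i ∉ s) :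
    (Insert.insert i s).sort (· ≤ ·) = (s.sort (· ≤ ·)).orderedInsert (· ≤ ·) i := by
  refine List.Perm.eq_of_pairwise' (r := (· ≤ ·)) ?_ ?_ ?_
  · exact Finset.pairwise_sort _ _
  · exact (Finset.pairwise_sort _ _).orderedInsert _ _
  · refine List.Perm.trans ?_ (List.perm_orderedInsert _ _ _).symm
    rw [← Multiset.coe_eq_coe, ← Multiset.cons_coe, Finset.sort_eq, Finset.sort_eq,
      Finset.insert_val_of_notMem hi]

theorem countP_sort (s : Finset (Fin (n + 1))) (i : Fin (n + 1)) :
    (s.sort (· ≤ ·)).countP (· < i) = (s.filter (· < i)).card := by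
  rw [← Multiset.coe_countP, Finset.sort_eq, Multiset.countP_eq_card_filter]
  rfl

theorem Face.dim_insert (J : Face n) {i : Fin (n + 1)} (hi : i ∉ J.1) :
    (J.insert i).dim = J.dim + 1 := by
  have := J.card_eq
  simp only [Face.dim, Face.insert, Finset.card_insert_of_notMem hi]
  omega

/-- The differential of a Whitney form. -/
theorem formD_whitney (J : Face n) : formD K n (whitney K J.vertex) =
    ∑ i ∈ J.1ᶜ, (-1 : ℤ) ^ J.below i • whitney K (J.insert i).vertex := by
  rw [whitney_vertex, map_smul, formD_whitneyList, J.length_list, smul_smul,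
    ← sum_whitneyList_cons, ← Finset.sum_compl_add_sum J.1,
    Finset.sum_eq_zero (s := J.1) fun i hi => whitneyList_of_mem ((Finset.mem_sort _).2 hi),
    add_zero, Finset.smul_sum]
  refine Finset.sum_congr rfl fun i hi => ?_
  rw [Finset.mem_compl] at hi
  rw [whitneyList_orderedInsert _ _ (Finset.pairwise_sort _ _)
    (fun h => hi ((Finset.mem_sort _).1 h)), countP_sort, ← sort_insert_eq _ hi, whitney_vertex,
    J.dim_insert hi, smul_smul, Nat.factorial_succ, ← Int.cast_smul_eq_zsmul K, smul_smul]
  congr 1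
  push_cast [Face.below]
  ring

theorem Face.below_vertex (I : Face n) (j : Fin (I.dim + 1)) : I.below (I.vertex j) = j := by
  have : I.1.filter (· < I.vertex j) = (Finset.univ.filter (· < j)).image I.vertex := by
    ext x
    simp only [Finset.mem_filter, Finset.mem_image, Finset.mem_univ, true_and]
    constructor
    · rintro ⟨hx, hlt⟩
      rw [← I.image_vertex] at hx
      obtain ⟨a, -, rfl⟩ := Finset.mem_image.1 hx
      exact ⟨a, I.vertex_strictMono.lt_iff_lt.1 hlt, rfl⟩
    · rintro ⟨a, ha, rfl⟩
      exact ⟨I.vertex_mem a, I.vertex_strictMono ha⟩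
  rw [Face.below, this, Finset.card_image_of_injective _ I.vertex_strictMono.injective,
    ← Fin.card_Iio j]
  congr 1
  ext x
  simp

theorem Face.sum_vertex {M : Type*} [AddCommMonoid M] (I : Face n) (F : ℕ → Fin (n + 1) → M) :
    ∑ j : Fin (I.dim + 1), F j (I.vertex j) = ∑ i ∈ I.1, F (I.below i) i := by
  conv_rhs => rw [← I.image_vertex]
  rw [Finset.sum_image fun a _ b _ h => I.vertex_strictMono.injective h]
  exact Finset.sum_congr rfl fun j _ => by rw [I.below_vertex]

theorem Face.below_insert (J : Face n) (i : Fin (n + 1)) : (J.insert i).below i = J.below i := by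
  simp [Face.below, Face.insert, Finset.filter_insert]

/-- Exchange of summation between pairs of a face with one of its facets, and pairs of a face with
a vertex not on it. -/
theorem sum_facets {M : Type*} [AddCommGroup M] (G : Face n → Face n → M) :
    ∑ I : Face n, (∑ j : Fin (I.dim + 1), if h : (I.1.erase (I.vertex j)).Nonempty then
      (-1 : ℤ) ^ (j : ℕ) • G I ⟨_, h⟩ else 0) =
    ∑ J : Face n, ∑ i ∈ J.1ᶜ, (-1 : ℤ) ^ J.below i • G (J.insert i) J := by
  have h1 : ∀ I : Face n, (∑ j : Fin (I.dim + 1), if h : (I.1.erase (I.vertex j)).Nonempty then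
      (-1 : ℤ) ^ (j : ℕ) • G I ⟨_, h⟩ else 0) = ∑ i ∈ I.1, if h : (I.1.erase i).Nonempty then
      (-1 : ℤ) ^ I.below i • G I ⟨_, h⟩ else 0 := fun I =>
    I.sum_vertex fun j i => if h : (I.1.erase i).Nonempty then (-1 : ℤ) ^ j • G I ⟨_, h⟩ else 0
  have h2 : ∀ (J : Face n) (i : Fin (n + 1)), i ∉ J.1 →
      (if h : ((J.insert i).1.erase i).Nonempty then
        (-1 : ℤ) ^ (J.insert i).below i • G (J.insert i) ⟨_, h⟩ else 0) =
      (-1 : ℤ) ^ J.below i • G (J.insert i) J := by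
    intro J i hi
    have he : (J.insert i).1.erase i = J.1 := Finset.erase_insert hi
    have hJ : (⟨(J.insert i).1.erase i, he ▸ J.2⟩ : Face n) = J := Subtype.ext he
    rw [dif_pos (he ▸ J.2), hJ, J.below_insert]
  have h3 : ∀ (I : Face n) (i : Fin (n + 1)) (hi : i ∈ I.1) (h : (I.1.erase i).Nonempty),
      Face.insert ⟨I.1.erase i, h⟩ i = I := fun I i hi h => Subtype.ext (Finset.insert_erase hi)
  rw [Finset.sum_congr rfl fun I _ => h1 I, Finset.sum_sigma', Finset.sum_sigma']
  refine Finset.sum_bij_ne_zero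
    (fun x _ hx => ⟨⟨x.1.1.erase x.2, by by_contra h; exact hx (dif_neg h)⟩, x.2⟩) ?_ ?_ ?_ ?_
  · rintro ⟨I, i⟩ hi hx
    simp
  · rintro ⟨I, i⟩ hi hx ⟨I', i'⟩ hi' hx' h
    simp only [Finset.mem_sigma, Finset.mem_univ, true_and] at hi hi'
    simp only [Sigma.mk.injEq, Subtype.mk.injEq, heq_eq_eq] at h
    obtain ⟨h1, rfl⟩ := h
    have : I = I' := Subtype.ext (by rw [← Finset.insert_erase hi, h1, Finset.insert_erase hi'])
    rw [this]
  · rintro ⟨J, i⟩ hi hx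
    simp only [Finset.mem_sigma, Finset.mem_univ, true_and, Finset.mem_compl] at hi
    refine ⟨⟨J.insert i, i⟩, by simp [Face.insert], ?_, ?_⟩
    · exact fun h => hx ((h2 J i hi).symm.trans h)
    · exact Sigma.ext (Subtype.ext (Finset.erase_insert hi)) HEq.rfl
  · rintro ⟨I, i⟩ hi hx
    simp only [Finset.mem_sigma, Finset.mem_univ, true_and] at hi
    have hne : (I.1.erase i).Nonempty := by by_contra h; exact hx (dif_neg h)
    have := h2 ⟨I.1.erase i, hne⟩ i (Finset.notMem_erase i I.1)
    rw [h3 I i hi hne] at this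
    simp only [h3 I i hi hne]
    exact this

/-- The Whitney forms of the vertices, the barycentric coordinates, add up to one. -/
theorem sum_whitney_vertices :
    ∑ I : Face n, (if I.dim = 0 then whitney K I.vertex else 0) = 1 := by
  rw [← sum_tF, ← Finset.sum_filter]
  symm
  refine Finset.sum_bij (fun i _ => ⟨{i}, Finset.singleton_nonempty i⟩) ?_ ?_ ?_ ?_
  · intro i _
    exact Finset.mem_filter.2 ⟨Finset.mem_univ _, rfl⟩
  · intro i _ j _ h
    simpa using h
  · intro I hI
    simp only [Finset.mem_filter, Finset.mem_univ, true_and] at hI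
    obtain ⟨i, hi⟩ := Finset.card_eq_one.1 (I.card_eq.trans (by rw [hI]))
    exact ⟨i, Finset.mem_univ _, Subtype.ext hi.symm⟩
  · intro i _
    rw [whitney_vertex]
    simp [Face.dim, Face.list, whitneyList, dtList]

end Whitney

/-! ### Stokes' theorem -/

section Stokes

variable {K : Type v} [Field K] {n m : ℕ}

theorem prod_X_pow (a : Fin n →₀ ℕ) :
    (∏ i, MvPolynomial.X i ^ a i : MvPolynomial (Fin n) K) = MvPolynomial.monomial a 1 := by
  rw [MvPolynomial.monomial_eq, Finsupp.prod_fintype _ _ (by simp)]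
  simp

theorem polyIntegral_monomial (a : Fin n → ℕ) :
    polyIntegral K n (∏ i, MvPolynomial.X i ^ a i) =
      (∏ i, ((a i).factorial : K)) / ((∑ i, a i + n).factorial : K) := by
  have h1 : MvPolynomial.monomial (Finsupp.equivFunOnFinite.symm a) 1 =
      MvPolynomial.basisMonomials (Fin n) K (Finsupp.equivFunOnFinite.symm a) := by
    rw [MvPolynomial.coe_basisMonomials]
  have h2 := prod_X_pow (K := K) (Finsupp.equivFunOnFinite.symm a)
  rw [Finsupp.coe_equivFunOnFinite_symm] at h2
  rw [h2, h1, polyIntegral, Module.Basis.constr_basis]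
  simp

theorem prod_factorial_add_single (b : Fin n → ℕ) (j : Fin n) :
    ∏ i, (((b + Pi.single j 1 : Fin n → ℕ) i).factorial : K) =
      (b j + 1) * ∏ i, ((b i).factorial : K) := by
  rw [Fintype.prod_eq_mul_prod_compl j, Fintype.prod_eq_mul_prod_compl j (fun i => _)]
  simp only [Pi.add_apply, Pi.single_eq_same, Nat.factorial_succ, Nat.cast_mul, Nat.cast_succ,
    mul_assoc]
  congr 2
  refine Finset.prod_congr rfl fun i hi => ?_
  rw [Pi.single_eq_of_ne (by simpa using hi), add_zero]

theorem prod_X_add_single (b : Fin n → ℕ) (j : Fin n) :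
    (∏ i, MvPolynomial.X i ^ (b + Pi.single j 1 : Fin n → ℕ) i : MvPolynomial (Fin n) K) =
      MvPolynomial.X j * ∏ i, MvPolynomial.X i ^ b i := by
  simp only [Pi.add_apply, pow_add, Finset.prod_mul_distrib]
  rw [mul_comm, Finset.prod_eq_single j]
  · simp
  · intro i _ hi
    rw [Pi.single_eq_of_ne hi, pow_zero]
  · simp

theorem polyIntegral_bary_zero [CharZero K] (c : ℕ) (b : Fin n → ℕ) :
    polyIntegral K n (bary K 0 ^ c * ∏ i, MvPolynomial.X i ^ b i) =
      (c.factorial * ∏ i, ((b i).factorial : K)) / ((c + ∑ i, b i + n).factorial : K) := by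
  induction c generalizing b with
  | zero => simp [polyIntegral_monomial]
  | succ c ih =>
    have h0 : bary K (0 : Fin (n + 1)) = 1 - ∑ j : Fin n, MvPolynomial.X j := rfl
    have e : bary K (0 : Fin (n + 1)) ^ (c + 1) * ∏ i, MvPolynomial.X i ^ b i =
        bary K 0 ^ c * ∏ i, MvPolynomial.X i ^ b i -
          ∑ j, bary K 0 ^ c * ∏ i, MvPolynomial.X i ^ (b + Pi.single j 1 : Fin n → ℕ) i := by
      simp only [prod_X_add_single]
      rw [pow_succ]
      conv_lhs => enter [1, 2]; rw [h0]
      rw [mul_sub, sub_mul, mul_one, Finset.mul_sum, Finset.sum_mul]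
      congr 1
      exact Finset.sum_congr rfl fun j _ => by rw [mul_assoc]
    have hB : ∀ j : Fin n, c + ∑ i, (b + Pi.single j 1 : Fin n → ℕ) i + n =
        (c + ∑ i, b i + n) + 1 := by
      intro j
      simp only [Pi.add_apply, Finset.sum_add_distrib, Finset.sum_pi_single', Finset.mem_univ,
        if_true]
      omega
    rw [e, map_sub, map_sum, ih]
    simp only [ih, prod_factorial_add_single, hB]
    rw [show c + 1 + ∑ i, b i + n = (c + ∑ i, b i + n) + 1 by ring]
    rw [Nat.factorial_succ, Nat.factorial_succ]
    have h1 : ((c + ∑ i, b i + n).factorial : K) ≠ 0 := Nat.cast_ne_zero.2 (Nat.factorial_ne_zero _)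
    have h2 : ((c + ∑ i, b i + n + 1 : ℕ) : K) ≠ 0 := Nat.cast_ne_zero.2 (Nat.succ_ne_zero _)
    have h3 : ∑ j : Fin n, (c.factorial : K) * (((b j : K) + 1) * ∏ i, ((b i).factorial : K)) =
        ((∑ i, b i : ℕ) + n) * (c.factorial * ∏ i, ((b i).factorial : K)) := by
      have : ((∑ i, b i : ℕ) + n : K) = ∑ j : Fin n, ((b j : K) + 1) := by
        simp [Finset.sum_add_distrib]
      rw [this, Finset.sum_mul]
      exact Finset.sum_congr rfl fun j _ => by ring
    rw [← Finset.sum_div, h3]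
    push_cast at h2 ⊢
    field_simp
    ring

/-- Dirichlet's formula, in barycentric coordinates. -/
theorem polyIntegral_bary [CharZero K] (a : Fin (n + 1) → ℕ) :
    polyIntegral K n (∏ i, bary K i ^ a i) =
      (∏ i, ((a i).factorial : K)) / ((∑ i, a i + n).factorial : K) := by
  rw [Fin.prod_univ_succ, Fin.prod_univ_succ, Fin.sum_univ_succ, ← polyIntegral_bary_zero]
  rfl

theorem polyPull_bary_of_injective {θ : Fin (m + 1) → Fin (n + 1)} (hθ : Function.Injective θ)
    (l : Fin (m + 1)) : polyPull K θ (bary K (θ l)) = bary K l := by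
  rw [polyPull_bary]
  simp [hθ.eq_iff, Finset.filter_eq']

theorem polyPull_bary_of_notMem {θ : Fin (m + 1) → Fin (n + 1)} {i : Fin (n + 1)}
    (hi : ∀ l, θ l ≠ i) : polyPull K θ (bary K i) = 0 := by
  rw [polyPull_bary]
  simp [hi]

/-- Integration over the simplex of a partial derivative. -/
theorem polyIntegral_pderiv [CharZero K] (j : Fin (n + 1)) (p : MvPolynomial (Fin (n + 1)) K) :
    polyIntegral K (n + 1) (MvPolynomial.pderiv j p) =
      polyIntegral K n (polyPull K (Fin.succAbove 0) p) -
      polyIntegral K n (polyPull K (Fin.succAbove j.succ) p) := by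
  suffices h : polyIntegral K (n + 1) ∘ₗ (MvPolynomial.pderiv j).toLinearMap =
      polyIntegral K n ∘ₗ (polyPull K (Fin.succAbove 0)).toLinearMap -
      polyIntegral K n ∘ₗ (polyPull K (Fin.succAbove j.succ)).toLinearMap from
    LinearMap.congr_fun h p
  refine (MvPolynomial.basisMonomials (Fin (n + 1)) K).ext fun a => ?_
  have hb : (MvPolynomial.basisMonomials (Fin (n + 1)) K) a = MvPolynomial.monomial a 1 := by
    rw [MvPolynomial.coe_basisMonomials]
  rw [hb]
  simp only [LinearMap.comp_apply, LinearMap.sub_apply, AlgHom.toLinearMap_apply,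
    Derivation.coeFn_coe]
  have h0 : polyPull K (Fin.succAbove 0) (MvPolynomial.monomial a 1) =
      ∏ i : Fin (n + 1), bary K i ^ a i := by
    rw [← prod_X_pow, map_prod]
    refine Finset.prod_congr rfl fun i _ => ?_
    rw [map_pow]
    congr 1
    exact polyPull_bary_of_injective Fin.succAbove_right_injective i
  have h1 : polyPull K (Fin.succAbove j.succ) (MvPolynomial.monomial a 1) =
      0 ^ a j * ∏ i : Fin n, MvPolynomial.X i ^ a (j.succAbove i) := by
    rw [← prod_X_pow, map_prod, Fin.prod_univ_succAbove _ j, map_pow]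
    congr 1
    · congr 1
      exact polyPull_bary_of_notMem (θ := Fin.succAbove j.succ) (i := j.succ) fun l =>
        Fin.succAbove_ne _ _
    · refine Finset.prod_congr rfl fun i _ => ?_
      rw [map_pow]
      congr 1
      have := polyPull_bary_of_injective (K := K) (θ := Fin.succAbove j.succ)
        Fin.succAbove_right_injective i.succ
      rw [Fin.succ_succAbove_succ] at this
      exact this
  rw [h0, h1, polyIntegral_bary, MvPolynomial.pderiv_monomial, one_mul]
  rcases Nat.eq_zero_or_pos (a j) with hj | hj
  · rw [hj, Nat.cast_zero, map_zero, map_zero, pow_zero, one_mul, polyIntegral_monomial,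
      Fin.prod_univ_succAbove _ j, Fin.sum_univ_succAbove _ j, hj]
    simp
  · rw [zero_pow hj.ne', zero_mul, map_zero, sub_zero]
    obtain ⟨b, rfl⟩ : ∃ b : Fin (n + 1) →₀ ℕ, a = b + Finsupp.single j 1 :=
      ⟨a - Finsupp.single j 1, (tsub_add_cancel_of_le (Finsupp.single_le_iff.2 hj)).symm⟩
    have hs : ∀ i, (b + Finsupp.single j 1 : Fin (n + 1) →₀ ℕ) i =
        (⇑b + Pi.single j 1 : Fin (n + 1) → ℕ) i := fun i => by
      rw [Finsupp.add_apply, Pi.add_apply, Finsupp.single_eq_pi_single]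
    rw [add_tsub_cancel_right, Finset.prod_congr rfl fun i _ => by rw [hs],
      prod_factorial_add_single]
    have h2 : (MvPolynomial.monomial b ((b + Finsupp.single j 1 : Fin (n + 1) →₀ ℕ) j : K)) =
        ((b j : K) + 1) • MvPolynomial.monomial b 1 := by
      rw [MvPolynomial.smul_monomial]
      simp
    rw [h2, map_smul, ← prod_X_pow, polyIntegral_monomial, smul_eq_mul, mul_div_assoc]
    congr 3
    have : ∑ i, (b + Finsupp.single j 1 : Fin (n + 1) →₀ ℕ) i = ∑ i, b i + 1 := by
      simp [Finset.sum_add_distrib]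
    rw [this, add_assoc, add_comm 1 n]

theorem topCoeff_ιMulti (v : Fin n → Fin n → K) :
    topCoeff K n (ExteriorAlgebra.ιMulti K n v) = Matrix.det (Matrix.of v) := by
  rw [topCoeff, ExteriorAlgebra.liftAlternating_apply_ιMulti, Pi.single_eq_same]
  rfl

theorem topCoeff_ιMulti_of_ne {i : ℕ} (hi : i ≠ n) (v : Fin i → Fin n → K) :
    topCoeff K n (ExteriorAlgebra.ιMulti K i v) = 0 := by
  rw [topCoeff, ExteriorAlgebra.liftAlternating_apply_ιMulti, Pi.single_eq_of_ne hi]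
  rfl

theorem covPull_succAbove_succ (j : Fin (n + 1)) (x : Fin (n + 1) → K) :
    covPull K (Fin.succAbove j.succ) x = fun a => x (j.succAbove a) := by
  suffices h : covPull K (Fin.succAbove j.succ) = LinearMap.funLeft K K j.succAbove from
    LinearMap.congr_fun h x
  refine cov_ext fun l => ?_
  rw [covPull_dBary]
  induction l using Fin.succAboveCases j.succ with
  | x =>
    rw [Finset.filter_false_of_mem fun a _ => Fin.succAbove_ne _ _, Finset.sum_empty]
    ext a
    simp [dBary, LinearMap.funLeft_apply, Fin.succAbove_ne]
  | p l =>
    simp only [Fin.succAbove_right_inj, Finset.filter_eq', Finset.mem_univ, if_true,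
      Finset.sum_singleton]
    ext a
    rw [LinearMap.funLeft_apply]
    refine Fin.cases ?_ (fun l => ?_) l
    · rw [Fin.succ_succAbove_zero]; rfl
    · rw [Fin.succ_succAbove_succ]
      simp [dBary, Pi.single_apply]

theorem covPull_succAbove_zero (x : Fin (n + 1) → K) :
    covPull K (Fin.succAbove 0) x = fun a => x a.succ - x 0 := by
  suffices h : covPull K (Fin.succAbove 0) = LinearMap.funLeft K K Fin.succ -
      LinearMap.funLeft K K (fun _ : Fin n => (0 : Fin (n + 1))) from LinearMap.congr_fun h x
  refine LinearMap.pi_ext' fun j => LinearMap.ext_ring ?_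
  have : covPull K (Fin.succAbove 0) (dBary K j.succ) = dBary K j := by
    rw [covPull_dBary]
    simp [Finset.filter_eq']
  refine this.trans ?_
  ext a
  refine Fin.cases ?_ (fun j => ?_) j
  · simp [dBary, LinearMap.funLeft_apply]
  · simp [dBary, LinearMap.funLeft_apply, Pi.single_apply]

theorem topCoeff_pull_succ (j : Fin (n + 1)) (w : ExteriorAlgebra K (Fin (n + 1) → K)) :
    topCoeff K n (ExteriorAlgebra.map (covPull K (Fin.succAbove j.succ)) w) =
      (-1 : K) ^ (j : ℕ) * topCoeff K (n + 1) (ExteriorAlgebra.ι K (Pi.single j 1) * w) := by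
  suffices h : topCoeff K n ∘ₗ
      (ExteriorAlgebra.map (covPull K (Fin.succAbove j.succ))).toLinearMap = (-1 : K) ^ (j : ℕ) •
      topCoeff K (n + 1) ∘ₗ LinearMap.mulLeft K (ExteriorAlgebra.ι K (Pi.single j 1)) from
    LinearMap.congr_fun h w
  refine ExteriorAlgebra.lhom_ext fun i => AlternatingMap.ext fun v => ?_
  simp only [LinearMap.compAlternatingMap_apply, LinearMap.comp_apply, LinearMap.smul_apply,
    AlgHom.toLinearMap_apply, ExteriorAlgebra.map_apply_ιMulti, LinearMap.mulLeft_apply]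
  have hc : ExteriorAlgebra.ι K (Pi.single j (1 : K)) * ExteriorAlgebra.ιMulti K i v =
      ExteriorAlgebra.ιMulti K (i + 1) (Fin.cons (Pi.single j 1) v) := by
    rw [ExteriorAlgebra.ιMulti_succ_apply]
    rfl
  rw [hc]
  by_cases hi : i = n
  · subst hi
    rw [topCoeff_ιMulti, topCoeff_ιMulti, Matrix.det_succ_row_zero, Finset.sum_eq_single j]
    · simp only [Matrix.of_apply, Fin.cons_zero, Pi.single_eq_same, mul_one, smul_eq_mul,
        ← mul_assoc, ← mul_pow]
      simp only [neg_mul, one_mul, neg_neg, one_pow]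
      congr 1
      ext r a
      simp [covPull_succAbove_succ]
    · intro b _ hb
      simp [Pi.single_eq_of_ne hb]
    · simp
  · rw [topCoeff_ιMulti_of_ne hi, topCoeff_ιMulti_of_ne (by omega), smul_zero]

theorem topCoeff_pull_zero (w : ExteriorAlgebra K (Fin (n + 1) → K)) :
    topCoeff K n (ExteriorAlgebra.map (covPull K (Fin.succAbove 0)) w) =
      ∑ j, topCoeff K (n + 1) (ExteriorAlgebra.ι K (Pi.single j 1) * w) := by
  have hs : ∑ j : Fin (n + 1), topCoeff K (n + 1) (ExteriorAlgebra.ι K (Pi.single j 1) * w) =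
      topCoeff K (n + 1) (ExteriorAlgebra.ι K (fun _ => 1) * w) := by
    rw [← map_sum, ← Finset.sum_mul, ← map_sum]
    congr 3
    ext j
    simp [Finset.sum_apply, Pi.single_apply]
  rw [hs]
  suffices h : topCoeff K n ∘ₗ (ExteriorAlgebra.map (covPull K (Fin.succAbove 0))).toLinearMap =
      topCoeff K (n + 1) ∘ₗ LinearMap.mulLeft K (ExteriorAlgebra.ι K (fun _ => 1)) from
    LinearMap.congr_fun h w
  refine ExteriorAlgebra.lhom_ext fun i => AlternatingMap.ext fun v => ?_
  simp only [LinearMap.compAlternatingMap_apply, LinearMap.comp_apply,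
    AlgHom.toLinearMap_apply, ExteriorAlgebra.map_apply_ιMulti, LinearMap.mulLeft_apply]
  have hc : ExteriorAlgebra.ι K (fun _ => (1 : K)) * ExteriorAlgebra.ιMulti K i v =
      ExteriorAlgebra.ιMulti K (i + 1) (Fin.cons (fun _ => 1) v) := by
    rw [ExteriorAlgebra.ιMulti_succ_apply]
    rfl
  rw [hc]
  by_cases hi : i = n
  · subst hi
    -- subtract the first column from the others
    let B : Matrix (Fin (i + 1)) (Fin (i + 1)) K := Matrix.of fun r a =>
      Fin.cases ((Fin.cons (fun _ => 1) v : Fin (i + 1) → Fin (i + 1) → K) r 0)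
        (fun a => (Fin.cons (fun _ => 1) v : Fin (i + 1) → Fin (i + 1) → K) r a.succ -
          (Fin.cons (fun _ => 1) v : Fin (i + 1) → Fin (i + 1) → K) r 0) a
    have hB : Matrix.det (Matrix.of (Fin.cons (fun _ => 1) v : Fin (i + 1) → Fin (i + 1) → K)) =
        B.det := by
      rw [← Matrix.det_transpose, ← Matrix.det_transpose B]
      refine Matrix.det_eq_of_forall_row_eq_smul_add_const (fun a => if a = 0 then 0 else 1) 0
        (by simp) fun a r => ?_
      refine Fin.cases ?_ (fun a => ?_) a <;> simp [B]
    rw [topCoeff_ιMulti, topCoeff_ιMulti, hB, Matrix.det_succ_row_zero, Finset.sum_eq_single 0]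
    · simp only [Fin.val_zero, pow_zero, one_mul]
      have : B 0 0 = 1 := rfl
      rw [this, one_mul]
      congr 1
      ext r a
      exact congrFun (covPull_succAbove_zero (v r)) a
    · intro b _ hb
      obtain ⟨b, rfl⟩ := Fin.exists_succ_eq_of_ne_zero hb
      have : B 0 b.succ = 0 := by simp [B]
      rw [this]
      ring
    · simp
  · rw [topCoeff_ιMulti_of_ne hi, topCoeff_ιMulti_of_ne (by omega)]

/-- Stokes' theorem on the simplex. -/
theorem stokes [CharZero K] (ω : Form K (n + 1)) : formIntegral K (n + 1) (formD K (n + 1) ω) =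
    ∑ j : Fin (n + 2), (-1 : K) ^ (j : ℕ) * formIntegral K n (formPull K (Fin.succAbove j) ω) := by
  induction ω using TensorProduct.induction_on with
  | zero => simp
  | add x y hx hy => simp only [map_add, hx, hy, mul_add, Finset.sum_add_distrib]
  | tmul p w =>
    simp only [formD, LinearMap.sum_apply, map_sum, TensorProduct.map_tmul, formIntegral,
      LinearMap.comp_apply, LinearMap.mul'_apply, formPull, Algebra.TensorProduct.map_tmul,
      LinearMap.mulLeft_apply, Derivation.coeFn_coe, polyIntegral_pderiv]
    rw [Fin.sum_univ_succ (n := n + 1), topCoeff_pull_zero]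
    simp only [topCoeff_pull_succ, Fin.val_zero, pow_zero, one_mul, Finset.mul_sum]
    rw [← Finset.sum_add_distrib]
    refine Finset.sum_congr rfl fun j _ => ?_
    have : (-1 : K) ^ (j : ℕ) * (-1 : K) ^ (j : ℕ) = 1 := by
      rw [← mul_pow]; simp
    rw [Fin.val_succ, pow_succ]
    linear_combination (polyIntegral K n (polyPull K (Fin.succAbove j.succ) p) *
      topCoeff K (n + 1) (ExteriorAlgebra.ι K (Pi.single j 1) * w)) * this

end Stokes

/-! ### Dupont's homotopy -/

section Dupont

variable {K : Type v} [Field K] {n m : ℕ}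

variable (K) in
/-- The composition `h_{v_k} ⋯ h_{v₀}`, by recursion on the list of vertices. -/
noncomputable def coneList : List (Fin (n + 1)) → Module.End K (Form K n)
  | [] => 1
  | i :: v => coneList v * coneHomotopy K i

variable (K) in
/-- The alternating sum of the compositions of all but one of `h_{v_k}, …, h_{v₀}`. -/
noncomputable def coneListFacets : List (Fin (n + 1)) → Module.End K (Form K n)
  | [] => 0
  | i :: v => coneList K v - coneListFacets v * coneHomotopy K i

variable (K) in
/-- The operator `(-1)ᵏ ε_{v_k} h_{v_{k-1}} ⋯ h_{v₀}`, where `εᵢ` is the evaluation at the `i`-th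
vertex; it is the integral over the face with vertices `v₀, …, v_k`, see `coneListEval_ofFn`. -/
noncomputable def coneListEval : List (Fin (n + 1)) → Module.End K (Form K n)
  | [] => 0
  | [i] => vertexConst K i
  | i :: j :: v => -(coneListEval (j :: v) * coneHomotopy K i)

theorem coneList_ofFn {c : ℕ} (v : Fin c → Fin (n + 1)) :
    coneList K (List.ofFn v) = iterHomotopy K v := by
  induction c with
  | zero => simp [coneList, iterHomotopy]
  | succ c ih =>
    rw [List.ofFn_succ, coneList, ih, iterHomotopy, iterHomotopy, List.ofFn_succ (n := c),
      List.reverse_cons, List.prod_append, List.prod_singleton]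

/-- The commutator of the de Rham differential with a composition of Poincaré homotopies. -/
theorem coneList_formD [CharZero K] (v : List (Fin (n + 1))) (ω : Form K n) :
    coneList K v (formD K n ω) = (-1 : K) ^ v.length • formD K n (coneList K v ω) -
      coneListFacets K v ω + coneListEval K v ω := by
  induction v generalizing ω with
  | nil =>
    change formD K n ω = (-1 : K) ^ 0 • formD K n ω - 0 + 0
    rw [pow_zero, one_smul, sub_zero, add_zero]
  | cons i v ih =>
    have e : coneList K v (vertexConst K i ω) - coneListEval K v (coneHomotopy K i ω) =
        coneListEval K (i :: v) ω := by
      cases v with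
      | nil => exact sub_zero _
      | cons j v =>
        have h := LinearMap.congr_fun (coneHomotopy_vertexConst (K := K) j i) ω
        change coneList K v ((coneHomotopy K j * vertexConst K i) ω) - _ = -_
        rw [h, LinearMap.zero_apply, map_zero, zero_sub]
        rfl
    have h1 : coneList K (i :: v) (formD K n ω) =
        coneList K v (coneHomotopy K i (formD K n ω)) := rfl
    have h2 : coneList K (i :: v) ω = coneList K v (coneHomotopy K i ω) := rfl
    have h3 : coneListFacets K (i :: v) ω =
        coneList K v ω - coneListFacets K v (coneHomotopy K i ω) := rfl
    rw [h1, h2, h3, ← e, poincare, map_sub, map_sub, ih, List.length_cons, pow_succ, mul_neg_one,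
      form_neg_smul]
    abel

theorem coneListFacets_eq (v : List (Fin (n + 1))) (ω : Form K n) : coneListFacets K v ω =
    ∑ j : Fin v.length, (-1 : ℤ) ^ (j : ℕ) • coneList K (v.eraseIdx j) ω := by
  induction v generalizing ω with
  | nil => simp [coneListFacets]
  | cons i v ih =>
    have h3 : coneListFacets K (i :: v) ω =
        coneList K v ω - coneListFacets K v (coneHomotopy K i ω) := rfl
    rw [h3, ih]
    change _ = ∑ j : Fin (v.length + 1), _
    rw [Fin.sum_univ_succ, sub_eq_add_neg, ← Finset.sum_neg_distrib]
    congr 1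
    · simp
    · refine Finset.sum_congr rfl fun j _ => ?_
      rw [Fin.val_succ, List.eraseIdx_cons_succ, pow_succ, mul_neg_one, neg_smul]
      rfl

theorem Face.sort_erase_vertex (I : Face n) (j : Fin (I.dim + 1)) :
    (I.1.erase (I.vertex j)).sort (· ≤ ·) = I.list.eraseIdx j := by
  have hj : (j : ℕ) < I.list.length := by rw [I.length_list]; exact j.2
  have hv : I.vertex j = I.list[(j : ℕ)] := by
    have h := I.ofFn_vertex
    simp only [← h, List.getElem_ofFn]
  rw [← List.Nodup.erase_getElem (Finset.sort_nodup _ _) _ hj, ← hv]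
  refine List.Perm.eq_of_pairwise' (r := (· ≤ ·)) (Finset.pairwise_sort _ _)
    ((Finset.pairwise_sort _ _).sublist List.erase_sublist) ?_
  rw [← Multiset.coe_eq_coe, ← Multiset.coe_erase, Finset.sort_eq, Finset.sort_eq, Finset.erase_val]

theorem coneListFacets_face (I : Face n) (ω : Form K n) : coneListFacets K I.list ω =
    (∑ j : Fin (I.dim + 1), if h : (I.1.erase (I.vertex j)).Nonempty then
      (-1 : ℤ) ^ (j : ℕ) • coneList K (Face.list ⟨_, h⟩) ω else 0) +
        if I.dim = 0 then ω else 0 := by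
  have h1 : ∀ (c : ℕ), I.list.length = c → coneListFacets K I.list ω =
      ∑ j : Fin c, (-1 : ℤ) ^ (j : ℕ) • coneList K (I.list.eraseIdx j) ω := by
    rintro c rfl
    exact coneListFacets_eq _ _
  rw [h1 _ I.length_list]
  simp only [← I.sort_erase_vertex]
  by_cases hd : I.dim = 0
  · have hs : ∀ j, ¬ (I.1.erase (I.vertex j)).Nonempty := by
      intro j
      rw [← Finset.card_pos, Finset.card_erase_of_mem (I.vertex_mem j), I.card_eq, hd]
      simp
    have hs' : ∀ j, I.1.erase (I.vertex j) = ∅ := fun j => Finset.not_nonempty_iff_eq_empty.1 (hs j)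
    have hj : ∀ j : Fin (I.dim + 1), (j : ℕ) = 0 := fun j => by have := j.2; omega
    simp [hs', hd, coneList, hj]
  · have hs : ∀ j, (I.1.erase (I.vertex j)).Nonempty := by
      intro j
      rw [← Finset.card_pos, Finset.card_erase_of_mem (I.vertex_mem j), I.card_eq]
      omega
    simp [hs, hd]

theorem topCoeff_eq_zero {d : ℕ} (hd : d ≠ n) {w : ExteriorAlgebra K (Fin n → K)}
    (hw : w ∈ ⋀[K]^d (Fin n → K)) : topCoeff K n w = 0 := by
  rw [← ExteriorAlgebra.ιMulti_span_fixedDegree] at hw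
  induction hw using Submodule.span_induction with
  | mem x hx => obtain ⟨w, rfl⟩ := hx; exact topCoeff_ιMulti_of_ne hd w
  | zero => exact map_zero _
  | add x y _ _ hx hy => rw [map_add, hx, hy, add_zero]
  | smul c x _ hx => rw [map_smul, hx, smul_zero]

theorem formIntegral_of_mem {d : ℕ} (hd : d ≠ n) {ω : Form K n} (h : ω ∈ formDeg K n d) :
    formIntegral K n ω = 0 := by
  suffices hs : formDeg K n d ≤ LinearMap.ker (formIntegral K n) from hs h
  rw [formDeg, Submodule.map₂_le]
  intro p _ w hw
  simp [formIntegral, topCoeff_eq_zero hd hw]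

theorem formIntegral_coneHomotopy (i : Fin (n + 1)) (ω : Form K n) :
    formIntegral K n (coneHomotopy K i ω) = 0 := by
  induction ω using form_homogeneous_induction with
  | hom d ω h =>
    rcases Nat.lt_or_ge n d with hd | hd
    · rw [formDeg_eq_zero hd h, map_zero, map_zero]
    · rcases Nat.eq_zero_or_pos d with rfl | hd'
      · rw [coneHomotopy_zero_of_mem i h, map_zero]
      · exact formIntegral_of_mem (by omega) (coneHomotopy_mem i h)
  | add x y hx hy => rw [map_add, map_add, hx, hy, add_zero]

/-- Integration over a simplex, as an iterated integral: the simplex is a cone. -/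
theorem formIntegral_succ [CharZero K] (ω : Form K (n + 1)) : formIntegral K (n + 1) ω =
    -formIntegral K n (formPull K Fin.succ (coneHomotopy K 0 ω)) := by
  have h := congrArg (formIntegral K (n + 1)) (poincare 0 ω)
  rw [formIntegral_coneHomotopy, map_sub, map_sub, vertexConst_apply,
    formIntegral_of_mem (by omega) (fn_mem _), stokes, Fin.sum_univ_succ,
    Finset.sum_eq_zero] at h
  · simp only [Fin.val_zero, pow_zero, one_mul, Fin.succAbove_zero, add_zero] at h
    linear_combination h
  · intro j _
    -- the homotopy of the cone restricts to the homotopy of the facets containing the apex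
    have e := formPull_coneHomotopy (K := K) (Fin.succAbove j.succ) 0 ω
    rw [Fin.succ_succAbove_zero] at e
    rw [e, formIntegral_coneHomotopy, mul_zero]

/-- Integration over a face is an iterated cone homotopy followed by an evaluation at a vertex. -/
theorem coneListEval_ofFn [CharZero K] {c : ℕ} (v : Fin (c + 1) → Fin (n + 1)) (ω : Form K n) :
    coneListEval K (List.ofFn v) ω = algebraMap K _ (formIntegral K c (formPull K v ω)) := by
  induction c generalizing ω with
  | zero =>
    have : v = fun _ => v 0 := funext fun a => by rw [Fin.fin_one_eq_zero a]
    rw [this]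
    simp [List.ofFn_succ, coneListEval]
    rfl
  | succ c ih =>
    have h1 : List.ofFn v = v 0 :: List.ofFn fun a => v a.succ := List.ofFn_succ
    have h2 : (List.ofFn fun a => v a.succ) = v (Fin.succ 0) :: List.ofFn fun a => v a.succ.succ :=
      List.ofFn_succ
    have h3 := formPull_coneHomotopy (K := K) v 0 ω
    have h4 : ∀ η : Form K n, formPull K Fin.succ (formPull K v η) =
        formPull K (fun a => v a.succ) η := fun η =>
      DFunLike.congr_fun (formPull_comp (K := K) v Fin.succ) η
    rw [formIntegral_succ, ← h3, h4, map_neg, ← ih, h1, h2, coneListEval]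
    rfl

/-- Dupont's homotopy is a homotopy between the identity and the projection onto the Whitney
forms given by integration over the faces. -/
theorem dupont_formD [CharZero K] (ω : Form K n) :
    dupont K n (formD K n ω) + formD K n (dupont K n ω) =
      (∑ I : Face n, formIntegral K I.dim (formPull K I.vertex ω) • whitney K I.vertex) - ω := by
  simp only [dupont, LinearMap.sum_apply, map_sum, LinearMap.comp_apply, LinearMap.mulLeft_apply,
    ← coneList_ofFn, Face.ofFn_vertex]
  rw [← Finset.sum_add_distrib]
  have h1 : ∀ I : Face n, whitney K I.vertex * coneList K I.list (formD K n ω) +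
      formD K n (whitney K I.vertex * coneList K I.list ω) =
      formIntegral K I.dim (formPull K I.vertex ω) • whitney K I.vertex +
      (formD K n (whitney K I.vertex) * coneList K I.list ω -
        whitney K I.vertex * coneListFacets K I.list ω) := by
    intro I
    rw [coneList_formD, formD_mul, parity_of_mem (whitney_mem I), ← I.ofFn_vertex,
      coneListEval_ofFn,
      I.ofFn_vertex, I.length_list, pow_succ, mul_neg_one, form_neg_smul, mul_add,
      form_mul_sub, form_mul_neg, mul_smul_comm, smul_mul_assoc, ← Algebra.commutes,
      ← Algebra.smul_def]
    abel
  rw [Finset.sum_congr rfl fun I _ => h1 I, Finset.sum_add_distrib, sub_eq_add_neg]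
  congr 1
  rw [Finset.sum_sub_distrib]
  have h2 := sum_facets (M := Form K n) fun I J : Face n =>
    whitney K I.vertex * coneList K J.list ω
  have h3 : ∀ I : Face n, whitney K I.vertex * coneListFacets K I.list ω =
      (∑ j : Fin (I.dim + 1), if h : (I.1.erase (I.vertex j)).Nonempty then
        (-1 : ℤ) ^ (j : ℕ) • (whitney K I.vertex * coneList K (Face.list ⟨_, h⟩) ω) else 0) +
      (if I.dim = 0 then whitney K I.vertex else 0) * ω := by
    intro I
    rw [coneListFacets_face, mul_add, Finset.mul_sum]
    congr 1
    · refine Finset.sum_congr rfl fun j _ => ?_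
      split_ifs
      · rw [mul_smul_comm]
      · simp
    · split_ifs <;> simp
  rw [Finset.sum_congr rfl fun I _ => h3 I, Finset.sum_add_distrib, h2, ← Finset.sum_mul,
    sum_whitney_vertices, one_mul]
  have h4 : ∀ J : Face n, formD K n (whitney K J.vertex) * coneList K J.list ω =
      ∑ i ∈ J.1ᶜ, (-1 : ℤ) ^ J.below i • (whitney K (J.insert i).vertex * coneList K J.list ω) := by
    intro J
    rw [formD_whitney, Finset.sum_mul]
    exact Finset.sum_congr rfl fun i _ => smul_mul_assoc _ _ _
  rw [Finset.sum_congr rfl fun J _ => h4 J]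
  abel

end Dupont

/-! ### Extension of multilinear operations to tensor products -/

section Extend

variable {K : Type v} [Field K] {A : Type*} [Ring A] [Algebra K A] {V : Type u} [AddCommGroup V]
  [Module K V]

theorem extend_cons_tmul {k : ℕ} (a : A) (v : V) (x : Fin k → A ⊗[K] V)
    (q : MultilinearMap K (fun _ : Fin (k + 1) => V) V) :
    extend K (k + 1) (Fin.cons (a ⊗ₜ v) x) q =
      (LinearMap.mulRight K a).rTensor V (extend K k x (q.curryLeft v)) := by
  simp only [extend, Fin.cons_zero, Fin.tail_cons, TensorProduct.lift.tmul]
  rfl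

theorem extend_cons_add {k : ℕ} (y z : A ⊗[K] V) (x : Fin k → A ⊗[K] V)
    (q : MultilinearMap K (fun _ : Fin (k + 1) => V) V) :
    extend K (k + 1) (Fin.cons (y + z) x) q =
      extend K (k + 1) (Fin.cons y x) q + extend K (k + 1) (Fin.cons z x) q := by
  simp only [extend, Fin.cons_zero, Fin.tail_cons, map_add, LinearMap.add_apply]

theorem extend_cons_smul {k : ℕ} (c : K) (y : A ⊗[K] V) (x : Fin k → A ⊗[K] V)
    (q : MultilinearMap K (fun _ : Fin (k + 1) => V) V) :
    extend K (k + 1) (Fin.cons (c • y) x) q = c • extend K (k + 1) (Fin.cons y x) q := by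
  simp only [extend, Fin.cons_zero, Fin.tail_cons, map_smul, LinearMap.smul_apply]

theorem extend_cons_zero {k : ℕ} (x : Fin k → A ⊗[K] V)
    (q : MultilinearMap K (fun _ : Fin (k + 1) => V) V) :
    extend K (k + 1) (Fin.cons 0 x) q = 0 := by
  simp only [extend, Fin.cons_zero, map_zero, LinearMap.zero_apply]

theorem extend_update_add {k : ℕ} [hk : DecidableEq (Fin k)] (x : Fin k → A ⊗[K] V) (i : Fin k)
    (y z : A ⊗[K] V) (q : MultilinearMap K (fun _ : Fin k => V) V) :
    extend K k (Function.update x i (y + z)) q =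
      extend K k (Function.update x i y) q + extend K k (Function.update x i z) q := by
  obtain rfl : hk = instDecidableEqFin k := Subsingleton.elim _ _
  induction k with
  | zero => exact i.elim0
  | succ k ih =>
    rw [← Fin.cons_self_tail x]
    generalize x 0 = x0
    generalize Fin.tail x = x
    refine Fin.cases ?_ (fun i => ?_) i
    · simp only [Fin.update_cons_zero, extend_cons_add]
    · simp only [← Fin.cons_update]
      induction x0 with
      | zero => simp only [extend_cons_zero, add_zero]
      | add u w hu hw => simp only [extend_cons_add, hu, hw]; abel
      | tmul a v => simp only [extend_cons_tmul, ih, map_add]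

theorem extend_update_smul {k : ℕ} [hk : DecidableEq (Fin k)] (x : Fin k → A ⊗[K] V) (i : Fin k)
    (c : K) (y : A ⊗[K] V) (q : MultilinearMap K (fun _ : Fin k => V) V) :
    extend K k (Function.update x i (c • y)) q = c • extend K k (Function.update x i y) q := by
  obtain rfl : hk = instDecidableEqFin k := Subsingleton.elim _ _
  induction k with
  | zero => exact i.elim0
  | succ k ih =>
    rw [← Fin.cons_self_tail x]
    generalize x 0 = x0
    generalize Fin.tail x = x
    refine Fin.cases ?_ (fun i => ?_) i
    · simp only [Fin.update_cons_zero, extend_cons_smul]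
    · simp only [← Fin.cons_update]
      induction x0 with
      | zero => simp only [extend_cons_zero, smul_zero]
      | add u w hu hw => simp only [extend_cons_add, hu, hw, smul_add]
      | tmul a v => simp only [extend_cons_tmul, ih, map_smul]

variable (A) in
/-- The extension of a multilinear operation on `V` to `A ⊗ V`, as a multilinear map. -/
noncomputable def extendMulti {k : ℕ} (q : MultilinearMap K (fun _ : Fin k => V) V) :
    MultilinearMap K (fun _ : Fin k => A ⊗[K] V) (A ⊗[K] V) where
  toFun x := extend K k x q
  map_update_add' x i y z := extend_update_add x i y z q
  map_update_smul' x i c y := extend_update_smul x i c y q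

theorem extendMulti_tmul {k : ℕ} (a : Fin k → A) (x : Fin k → V)
    (q : MultilinearMap K (fun _ : Fin k => V) V) :
    extendMulti A q (fun j => a j ⊗ₜ x j) = (List.ofFn a).reverse.prod ⊗ₜ q x :=
  extend_tmul K a x q

theorem extendMulti_cons_tmul {k : ℕ} (a : A) (v : V) (x : Fin k → A ⊗[K] V)
    (q : MultilinearMap K (fun _ : Fin (k + 1) => V) V) :
    extendMulti A q (Fin.cons (a ⊗ₜ v) x) =
      (LinearMap.mulRight K a).rTensor V (extendMulti A (q.curryLeft v) x) :=
  extend_cons_tmul a v x q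

theorem map_extendMulti (φ : A →ₐ[K] A) {k : ℕ} (q : MultilinearMap K (fun _ : Fin k => V) V)
    (x : Fin k → A ⊗[K] V) :
    φ.toLinearMap.rTensor V (extendMulti A q x) =
      extendMulti A q fun j => φ.toLinearMap.rTensor V (x j) :=
  map_extend K φ LinearMap.id x q q fun _ => rfl

end Extend

/-! ### Koszul signs in products of forms -/

section Signs

variable {K : Type v} [Field K] {n : ℕ}

/-- The product of the forms `ω a`, `a ∈ T`, in decreasing order. -/
noncomputable def revProd {k : ℕ} (ω : Fin k → Form K n) (T : Finset (Fin k)) : Form K n :=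
  ((T.sort (· ≤ ·)).map ω).reverse.prod

theorem revProd_insert {k : ℕ} (ω : Fin k → Form K n) {T : Finset (Fin k)} {a : Fin k}
    (ha : ∀ b ∈ T, a < b) : revProd ω (insert a T) = revProd ω T * ω a := by
  rw [revProd, Finset.sort_insert _ (fun b hb => (ha b hb).le) fun h => (ha a h).false]
  simp [revProd]

theorem revProd_mem {k : ℕ} {ω : Fin k → Form K n} {d : Fin k → ℕ}
    (h : ∀ a, ω a ∈ formDeg K n (d a)) (T : Finset (Fin k)) :
    revProd ω T ∈ formDeg K n (∑ a ∈ T, d a) := by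
  induction T using Finset.induction_on_min with
  | empty => simp only [revProd, Finset.sort_empty, Finset.sum_empty]; exact fn_mem 1
  | insert a T ha ih =>
    rw [revProd_insert ω ha, Finset.sum_insert fun h => (ha a h).false, add_comm]
    exact mul_mem_formDeg ih (h a)

theorem revProd_sdiff_mul {k : ℕ} {ω : Fin k → Form K n} {d : Fin k → ℕ}
    (h : ∀ a, ω a ∈ formDeg K n (d a)) (U S : Finset (Fin k)) (hS : S ⊆ U) :
    revProd ω (U \ S) * revProd ω S =
      (-1 : K) ^ (∑ a ∈ S, ∑ b ∈ U \ S with b < a, d a * d b) • revProd ω U := by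
  induction U using Finset.induction_on_min generalizing S with
  | empty => rw [Finset.subset_empty.1 hS]; simp [revProd]
  | insert m U hm ih =>
    have hmU : m ∉ U := fun h => (hm m h).false
    rw [revProd_insert ω hm]
    by_cases hmS : m ∈ S
    · obtain ⟨T, hmT, rfl⟩ : ∃ T, m ∉ T ∧ insert m T = S :=
        ⟨S.erase m, Finset.notMem_erase m S, Finset.insert_erase hmS⟩
      have hT : T ⊆ U := fun x hx =>
        (Finset.mem_insert.1 (hS (Finset.mem_insert_of_mem hx))).resolve_left
          fun h => hmT (h ▸ hx)
      have e : insert m U \ insert m T = U \ T := by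
        ext x
        simp only [Finset.mem_sdiff, Finset.mem_insert, not_or]
        constructor
        · rintro ⟨rfl | h, h1, h2⟩
          · exact absurd rfl h1
          · exact ⟨h, h2⟩
        · exact fun ⟨h1, h2⟩ => ⟨Or.inr h1, fun h => hmU (h ▸ h1), h2⟩
      have e0 : ∑ b ∈ U \ T with b < m, d m * d b = 0 := by
        rw [Finset.filter_false_of_mem, Finset.sum_empty]
        exact fun b hb => (hm b (Finset.mem_sdiff.1 hb).1).le.not_gt
      rw [e, revProd_insert ω fun b hb => hm b (hT hb), ← mul_assoc, ih T hT,
        Finset.sum_insert hmT, e0, zero_add, smul_mul_assoc]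
    · have hT : S ⊆ U := fun x hx =>
        (Finset.mem_insert.1 (hS hx)).resolve_left fun h => hmS (h ▸ hx)
      have e : insert m U \ S = insert m (U \ S) := Finset.insert_sdiff_of_notMem _ hmS
      have hmUS : m ∉ U \ S := fun h => hmU (Finset.mem_sdiff.1 h).1
      have e0 : ∑ a ∈ S, ∑ b ∈ insert m (U \ S) with b < a, d a * d b =
          d m * ∑ a ∈ S, d a + ∑ a ∈ S, ∑ b ∈ U \ S with b < a, d a * d b := by
        rw [Finset.mul_sum, ← Finset.sum_add_distrib]
        refine Finset.sum_congr rfl fun a ha => ?_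
        rw [Finset.filter_insert, if_pos (hm a (hT ha)), Finset.sum_insert, mul_comm (d m)]
        exact fun h => hmUS (Finset.mem_filter.1 h).1
      rw [e, revProd_insert ω fun b hb => hm b (Finset.mem_sdiff.1 hb).1, mul_assoc,
        form_mul_comm (h m) (revProd_mem h S), mul_smul_comm, ← mul_assoc, ih S hT, smul_mul_assoc,
        smul_smul, e0, pow_add]

theorem revProd_restrict {k : ℕ} (ω : Fin k → Form K n) (S : Finset (Fin k)) :
    (List.ofFn (restrict S ω)).reverse.prod = revProd ω S := by
  rw [revProd]
  congr 2
  refine List.ext_getElem ?_ fun a h1 h2 => ?_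
  · simp
  · rw [List.getElem_ofFn, List.getElem_map]
    rfl

theorem revProd_univ {k : ℕ} (ω : Fin k → Form K n) :
    (List.ofFn ω).reverse.prod = revProd ω Finset.univ := by
  rw [revProd]
  congr 2
  rw [Fin.sort_univ, List.ofFn_eq_map]

theorem negOnePow_smul {M : Type*} [AddCommGroup M] [Module K M] (d : ℕ) (x : M) :
    (d : ℤ).negOnePow • x = (-1 : K) ^ d • x := by
  induction d with
  | zero => simp
  | succ d ih => rw [Nat.cast_succ, Int.negOnePow_succ, Units.neg_smul, ih, pow_succ, mul_neg_one,
      neg_smul]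

/-- The product of forms in the order given by an unshuffle. -/
theorem prod_unshuffle {k : ℕ} {ω : Fin k → Form K n} {d : Fin k → ℕ}
    (h : ∀ a, ω a ∈ formDeg K n (d a)) (S : Finset (Fin k)) :
    (List.ofFn (restrict Sᶜ ω)).reverse.prod * (List.ofFn (restrict S ω)).reverse.prod =
      (unshuffleSign (fun a => -(d a : ℤ)) S).negOnePow • (List.ofFn ω).reverse.prod := by
  have e : unshuffleSign (fun a => -(d a : ℤ)) S =
      ((∑ a ∈ S, ∑ b ∈ Finset.univ \ S with b < a, d a * d b : ℕ) : ℤ) := by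
    rw [unshuffleSign, Finset.compl_eq_univ_sdiff]
    push_cast
    simp
  rw [e, negOnePow_smul (K := K), revProd_restrict, revProd_restrict, revProd_univ,
    Finset.compl_eq_univ_sdiff, revProd_sdiff_mul h _ _ (Finset.subset_univ S)]

end Signs

/-! ### Forms with coefficients in an `L∞` algebra -/

section FormCoefficients

variable {K : Type v} [Field K]

/-- A property of the values of a multilinear map can be checked on generators. -/
theorem multilinear_mem_of_span {E F : Type*} [AddCommMonoid E] [Module K E] [AddCommMonoid F]
    [Module K F] {k : ℕ} (M : MultilinearMap K (fun _ : Fin k => E) F) (S : Fin k → Set E)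
    (N : Submodule K F) (h : ∀ y, (∀ j, y j ∈ S j) → M y ∈ N) {x : Fin k → E}
    (hx : ∀ j, x j ∈ Submodule.span K (S j)) : M x ∈ N := by
  induction k with
  | zero => exact h x fun j => j.elim0
  | succ k ih =>
    rw [← Fin.cons_self_tail x]
    have h0 := hx 0
    generalize x 0 = x0 at h0
    induction h0 using Submodule.span_induction with
    | mem y hy =>
      exact ih (M.curryLeft y) (fun j => S j.succ)
        (fun z hz => h _ (Fin.cases hy hz)) (fun j => hx j.succ)
    | zero => rw [M.map_coord_zero 0 (Fin.cons_zero _ _)]; exact N.zero_mem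
    | add y z _ _ hy hz => rw [M.cons_add]; exact add_mem hy hz
    | smul c y _ hy => rw [M.cons_smul]; exact N.smul_mem c hy

variable (L : CompleteLInfty.{u} K) (n : ℕ)

/-- The decomposable elements of degree `k` of `Ω*(Δₙ) ⊗ L`. -/
def pureDeg (k : ℤ) : Set (Form K n ⊗[K] L) :=
  {x | ∃ (d : ℕ) (ω : Form K n) (l : L), ω ∈ formDeg K n d ∧ l ∈ L.deg (k - d) ∧ x = ω ⊗ₜ l}

/-- The elements of degree `k` of `Ω*(Δₙ) ⊗ L`. -/
noncomputable def tensorDeg (k : ℤ) : Submodule K (Form K n ⊗[K] L) :=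
    Submodule.span K (pureDeg L n k)

/-- The filtration `Ω*(Δₙ) ⊗ FᵖL` of `Ω*(Δₙ) ⊗ L`. -/
noncomputable def tensorFilt (p : ℕ) : Submodule K (Form K n ⊗[K] L) :=
  Submodule.map₂ (TensorProduct.mk K (Form K n) L) ⊤ (L.filt p)

/-- The parity of forms, on `Ω*(Δₙ) ⊗ L`. -/
noncomputable def tensorParity : Form K n ⊗[K] L →ₗ[K] Form K n ⊗[K] L :=
  (formParity K n).toLinearMap.rTensor L

/-- The de Rham differential on `Ω*(Δₙ) ⊗ L`. -/
noncomputable def tensorD : Form K n ⊗[K] L →ₗ[K] Form K n ⊗[K] L := (formD K n).rTensor L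

variable {L n}

theorem tensorFilt_antitone : Antitone (tensorFilt L n) := fun _ _ h =>
  Submodule.map₂_le_map₂_right (L.filt_antitone h)

theorem tensorFilt_one : tensorFilt L n 1 = ⊤ := by
  rw [tensorFilt, L.filt_one, TensorProduct.map₂_mk_top_top_eq_top]

theorem tensorFilt_of_le {p : ℕ} (hp : p ≤ 1) (x : Form K n ⊗[K] L) : x ∈ tensorFilt L n p :=
  tensorFilt_antitone hp (by rw [tensorFilt_one]; trivial)

theorem rTensor_mem_filt {m : ℕ} (g : Form K n →ₗ[K] Form K m) {p : ℕ} {x : Form K n ⊗[K] L}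
    (hx : x ∈ tensorFilt L n p) : g.rTensor L x ∈ tensorFilt L m p := by
  suffices h : tensorFilt L n p ≤ (tensorFilt L m p).comap (g.rTensor L) from h hx
  rw [tensorFilt, Submodule.map₂_le]
  intro ω _ l hl
  exact Submodule.apply_mem_map₂ _ trivial hl

theorem rTensor_mem_deg {m : ℕ} (g : Form K n →ₗ[K] Form K m) (s : ℕ → ℕ) (t : ℤ)
    (hg : ∀ d, ∀ ω ∈ formDeg K n d, g ω ∈ formDeg K m (s d) ∧ ((s d : ℤ) = d + t ∨ g ω = 0))
    {k : ℤ} {x : Form K n ⊗[K] L} (hx : x ∈ tensorDeg L n k) :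
    g.rTensor L x ∈ tensorDeg L m (k + t) := by
  suffices h : tensorDeg L n k ≤ (tensorDeg L m (k + t)).comap (g.rTensor L) from h hx
  rw [tensorDeg, Submodule.span_le]
  rintro _ ⟨d, ω, l, hω, hl, rfl⟩
  obtain ⟨h1, h2 | h2⟩ := hg d ω hω
  · exact Submodule.subset_span ⟨s d, g ω, l, h1, by
      rw [h2, add_sub_add_right_eq_sub]; exact hl, rfl⟩
  · change g ω ⊗ₜ[K] l ∈ tensorDeg L m (k + t)
    rw [h2, TensorProduct.zero_tmul]
    exact zero_mem _

theorem tensorParity_tmul {d : ℕ} {ω : Form K n} (h : ω ∈ formDeg K n d) (l : L) :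
    tensorParity L n (ω ⊗ₜ l) = (-1 : K) ^ d • ω ⊗ₜ l := by
  change formParity K n ω ⊗ₜ l = _
  rw [parity_of_mem h, TensorProduct.smul_tmul']

theorem tensorParity_tensorParity (x : Form K n ⊗[K] L) :
    tensorParity L n (tensorParity L n x) = x := by
  induction x with
  | zero => simp
  | add x y hx hy => simp only [map_add, hx, hy]
  | tmul ω l =>
    change formParity K n (formParity K n ω) ⊗ₜ l = _
    rw [parity_parity]

theorem tensorD_tensorParity (x : Form K n ⊗[K] L) :
    tensorD L n (tensorParity L n x) = (-1 : K) • tensorParity L n (tensorD L n x) := by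
  induction x with
  | zero => simp
  | add x y hx hy => simp only [map_add, hx, hy, smul_add]
  | tmul ω l =>
    change formD K n (formParity K n ω) ⊗ₜ l = (-1 : K) • formParity K n (formD K n ω) ⊗ₜ[K] l
    rw [parity_formD, TensorProduct.smul_tmul', neg_one_smul, neg_neg]

theorem tensorD_tensorD (x : Form K n ⊗[K] L) : tensorD L n (tensorD L n x) = 0 := by
  induction x with
  | zero => simp
  | add x y hx hy => simp only [map_add, hx, hy, add_zero]
  | tmul ω l =>
    change formD K n (formD K n ω) ⊗ₜ l = 0
    rw [formD_formD, TensorProduct.zero_tmul]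

theorem tensorD_mem_deg {k : ℤ} {x : Form K n ⊗[K] L} (hx : x ∈ tensorDeg L n k) :
    tensorD L n x ∈ tensorDeg L n (k + 1) :=
  rTensor_mem_deg (formD K n) (fun d => d + 1) 1
    (fun d ω h => ⟨formD_mem h, Or.inl (by push_cast; ring)⟩) hx

theorem tensorParity_mem_deg {k : ℤ} {x : Form K n ⊗[K] L} (hx : x ∈ tensorDeg L n k) :
    tensorParity L n x ∈ tensorDeg L n k := by
  have := rTensor_mem_deg (formParity K n).toLinearMap id 0 (fun d ω h =>
    ⟨by rw [AlgHom.toLinearMap_apply, parity_of_mem h]; exact Submodule.smul_mem _ _ h,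
      Or.inl (by simp)⟩) hx
  rwa [add_zero] at this

theorem iUnion_pureDeg_span : Submodule.span K (⋃ k, pureDeg L n k) = ⊤ := by
  rw [eq_top_iff]
  intro x hx
  clear hx
  induction x with
  | zero => exact zero_mem _
  | add x y hx hy => exact add_mem hx hy
  | tmul ω l =>
    induction ω using form_homogeneous_induction with
    | add x y hx hy => rw [TensorProduct.add_tmul]; exact add_mem hx hy
    | hom d ω hω =>
      have hl : l ∈ ⨆ k, L.deg k := by rw [L.isInternal.submodule_iSup_eq_top]; trivial
      induction hl using Submodule.iSup_induction' with
      | mem k l hl =>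
        refine Submodule.subset_span (Set.mem_iUnion.2 ⟨k + d, d, ω, l, hω, ?_, rfl⟩)
        rwa [add_sub_cancel_right]
      | zero => rw [TensorProduct.tmul_zero]; exact zero_mem _
      | add y z _ _ hy hz => rw [TensorProduct.tmul_add]; exact add_mem hy hz

theorem extendMulti_mem_filt {k : ℕ} {q : MultilinearMap K (fun _ : Fin k => L.carrier) L.carrier}
    {p : Fin k → ℕ} {r : ℕ} (hq : ∀ y, (∀ j, y j ∈ L.filt (p j)) → q y ∈ L.filt r)
    {x : Fin k → Form K n ⊗[K] L} (hx : ∀ j, x j ∈ tensorFilt L n (p j)) :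
    extendMulti (Form K n) q x ∈ tensorFilt L n r := by
  refine multilinear_mem_of_span (extendMulti (Form K n) q)
    (fun j => Set.image2 (fun (ω : Form K n) (l : L.carrier) => ω ⊗ₜ[K] l) Set.univ
      (L.filt (p j) : Set L.carrier)) _ ?_ ?_
  · intro y hy
    choose ω _ l hl e using hy
    dsimp only at e
    obtain rfl : (fun j => (ω j ⊗ₜ[K] l j : Form K n ⊗[K] L)) = y := funext e
    rw [extendMulti_tmul]
    exact Submodule.apply_mem_map₂ _ trivial (hq l hl)
  · intro j
    have := hx j
    rw [tensorFilt, Submodule.map₂_eq_span_image2] at this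
    exact this

theorem extendMulti_q_mem_filt {k : ℕ} {p : Fin k → ℕ} (hp : ∀ j, 1 ≤ p j)
    {x : Fin k → Form K n ⊗[K] L} (hx : ∀ j, x j ∈ tensorFilt L n (p j)) :
    extendMulti (Form K n) (L.q k) x ∈ tensorFilt L n (∑ j, p j) :=
  extendMulti_mem_filt (fun y hy => L.q_filt k p y hp hy) hx

theorem prod_mem_formDeg {k : ℕ} {ω : Fin k → Form K n} {d : Fin k → ℕ}
    (h : ∀ a, ω a ∈ formDeg K n (d a)) :
    (List.ofFn ω).reverse.prod ∈ formDeg K n (∑ a, d a) := by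
  rw [revProd_univ]
  exact revProd_mem h _

theorem extendMulti_mem_deg {k : ℕ} {e : Fin k → ℤ} {x : Fin k → Form K n ⊗[K] L}
    (hx : ∀ j, x j ∈ tensorDeg L n (e j + 1)) :
    extendMulti (Form K n) (L.q k) x ∈ tensorDeg L n ((∑ j, e j) + 2) := by
  refine multilinear_mem_of_span (extendMulti (Form K n) (L.q k))
    (fun j => pureDeg L n (e j + 1)) _ ?_ hx
  intro y hy
  choose d ω l hω hl e' using hy
  obtain rfl : (fun j => (ω j ⊗ₜ[K] l j : Form K n ⊗[K] L)) = y := funext fun j => (e' j).symm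
  rw [extendMulti_tmul]
  refine Submodule.subset_span ⟨∑ j, d j, _, _, prod_mem_formDeg hω, ?_, rfl⟩
  have := L.q_deg k (fun j => e j - d j) l fun a => by
    have := hl a
    rwa [show e a + 1 - d a = e a - d a + 1 by ring] at this
  rw [Finset.sum_sub_distrib] at this
  push_cast
  rwa [show (∑ j, e j) + 2 - ∑ j, (d j : ℤ) = ∑ j, e j - ∑ j, (d j : ℤ) + 2 by ring]

variable (L n) in
/-- The operation `z ↦ q_{k+1}(z, φ, …, φ)` on elements `z` of degree two, for `φ` of degree one. -/
noncomputable def opLin (k : ℕ) (φ : Form K n ⊗[K] L) : Form K n ⊗[K] L →ₗ[K] Form K n ⊗[K] L where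
  toFun z := extendMulti (Form K n) (L.q (k + 1)) (Fin.cons (tensorParity L n z) fun _ => φ)
  map_add' y z := by rw [map_add, MultilinearMap.cons_add]
  map_smul' c z := by rw [map_smul, MultilinearMap.cons_smul]; rfl

variable (L n) in
/-- The operation `q_k(φ, …, φ)` for `φ` of degree one. -/
noncomputable def opDiag (k : ℕ) (φ : Form K n ⊗[K] L) : Form K n ⊗[K] L :=
  extendMulti (Form K n) (L.q k) fun _ => tensorParity L n φ

theorem opLin_apply (k : ℕ) (φ z : Form K n ⊗[K] L) : opLin L n k φ z =
    extendMulti (Form K n) (L.q (k + 1)) (Fin.cons (tensorParity L n z) fun _ => φ) := rfl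

theorem formOp_zero (k : ℕ) (x : Fin k → Form K n ⊗[K] L) :
    formOp L n k (fun _ => 0) x =
      extendMulti (Form K n) (L.q k) fun j => tensorParity L n (x j) := by
  have : ¬ Even (1 : ℤ) := by decide
  simp only [formOp, Finset.sum_const_zero, add_zero, if_neg this]
  rfl

theorem tensorParity_opDiag (k : ℕ) (φ : Form K n ⊗[K] L) :
    tensorParity L n (opDiag L n k φ) = extendMulti (Form K n) (L.q k) fun _ => φ := by
  have h : tensorParity L n (opDiag L n k φ) = extendMulti (Form K n) (L.q k)
      fun _ => tensorParity L n (tensorParity L n φ) := map_extendMulti (formParity K n) _ _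
  rw [h]
  simp only [tensorParity_tensorParity]

theorem opLin_mem_filt {k p : ℕ} (hp : 1 ≤ p) {φ z : Form K n ⊗[K] L}
    (hz : z ∈ tensorFilt L n p) : opLin L n k φ z ∈ tensorFilt L n (p + k) := by
  have := extendMulti_q_mem_filt (L := L) (n := n) (k := k + 1) (p := Fin.cons p fun _ => 1)
    (x := Fin.cons (tensorParity L n z) fun _ => φ) (Fin.cases hp fun _ => le_rfl)
    (Fin.cases (rTensor_mem_filt _ hz) fun j => tensorFilt_of_le le_rfl _)
  rw [Fin.sum_univ_succ] at this
  rw [opLin_apply]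
  simpa using this

theorem opDiag_mem_filt (k : ℕ) (φ : Form K n ⊗[K] L) : opDiag L n k φ ∈ tensorFilt L n k := by
  have := extendMulti_q_mem_filt (L := L) (n := n) (k := k) (p := fun _ => 1)
    (x := fun _ => tensorParity L n φ) (fun _ => le_rfl) fun j => tensorFilt_of_le le_rfl _
  rw [opDiag]
  simpa using this

/-- Elements of `Ω*(Δₙ) ⊗ L` of degree `k` are sums of decomposable ones. -/
theorem exists_sum_pure {k : ℤ} {φ : Form K n ⊗[K] L} (hφ : φ ∈ tensorDeg L n k) :
    ∃ (m : ℕ) (d : Fin m → ℕ) (ω : Fin m → Form K n) (l : Fin m → L),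
      (∀ a, ω a ∈ formDeg K n (d a)) ∧ (∀ a, l a ∈ L.deg (k - d a)) ∧
      φ = ∑ a, ω a ⊗ₜ l a := by
  obtain ⟨m, f, g, rfl⟩ := (Submodule.mem_span_set' (s := pureDeg L n k)).1 hφ
  choose d ω l hω hl e using fun a => (g a).2
  refine ⟨m, d, fun a => f a • ω a, l, fun a => Submodule.smul_mem _ _ (hω a), hl, ?_⟩
  exact Finset.sum_congr rfl fun a _ => by rw [e, TensorProduct.smul_tmul']

/-- The square-zero relation for the extended operations. -/
theorem sum_extendMulti_square {φ : Form K n ⊗[K] L} (hφ : φ ∈ tensorDeg L n 1) (k : ℕ) :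
    ∑ S : Finset (Fin k) with S.Nonempty, extendMulti (Form K n) (L.q (Sᶜ.card + 1))
      (Fin.cons (extendMulti (Form K n) (L.q S.card) fun _ => φ) fun _ => φ) = 0 := by
  obtain ⟨m, d, ω, l, hω, hl, rfl⟩ := exists_sum_pure hφ
  -- expand everything into decomposable elements, indexed by `s : Fin k → Fin m`
  have h1 : ∀ S : Finset (Fin k), extendMulti (Form K n) (L.q (Sᶜ.card + 1))
      (Fin.cons (extendMulti (Form K n) (L.q S.card) fun _ => ∑ a, ω a ⊗ₜ[K] l a)
        fun _ => ∑ a, ω a ⊗ₜ[K] l a) = ∑ s : Fin k → Fin m,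
      ((List.ofFn (restrict Sᶜ (ω ∘ s))).reverse.prod *
        (List.ofFn (restrict S (ω ∘ s))).reverse.prod) ⊗ₜ[K] L.q (Sᶜ.card + 1)
          (Fin.cons (L.q S.card (restrict S (l ∘ s))) (restrict Sᶜ (l ∘ s))) := by
    intro S
    have e1 : (extendMulti (Form K n) (L.q S.card) fun _ => ∑ a, ω a ⊗ₜ[K] l a) =
        ∑ r : Fin S.card → Fin m,
          (List.ofFn (ω ∘ r)).reverse.prod ⊗ₜ[K] L.q S.card (l ∘ r) := by
      rw [MultilinearMap.map_sum]
      exact Finset.sum_congr rfl fun r _ => extendMulti_tmul _ _ _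
    have e2 : ∀ z : Form K n ⊗[K] L, extendMulti (Form K n) (L.q (Sᶜ.card + 1))
        (Fin.cons z fun _ => ∑ a, ω a ⊗ₜ[K] l a) = ∑ r : Fin Sᶜ.card → Fin m,
        extendMulti (Form K n) (L.q (Sᶜ.card + 1))
          (Fin.cons z fun j => ω (r j) ⊗ₜ[K] l (r j)) := fun z =>
      ((extendMulti (Form K n) (L.q (Sᶜ.card + 1))).curryLeft z).map_sum _
    have e3 : ∀ (a : Form K n) (v : L) (r : Fin Sᶜ.card → Fin m),
        extendMulti (Form K n) (L.q (Sᶜ.card + 1))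
          (Fin.cons (a ⊗ₜ v) fun j => ω (r j) ⊗ₜ[K] l (r j)) =
        ((List.ofFn (ω ∘ r)).reverse.prod * a) ⊗ₜ L.q (Sᶜ.card + 1) (Fin.cons v (l ∘ r)) := by
      intro a v r
      rw [extendMulti_cons_tmul]
      have := extendMulti_tmul (A := Form K n) (ω ∘ r) (l ∘ r) ((L.q (Sᶜ.card + 1)).curryLeft v)
      exact congrArg _ this
    have e4 : ∀ r : Fin Sᶜ.card → Fin m, extendMulti (Form K n) (L.q (Sᶜ.card + 1))
        (Fin.cons (∑ r : Fin S.card → Fin m,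
          (List.ofFn (ω ∘ r)).reverse.prod ⊗ₜ[K] L.q S.card (l ∘ r))
          fun j => ω (r j) ⊗ₜ[K] l (r j)) = ∑ r' : Fin S.card → Fin m,
        ((List.ofFn (ω ∘ r)).reverse.prod * (List.ofFn (ω ∘ r')).reverse.prod) ⊗ₜ
          L.q (Sᶜ.card + 1) (Fin.cons (L.q S.card (l ∘ r')) (l ∘ r)) := by
      intro r
      have := congrArg (fun M => M fun j => ω (r j) ⊗ₜ[K] l (r j))
        (map_sum (extendMulti (Form K n) (L.q (Sᶜ.card + 1))).curryLeft
          (fun r : Fin S.card → Fin m =>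
            (List.ofFn (ω ∘ r)).reverse.prod ⊗ₜ[K] L.q S.card (l ∘ r)) Finset.univ)
      rw [sum_apply] at this
      exact this.trans (Finset.sum_congr rfl fun r' _ => e3 _ _ _)
    rw [e1, e2, Finset.sum_congr rfl fun r _ => e4 r, Finset.sum_comm, ← Fintype.sum_prod_type']
    symm
    refine Fintype.sum_equiv (((finSumEquivOfFinset rfl rfl).symm.arrowCongr
      (Equiv.refl (Fin m))).trans (Equiv.sumArrowEquivProdArrow _ _ _)) _ _ fun s => rfl
  rw [Finset.sum_congr rfl fun S _ => h1 S, Finset.sum_comm]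
  refine Finset.sum_eq_zero fun s _ => ?_
  have hsq := L.q_square k (fun a => -(d (s a) : ℤ)) (l ∘ s) fun a => by
    have := hl (s a)
    rwa [show (1 : ℤ) - d (s a) = -(d (s a) : ℤ) + 1 by ring] at this
  have h2 := congrArg (fun y => (List.ofFn (ω ∘ s)).reverse.prod ⊗ₜ[K] y) hsq
  simp only [TensorProduct.tmul_sum, TensorProduct.tmul_zero] at h2
  rw [← h2]
  refine Finset.sum_congr rfl fun S _ => ?_
  rw [prod_unshuffle (ω := ω ∘ s) (d := d ∘ s) fun a => hω (s a)]
  simp only [Units.smul_def, TensorProduct.tmul_smul]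
  rw [← TensorProduct.smul_tmul']
  rfl

theorem sum_opLin_opDiag {φ : Form K n ⊗[K] L} (hφ : φ ∈ tensorDeg L n 1) (k : ℕ) :
    ∑ j ∈ Finset.Icc 1 k, (k.choose j : K) • opLin L n (k - j) φ (opDiag L n j φ) = 0 := by
  have h := sum_extendMulti_square hφ k
  have h1 : ∀ S : Finset (Fin k), extendMulti (Form K n) (L.q (Sᶜ.card + 1))
      (Fin.cons (extendMulti (Form K n) (L.q S.card) fun _ => φ) fun _ => φ) =
      opLin L n (k - S.card) φ (opDiag L n S.card φ) := by
    intro S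
    rw [opLin_apply, tensorParity_opDiag]
    have : Sᶜ.card = k - S.card := by rw [Finset.card_compl, Fintype.card_fin]
    rw [this]
  rw [Finset.sum_congr rfl fun S _ => h1 S, Finset.sum_filter] at h
  have h2 : ∀ S : Finset (Fin k), (if S.Nonempty then
      opLin L n (k - S.card) φ (opDiag L n S.card φ) else 0) =
      (fun j => if j = 0 then 0 else opLin L n (k - j) φ (opDiag L n j φ)) S.card := by
    intro S
    by_cases hS : S.Nonempty
    · simp [hS, hS.card_pos.ne']
    · simp [Finset.not_nonempty_iff_eq_empty.1 hS]
  have h3 := Finset.sum_powerset_apply_card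
    (f := fun j => if j = 0 then 0 else opLin L n (k - j) φ (opDiag L n j φ))
    (x := (Finset.univ : Finset (Fin k)))
  rw [Finset.powerset_univ, ← Finset.sum_congr rfl fun S _ => h2 S, h, Finset.card_univ,
    Fintype.card_fin] at h3
  rw [h3]
  refine Finset.sum_subset_zero_on_sdiff (fun j hj => ?_) (fun j hj => ?_) fun j hj => ?_
  · exact Finset.mem_range_succ_iff.2 (Finset.mem_Icc.1 hj).2
  · have : j = 0 := by
      have := Finset.mem_sdiff.1 hj
      simp only [Finset.mem_range, Finset.mem_Icc, not_and] at this
      omega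
    simp [this]
  · rw [if_neg (by have := Finset.mem_Icc.1 hj; omega), Nat.cast_smul_eq_nsmul]

end FormCoefficients

/-! ### The de Rham differential as a derivation of the extended operations -/

section Derivation

variable {K : Type v} [Field K]

/-- Multilinear maps which agree on generators agree. -/
theorem multilinear_eq_of_span {E F : Type*} [AddCommMonoid E] [Module K E] [AddCommMonoid F]
    [Module K F] {k : ℕ} (M M' : MultilinearMap K (fun _ : Fin k => E) F) (S : Fin k → Set E)
    (h : ∀ y, (∀ j, y j ∈ S j) → M y = M' y) {x : Fin k → E}
    (hx : ∀ j, x j ∈ Submodule.span K (S j)) : M x = M' x := by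
  induction k with
  | zero => exact h x fun j => j.elim0
  | succ k ih =>
    rw [← Fin.cons_self_tail x]
    have h0 := hx 0
    generalize x 0 = x0 at h0
    induction h0 using Submodule.span_induction with
    | mem y hy =>
      exact ih (M.curryLeft y) (M'.curryLeft y) (fun j => S j.succ)
        (fun z hz => h _ (Fin.cases hy hz)) (fun j => hx j.succ)
    | zero => rw [M.map_coord_zero 0 (Fin.cons_zero _ _), M'.map_coord_zero 0 (Fin.cons_zero _ _)]
    | add y z _ _ hy hz => rw [M.cons_add, M'.cons_add, hy, hz]
    | smul c y _ hy => rw [M.cons_smul, M'.cons_smul, hy]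

variable {n : ℕ}

theorem prod_swap {k : ℕ} {ω : Fin k → Form K n} {d : Fin k → ℕ}
    (h : ∀ i, ω i ∈ formDeg K n (d i)) {a b : Fin k} (hab : (b : ℕ) = a + 1) :
    (List.ofFn (ω ∘ Equiv.swap a b)).reverse.prod =
      (-1 : K) ^ (d a * d b) • (List.ofFn ω).reverse.prod := by
  induction k with
  | zero => exact a.elim0
  | succ k ih =>
    obtain ⟨b, rfl⟩ := Fin.exists_succ_eq_of_ne_zero (x := b) (by rintro rfl; simp at hab)
    induction a using Fin.cases with
    | zero =>
      obtain ⟨k, rfl⟩ : ∃ l, k = l + 1 := ⟨k - 1, by have := b.2; omega⟩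
      obtain rfl : b = 0 := by ext; simpa using hab
      have h2 : ∀ i : Fin k, Equiv.swap (0 : Fin (k + 2)) (Fin.succ 0) i.succ.succ = i.succ.succ :=
        fun i => Equiv.swap_apply_of_ne_of_ne (Fin.succ_ne_zero _)
          fun h => Fin.succ_ne_zero _ (Fin.succ_injective _ h)
      simp only [List.ofFn_succ, Function.comp_apply, Equiv.swap_apply_left, Equiv.swap_apply_right,
        h2, List.reverse_cons, List.prod_append, List.prod_singleton]
      rw [mul_assoc, mul_assoc, form_mul_comm (h 0) (h (Fin.succ 0)), mul_smul_comm, mul_comm (d _)]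
    | succ a =>
      have h2 : ∀ i : Fin k, Equiv.swap a.succ b.succ i.succ = (Equiv.swap a b i).succ :=
        fun i => by
        rw [Equiv.swap_apply_def, Equiv.swap_apply_def]; split_ifs <;> simp_all
      have h3 : Equiv.swap a.succ b.succ 0 = 0 :=
        Equiv.swap_apply_of_ne_of_ne (Fin.succ_ne_zero a).symm (Fin.succ_ne_zero b).symm
      have := ih (ω := fun i => ω i.succ) (fun i => h i.succ) (a := a) (b := b) (by simpa using hab)
      simp only [List.ofFn_succ, Function.comp_apply, h2, h3, List.reverse_cons, List.prod_append,
        List.prod_singleton] at this ⊢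
      simp only [Function.comp_def] at this
      rw [this, smul_mul_assoc]

variable {L : CompleteLInfty.{u} K}

/-- Graded symmetry of the extended operations, for an element `z` of degree two and an element
`y` of degree one in adjacent positions. -/
theorem extendMulti_swap {k : ℕ} {a b : Fin k} (hab : (b : ℕ) = a + 1)
    {x : Fin k → Form K n ⊗[K] L} (ha : x a ∈ tensorDeg L n 2) (hb : x b ∈ tensorDeg L n 1) :
    extendMulti (Form K n) (L.q k)
      (fun i => if i = a then tensorParity L n (x b) else x (Equiv.swap a b i)) =
    extendMulti (Form K n) (L.q k) x := by
  have hne : b ≠ a := fun h => by rw [h] at hab; omega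
  have key := multilinear_eq_of_span
    (((extendMulti (Form K n) (L.q k)).compLinearMap
      fun i => if i = a then tensorParity L n else LinearMap.id).domDomCongr (Equiv.swap a b))
    (extendMulti (Form K n) (L.q k))
    (fun i => if i = a then pureDeg L n 2 else if i = b then pureDeg L n 1 else
      ⋃ j, pureDeg L n j) (x := x) ?_ ?_
  · rw [← key, MultilinearMap.domDomCongr_apply, MultilinearMap.compLinearMap_apply]
    congr 1
    ext1 i
    split_ifs with h
    · rw [h, Equiv.swap_apply_left]
    · rfl
  · intro y hy
    have hy' : ∀ i, ∃ (j : ℤ) (d : ℕ) (ω : Form K n) (l : L), ω ∈ formDeg K n d ∧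
        l ∈ L.deg (j - d) ∧ y i = ω ⊗ₜ l ∧ (i = a → j = 2) ∧ (i = b → j = 1) := by
      intro i
      have h := hy i
      split_ifs at h with h1 h2
      · obtain ⟨d, ω, l, h3, h4, h5⟩ := h
        exact ⟨2, d, ω, l, h3, h4, h5, fun _ => rfl, fun h => absurd (h.symm.trans h1) hne⟩
      · obtain ⟨d, ω, l, h3, h4, h5⟩ := h
        exact ⟨1, d, ω, l, h3, h4, h5, fun h => absurd h h1, fun _ => rfl⟩
      · obtain ⟨j, d, ω, l, h3, h4, h5⟩ := Set.mem_iUnion.1 h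
        exact ⟨j, d, ω, l, h3, h4, h5, fun h => absurd h h1, fun h => absurd h h2⟩
    choose j d ω l hω hl e hja hjb using hy'
    obtain rfl : (fun i => (ω i ⊗ₜ[K] l i : Form K n ⊗[K] L)) = y := funext fun i => (e i).symm
    rw [MultilinearMap.domDomCongr_apply, MultilinearMap.compLinearMap_apply]
    have h1 : ∀ i, (if i = a then tensorParity L n else LinearMap.id)
        (ω (Equiv.swap a b i) ⊗ₜ[K] l (Equiv.swap a b i)) =
        (if i = a then (-1 : K) ^ d b else 1) •
          ((ω ∘ Equiv.swap a b) i ⊗ₜ[K] (l ∘ Equiv.swap a b) i) := by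
      intro i
      split_ifs with h
      · rw [tensorParity_tmul (hω _), h, Equiv.swap_apply_left]
        simp only [Function.comp_apply, Equiv.swap_apply_left]
      · rw [one_smul]; rfl
    simp only [h1]
    have hq := L.q_symm k (fun i => j i - d i - 1) l
      (fun i => by rw [sub_add_cancel]; exact hl i) a b hab
    rw [MultilinearMap.map_smul_univ, extendMulti_tmul, extendMulti_tmul, prod_swap hω hab, hq,
      hja a rfl, hjb b rfl, Finset.prod_ite_eq' Finset.univ a, if_pos (Finset.mem_univ a)]
    have h2 : ((2 - d a - 1) * (1 - d b - 1) : ℤ).negOnePow =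
        ((d b + d a * d b : ℕ) : ℤ).negOnePow := by
      rw [Int.negOnePow_eq_iff]
      exact ⟨-d b, by push_cast; ring⟩
    rw [h2, negOnePow_smul (K := K), TensorProduct.tmul_smul, ← TensorProduct.smul_tmul', smul_smul,
      smul_smul, ← pow_add, ← pow_add, Even.neg_one_pow ⟨d b + d a * d b, by ring⟩, one_smul]
  · intro i
    split_ifs with h1 h2
    · rw [h1]; exact ha
    · rw [h2]; exact hb
    · rw [iUnion_pureDeg_span]; trivial

/-- The de Rham differential is a derivation of extended operations. -/
theorem tensorD_extendMulti {k : ℕ} (q : MultilinearMap K (fun _ : Fin k => L.carrier) L.carrier)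
    (x : Fin k → Form K n ⊗[K] L) : tensorD L n (extendMulti (Form K n) q x) =
      ∑ j, extendMulti (Form K n) q fun i =>
        if i < j then x i else if i = j then tensorD L n (x i) else tensorParity L n (x i) := by
  induction k with
  | zero =>
    have : x = fun j => (j.elim0 : Form K n) ⊗ₜ (j.elim0 : L) := funext fun j => j.elim0
    rw [this, extendMulti_tmul]
    change formD K n _ ⊗ₜ[K] _ = _
    have h0 : formD K n (List.ofFn fun j : Fin 0 => (j.elim0 : Form K n)).reverse.prod = 0 := by
      rw [List.ofFn_zero]
      have h1 := formD_mul (K := K) (n := n) 1 1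
      simp only [mul_one, one_mul, map_one (formParity K n)] at h1
      exact left_eq_add.1 h1
    rw [h0, TensorProduct.zero_tmul]
    simp
  | succ k ih =>
    have h1 : ∀ j : Fin (k + 1), (fun i : Fin (k + 1) => if i < j then x i else
        if i = j then tensorD L n (x i) else tensorParity L n (x i)) =
        Fin.cons (if j = 0 then tensorD L n (x 0) else x 0) fun i =>
            if i.succ < j then x i.succ else
          if i.succ = j then tensorD L n (x i.succ) else tensorParity L n (x i.succ) := by
      intro j
      ext1 i
      refine Fin.cases ?_ (fun i => ?_) i
      · by_cases hj : j = 0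
        · simp [hj]
        · simp [hj, Fin.pos_iff_ne_zero.2 hj]
      · simp
    simp only [h1]
    conv_lhs => rw [← Fin.cons_self_tail x]
    rw [Fin.sum_univ_succ]
    simp only [if_pos, Fin.succ_ne_zero, if_false, Fin.not_lt_zero, Fin.succ_lt_succ_iff,
      Fin.succ_inj]
    change _ = extendMulti (Form K n) q (Fin.cons (tensorD L n (x 0))
      fun i => tensorParity L n (Fin.tail x i)) + ∑ j : Fin k, extendMulti (Form K n) q
        (Fin.cons (x 0) fun i => if i < j then Fin.tail x i else
          if i = j then tensorD L n (Fin.tail x i) else tensorParity L n (Fin.tail x i))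
    generalize x 0 = x0
    generalize Fin.tail x = x
    induction x0 with
    | zero =>
      simp only [map_zero]
      simp only [MultilinearMap.map_coord_zero _ 0 (Fin.cons_zero _ _), map_zero,
        Finset.sum_const_zero, add_zero]
    | add y z hy hz =>
      simp only [map_add, MultilinearMap.cons_add, hy, hz, Finset.sum_add_distrib]
      abel
    | tmul a v =>
      have h2 : tensorD L n (a ⊗ₜ v) = formD K n a ⊗ₜ v := rfl
      have h3 := map_extendMulti (formParity K n) (q.curryLeft v) x
      have h4 : (extendMulti (Form K n) (q.curryLeft v) fun i => tensorParity L n (x i)) =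
        tensorParity L n (extendMulti (Form K n) (q.curryLeft v) x) := h3.symm
      simp only [h2, extendMulti_cons_tmul, h4, ← map_sum, ← ih]
      generalize extendMulti (Form K n) (q.curryLeft v) x = y
      induction y with
      | zero => simp
      | add y z hy hz => simp only [map_add, hy, hz]; abel
      | tmul b w =>
        change formD K n (b * a) ⊗ₜ w = (formParity K n b * formD K n a) ⊗ₜ w +
          (formD K n b * a) ⊗ₜ[K] w
        rw [formD_mul, TensorProduct.add_tmul, add_comm]

/-- By graded symmetry, `q_{k+1}(φ, …, φ, z, φ, …, φ)` does not depend on the position of `z`. -/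
theorem extendMulti_eq_opLin {φ z : Form K n ⊗[K] L} (hφ : φ ∈ tensorDeg L n 1)
    (hz : z ∈ tensorDeg L n 2) {k : ℕ} (j : Fin (k + 1)) :
    (extendMulti (Form K n) (L.q (k + 1)) fun i => if i < j then tensorParity L n φ else
      if i = j then tensorParity L n z else φ) = opLin L n k φ z := by
  induction j using Fin.induction with
  | zero =>
    rw [opLin_apply]
    congr 1
    ext1 i
    refine Fin.cases ?_ (fun i => ?_) i
    · simp
    · simp
  | succ j ih =>
    rw [← ih]
    have hs := extendMulti_swap (L := L) (n := n) (a := j.castSucc) (b := j.succ) (by simp)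
      (x := fun i => if i < j.castSucc then tensorParity L n φ else
        if i = j.castSucc then tensorParity L n z else φ)
      (by rw [if_neg (lt_irrefl _), if_pos rfl]; exact tensorParity_mem_deg hz) (by
        rw [if_neg (not_lt.2 j.castSucc_lt_succ.le), if_neg j.castSucc_lt_succ.ne']
        exact hφ)
    rw [← hs]
    congr 1
    ext1 i
    rcases lt_trichotomy (i : ℕ) (j : ℕ) with h | h | h
    · have h1 : i ≠ j.castSucc := fun h' => by rw [h'] at h; simp at h
      have h2 : i ≠ j.succ := fun h' => by rw [h'] at h; simp at h
      rw [Equiv.swap_apply_of_ne_of_ne h1 h2, if_neg h1, if_pos, if_pos]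
      · exact h
      · exact Fin.lt_def.2 (by simp; omega)
    · obtain rfl : i = j.castSucc := Fin.ext h
      rw [if_pos j.castSucc_lt_succ, if_pos rfl, if_neg (not_lt.2 j.castSucc_lt_succ.le),
        if_neg j.castSucc_lt_succ.ne']
    · have h1 : i ≠ j.castSucc := fun h' => by rw [h'] at h; simp at h
      rw [if_neg h1]
      by_cases h2 : i = j.succ
      · rw [h2, Equiv.swap_apply_right, if_neg (lt_irrefl _), if_pos rfl, if_neg (lt_irrefl _),
          if_pos rfl]
      · have h3 : (j : ℕ) + 1 < i := lt_of_le_of_ne h fun h' => h2 (Fin.ext h'.symm)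
        rw [Equiv.swap_apply_of_ne_of_ne h1 h2, if_neg h1, if_neg h2, if_neg, if_neg]
        · exact fun h' => by have := Fin.lt_def.1 h'; simp at this; omega
        · exact fun h' => by have := Fin.lt_def.1 h'; simp at this; omega

/-- The sign comes from moving the differential past `q`, which has degree one. -/
theorem tensorD_opDiag {φ : Form K n ⊗[K] L} (hφ : φ ∈ tensorDeg L n 1) (k : ℕ) :
    tensorD L n (opDiag L n (k + 1) φ) =
      (-(k + 1 : ℕ) : K) • opLin L n k φ (tensorD L n φ) := by
  have hd : tensorD L n φ ∈ tensorDeg L n 2 := one_add_one_eq_two (R := ℤ) ▸ tensorD_mem_deg hφ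
  rw [opDiag, tensorD_extendMulti]
  have h1 : ∀ j : Fin (k + 1), (fun i => if i < j then tensorParity L n φ else
      if i = j then tensorD L n (tensorParity L n φ)
      else tensorParity L n (tensorParity L n φ)) =
      fun i => (if i = j then (-1 : K) else 1) • (if i < j then tensorParity L n φ else
        if i = j then tensorParity L n (tensorD L n φ) else φ) := by
    intro j
    ext1 i
    rcases lt_trichotomy i j with h | h | h
    · rw [if_pos h, if_neg h.ne, if_pos h, one_smul]
    · rw [h, if_neg (lt_irrefl _), if_pos rfl, if_pos rfl, if_neg (lt_irrefl _), if_pos rfl,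
        tensorD_tensorParity]
    · rw [if_neg h.not_gt, if_neg h.ne', if_neg h.ne', if_neg h.not_gt, if_neg h.ne', one_smul,
        tensorParity_tensorParity]
  have h2 : ∀ j : Fin (k + 1), (extendMulti (Form K n) (L.q (k + 1)) fun i =>
      if i < j then tensorParity L n φ else if i = j then tensorD L n (tensorParity L n φ)
        else tensorParity L n (tensorParity L n φ)) =
      (-1 : K) • opLin L n k φ (tensorD L n φ) := by
    intro j
    rw [h1 j]
    refine (MultilinearMap.map_smul_univ _ _ _).trans ?_
    rw [Finset.prod_ite_eq' Finset.univ j,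
      if_pos (Finset.mem_univ j), extendMulti_eq_opLin hφ hd]
  refine (Finset.sum_congr rfl fun j _ => h2 j).trans ?_
  rw [Finset.sum_const, Finset.card_univ, Fintype.card_fin,
    ← Nat.cast_smul_eq_nsmul K, smul_smul, mul_neg_one]

end Derivation

/-! ### The Bianchi identity for forms with coefficients -/

section Bianchi

theorem add_neg_one_smul_self {R E : Type*} [Ring R] [AddCommMonoid E] [Module R E] (x : E) :
    x + (-1 : R) • x = 0 := by
  nth_rw 1 [← one_smul R x]
  rw [← add_smul, add_neg_cancel, zero_smul]

theorem mem_of_add_mem {R E : Type*} [Ring R] [AddCommMonoid E] [Module R E] {N : Submodule R E}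
    {x y : E} (h : x + y ∈ N) (hy : y ∈ N) : x ∈ N := by
  have := add_mem h (N.smul_mem (-1) hy)
  rwa [add_assoc, add_neg_one_smul_self, add_zero] at this

variable {K : Type v} [Field K] {L : CompleteLInfty.{u} K} {n : ℕ}

theorem opLin_zero (φ z : Form K n ⊗[K] L) : opLin L n 0 φ z = opLin L n 0 0 z := by
  rw [opLin_apply, opLin_apply]
  congr 1
  ext1 i
  obtain rfl : i = 0 := Subsingleton.elim (α := Fin 1) _ _
  rfl

theorem opLin_zero_tmul (φ : Form K n ⊗[K] L) {d : ℕ} {ω : Form K n} (h : ω ∈ formDeg K n d)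
    (l : L) : opLin L n 0 φ (ω ⊗ₜ l) = (-1 : K) ^ d • ω ⊗ₜ[K] L.q 1 fun _ => l := by
  have h1 : (Fin.cons (tensorParity L n (ω ⊗ₜ l)) fun _ => φ : Fin 1 → Form K n ⊗[K] L) =
      fun _ => ((-1 : K) ^ d • ω) ⊗ₜ l := by
    ext1 i
    obtain rfl : i = 0 := Subsingleton.elim (α := Fin 1) _ _
    rw [← TensorProduct.smul_tmul', ← tensorParity_tmul h]
    rfl
  rw [opLin_apply, h1, extendMulti_tmul]
  simp [TensorProduct.smul_tmul']

theorem opLin_self (φ : Form K n ⊗[K] L) : opLin L n 0 0 φ = opDiag L n 1 φ := by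
  rw [opLin_apply, opDiag]
  congr 1
  ext1 i
  obtain rfl : i = 0 := Subsingleton.elim (α := Fin 1) _ _
  rfl

variable (L n) in
/-- The total differential of `Ω*(Δₙ) ⊗ L`. -/
noncomputable def totalD : Form K n ⊗[K] L →ₗ[K] Form K n ⊗[K] L := tensorD L n + opLin L n 0 0

theorem totalD_apply (x : Form K n ⊗[K] L) : totalD L n x = tensorD L n x + opLin L n 0 0 x := rfl

/-- The two differentials anticommute by the derivation property, and `q₁` squares to zero. -/
theorem totalD_totalD {φ : Form K n ⊗[K] L} (hφ : φ ∈ tensorDeg L n 1) :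
    totalD L n (totalD L n φ) = 0 := by
  have h1 := tensorD_opDiag hφ 0
  have h2 := sum_opLin_opDiag hφ 1
  rw [Finset.Icc_self, Finset.sum_singleton, Nat.choose_self, Nat.cast_one, one_smul, Nat.sub_self,
    opLin_zero] at h2
  rw [opLin_zero, Nat.zero_add, Nat.cast_one] at h1
  rw [totalD_apply, totalD_apply, map_add, map_add, tensorD_tensorD, opLin_self, h1, h2, zero_add,
    add_zero, ← one_smul K (opLin L n 0 0 (tensorD L n φ)), smul_smul, ← add_smul]
  simp

theorem totalD_mem_filt {p : ℕ} {x : Form K n ⊗[K] L} (hx : x ∈ tensorFilt L n p) :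
    totalD L n x ∈ tensorFilt L n p := by
  rcases Nat.eq_zero_or_pos p with rfl | hp
  · exact tensorFilt_of_le (Nat.zero_le 1) _
  · exact add_mem (rTensor_mem_filt _ hx) (opLin_mem_filt (k := 0) hp hx)

/-- The part of the curvature of `φ` in which operations of arity at most `N` enter. -/
noncomputable def formCurv (N : ℕ) (φ : Form K n ⊗[K] L) : Form K n ⊗[K] L :=
  tensorD L n φ + ∑ k ∈ Finset.Icc 1 N, (k.factorial : K)⁻¹ • opDiag L n k φ

/-- The double sum `∑ q_{j+1}(q_k(φ, …, φ), φ, …, φ) / j! k!` is small, since its parts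
with `j + k` constant vanish. -/
theorem sum_sum_opLin_opDiag [CharZero K] {φ : Form K n ⊗[K] L} (hφ : φ ∈ tensorDeg L n 1) (N : ℕ) :
    ∑ j ∈ Finset.range N, ∑ k ∈ Finset.Icc 1 N, ((j.factorial : K)⁻¹ * (k.factorial : K)⁻¹) •
      opLin L n j φ (opDiag L n k φ) ∈ tensorFilt L n (N + 1) := by
  have h0 : ∀ m, ∑ k ∈ Finset.Icc 1 m, (((m - k).factorial : K)⁻¹ * (k.factorial : K)⁻¹) •
      opLin L n (m - k) φ (opDiag L n k φ) = 0 := by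
    intro m
    have h := congrArg ((m.factorial : K)⁻¹ • ·) (sum_opLin_opDiag hφ m)
    simp only [smul_zero, Finset.smul_sum, smul_smul] at h
    rw [← h]
    refine Finset.sum_congr rfl fun k hk => ?_
    congr 1
    rw [Nat.cast_choose K (Finset.mem_Icc.1 hk).2]
    have : (m.factorial : K) ≠ 0 := Nat.cast_ne_zero.2 m.factorial_ne_zero
    field_simp
  have h1 : ∀ k ∈ Finset.Icc 1 N, ∑ j ∈ Finset.range N,
      ((j.factorial : K)⁻¹ * (k.factorial : K)⁻¹) • opLin L n j φ (opDiag L n k φ) =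
      ∑ j ∈ Finset.range N \ Finset.range (N + 1 - k),
        ((j.factorial : K)⁻¹ * (k.factorial : K)⁻¹) • opLin L n j φ (opDiag L n k φ) +
      ∑ j ∈ Finset.range (N + 1 - k), ((j.factorial : K)⁻¹ * (k.factorial : K)⁻¹) •
        opLin L n j φ (opDiag L n k φ) := by
    intro k hk
    have hk' := Finset.mem_Icc.1 hk
    rw [Finset.sum_sdiff (Finset.range_subset_range.2 (show N + 1 - k ≤ N by omega))]
  have h2 : ∑ k ∈ Finset.Icc 1 N, ∑ j ∈ Finset.range (N + 1 - k),
      ((j.factorial : K)⁻¹ * (k.factorial : K)⁻¹) • opLin L n j φ (opDiag L n k φ) = 0 := by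
    rw [← Finset.sum_eq_zero (s := Finset.range (N + 1)) fun m _ => h0 m, Finset.sum_sigma',
      Finset.sum_sigma']
    refine Finset.sum_bij' (fun x _ => ⟨x.1 + x.2, x.1⟩) (fun x _ => ⟨x.2, x.1 - x.2⟩)
      ?_ ?_ ?_ ?_ ?_
    · rintro ⟨k, j⟩ h
      simp only [Finset.mem_sigma, Finset.mem_Icc, Finset.mem_range] at h ⊢
      omega
    · rintro ⟨m, k⟩ h
      simp only [Finset.mem_sigma, Finset.mem_Icc, Finset.mem_range] at h ⊢
      omega
    · rintro ⟨k, j⟩ h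
      simp
    · rintro ⟨m, k⟩ h
      simp only [Finset.mem_sigma, Finset.mem_Icc, Finset.mem_range] at h
      simp only [Sigma.mk.injEq, heq_eq_eq, and_true]
      omega
    · rintro ⟨k, j⟩ h
      simp
  rw [Finset.sum_comm, Finset.sum_congr rfl h1, Finset.sum_add_distrib, h2, add_zero]
  refine sum_mem fun k hk => sum_mem fun j hj => Submodule.smul_mem _ _ ?_
  have : N + 1 ≤ k + j := by
    have := Finset.mem_sdiff.1 hj
    simp only [Finset.mem_range] at this
    omega
  exact tensorFilt_antitone this (opLin_mem_filt (Finset.mem_Icc.1 hk).1 (opDiag_mem_filt k φ))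

/-- The Bianchi identity. -/
theorem bianchi [CharZero K] {φ : Form K n ⊗[K] L} (hφ : φ ∈ tensorDeg L n 1) (N : ℕ) :
    tensorD L n (formCurv N φ) + ∑ j ∈ Finset.range N, (j.factorial : K)⁻¹ •
      opLin L n j φ (formCurv N φ) ∈ tensorFilt L n (N + 1) := by
  have h1 : tensorD L n (formCurv N φ) + ∑ j ∈ Finset.range N, (j.factorial : K)⁻¹ •
      opLin L n j φ (tensorD L n φ) = 0 := by
    rw [formCurv, map_add, tensorD_tensorD, zero_add, map_sum,
      Finset.sum_bij' (s := Finset.Icc 1 N) (t := Finset.range N) (fun k _ => k - 1)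
        (fun j _ => j + 1) (g := fun j => tensorD L n
          (((j + 1).factorial : K)⁻¹ • opDiag L n (j + 1) φ)), ← Finset.sum_add_distrib]
    · refine Finset.sum_eq_zero fun j _ => ?_
      rw [map_smul, tensorD_opDiag hφ, smul_smul, ← add_smul]
      convert zero_smul K _
      rw [Nat.factorial_succ, Nat.cast_mul]
      have h1 : (j.factorial : K) ≠ 0 := Nat.cast_ne_zero.2 j.factorial_ne_zero
      have h2 : ((j + 1 : ℕ) : K) ≠ 0 := Nat.cast_ne_zero.2 j.succ_ne_zero
      field_simp
      ring
    all_goals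
      intro k hk
      simp only [Finset.mem_Icc, Finset.mem_range] at hk ⊢
      try omega
    rw [Nat.sub_add_cancel hk.1]
  have h2 : ∑ j ∈ Finset.range N, (j.factorial : K)⁻¹ • opLin L n j φ (formCurv N φ) =
      ∑ j ∈ Finset.range N, (j.factorial : K)⁻¹ • opLin L n j φ (tensorD L n φ) +
      ∑ j ∈ Finset.range N, ∑ k ∈ Finset.Icc 1 N, ((j.factorial : K)⁻¹ * (k.factorial : K)⁻¹) •
        opLin L n j φ (opDiag L n k φ) := by
    rw [← Finset.sum_add_distrib]
    refine Finset.sum_congr rfl fun j _ => ?_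
    rw [formCurv, map_add, smul_add, map_sum, Finset.smul_sum]
    simp only [map_smul, smul_smul]
  rw [h2, ← add_assoc, h1, zero_add]
  exact sum_sum_opLin_opDiag hφ N

/-- If the curvature is in `Fᵖ`, then its differential is in `F^{p+1}`. -/
theorem totalD_formCurv_mem [CharZero K] {φ : Form K n ⊗[K] L} (hφ : φ ∈ tensorDeg L n 1) {p N : ℕ}
    (hp : 1 ≤ p) (hpN : p ≤ N) (h : formCurv N φ ∈ tensorFilt L n p) :
    totalD L n (formCurv N φ) ∈ tensorFilt L n (p + 1) := by
  have h1 := tensorFilt_antitone (show p + 1 ≤ N + 1 by omega) (bianchi hφ N)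
  obtain ⟨N, rfl⟩ : ∃ M, N = M + 1 := ⟨N - 1, by omega⟩
  rw [Finset.sum_range_succ', Nat.factorial_zero, Nat.cast_one, inv_one, one_smul,
    opLin_zero, add_comm (∑ j ∈ _, _), ← add_assoc] at h1
  have h2 : ∑ j ∈ Finset.range N, ((j + 1).factorial : K)⁻¹ •
      opLin L n (j + 1) φ (formCurv (N + 1) φ) ∈ tensorFilt L n (p + 1) :=
    sum_mem fun j _ => Submodule.smul_mem _ _
      (tensorFilt_antitone (by omega) (opLin_mem_filt hp h))
  exact mem_of_add_mem h1 h2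

end Bianchi

/-! ### Dupont's contraction with coefficients -/

section Contraction

variable {K : Type v} [Field K] {n : ℕ}

variable (K) in
/-- The integral of a form over a face. -/
noncomputable def faceIntegral (I : Face n) : Form K n →ₗ[K] K :=
  formIntegral K I.dim ∘ₗ (formPull K I.vertex).toLinearMap

theorem faceIntegral_apply (I : Face n) (ω : Form K n) :
    faceIntegral K I ω = formIntegral K I.dim (formPull K I.vertex ω) := rfl

theorem faceIntegral_eq (I : Face n) {c : ℕ} (hc : I.1.card = c + 1) (ω : Form K n) :
    faceIntegral K I ω = formIntegral K c (formPull K (I.1.orderEmbOfFin hc) ω) := by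
  obtain rfl : I.dim = c := by have := I.card_eq; omega
  rfl

theorem faceIntegral_of_mem {I : Face n} {d : ℕ} (hd : d ≠ I.dim) {ω : Form K n}
    (h : ω ∈ formDeg K n d) : faceIntegral K I ω = 0 :=
  formIntegral_of_mem hd (formPull_mem _ h)

theorem orderEmbOfFin_succAbove {N c : ℕ} {s : Finset (Fin N)} (hs : s.card = c + 1)
    (j : Fin (c + 1)) (hs' : (s.erase (s.orderEmbOfFin hs j)).card = c) :
    s.orderEmbOfFin hs ∘ j.succAbove = (s.erase (s.orderEmbOfFin hs j)).orderEmbOfFin hs' := by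
  refine Finset.orderEmbOfFin_unique _ (fun a => ?_) ?_
  · refine Finset.mem_erase.2 ⟨fun h => ?_, s.orderEmbOfFin_mem hs _⟩
    exact Fin.succAbove_ne j a ((s.orderEmbOfFin hs).injective h)
  · exact (s.orderEmbOfFin hs).strictMono.comp (Fin.strictMono_succAbove j)

/-- Stokes' formula on the faces. -/
theorem faceIntegral_formD [CharZero K] (I : Face n) (ω : Form K n) :
    faceIntegral K I (formD K n ω) = ∑ j : Fin (I.dim + 1),
      if h : (I.1.erase (I.vertex j)).Nonempty then (-1 : K) ^ (j : ℕ) * faceIntegral K ⟨_, h⟩ ω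
      else 0 := by
  suffices hs : ∀ (c : ℕ) (hc : I.1.card = c + 1),
      formIntegral K c (formPull K (I.1.orderEmbOfFin hc) (formD K n ω)) = ∑ j : Fin (c + 1),
        if h : (I.1.erase (I.1.orderEmbOfFin hc j)).Nonempty then
          (-1 : K) ^ (j : ℕ) * faceIntegral K ⟨_, h⟩ ω else 0 from hs I.dim I.card_eq
  intro c hc
  have hcard : ∀ j, (I.1.erase (I.1.orderEmbOfFin hc j)).card = c := fun j => by
    rw [Finset.card_erase_of_mem (I.1.orderEmbOfFin_mem hc j), hc, Nat.add_sub_cancel]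
  rw [formPull_formD]
  cases c with
  | zero =>
    rw [Finset.sum_eq_zero fun j _ => dif_neg (by
      rw [Finset.not_nonempty_iff_eq_empty, ← Finset.card_eq_zero]
      exact hcard j)]
    induction ω using form_homogeneous_induction with
    | hom d ω h => exact formIntegral_of_mem d.succ_ne_zero (formD_mem (formPull_mem _ h))
    | add x y hx hy => rw [map_add, map_add, map_add, hx, hy, add_zero]
  | succ c =>
    rw [stokes]
    refine Finset.sum_congr rfl fun j _ => ?_
    have hne : (I.1.erase (I.1.orderEmbOfFin hc j)).Nonempty := by
      rw [← Finset.card_pos, hcard]; exact c.succ_pos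
    rw [dif_pos hne, faceIntegral_eq _ (hcard j), ← orderEmbOfFin_succAbove, ← formPull_comp]
    rfl

/-- The face consisting of all vertices. -/
def topFace (n : ℕ) : Face n := ⟨Finset.univ, Finset.univ_nonempty⟩

theorem dim_topFace : (topFace n).dim = n := by simp [topFace, Face.dim]

theorem Face.dim_lt {I : Face n} (h : I ≠ topFace n) : I.dim < n := by
  have h1 : I.1.card < n + 1 := by
    have := Finset.card_lt_card (Finset.ssubset_univ_iff.2 fun h' => h (Subtype.ext h'))
    rwa [Finset.card_univ, Fintype.card_fin] at this
  have := I.card_eq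
  omega

theorem formIntegral_whitney_topFace [CharZero K] :
    formIntegral K n (whitney K (topFace n).vertex) = 1 := by
  induction n with
  | zero =>
    have h := sum_whitney_vertices (K := K) (n := 0)
    have h0 : ∀ I : Face 0, I = topFace 0 := fun I => by
      by_contra h
      exact absurd (I.dim_lt h) (Nat.not_lt_zero _)
    rw [Finset.sum_eq_single (topFace 0) (fun I _ h => absurd (h0 I) h) (by simp),
      if_pos dim_topFace] at h
    rw [h]
    have h1 : polyIntegral K 0 1 = 1 := by
      have := polyIntegral_monomial (K := K) (n := 0) 0
      simpa using this
    have h2 : topCoeff K 0 1 = 1 := by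
      have := topCoeff_ιMulti (K := K) (n := 0) Fin.elim0
      simpa using this
    change formIntegral K 0 ((1 : MvPolynomial (Fin 0) K) ⊗ₜ 1) = 1
    simp [formIntegral, h1, h2]
  | succ n ih =>
    have hne : (Finset.univ.erase (0 : Fin (n + 2))).Nonempty := ⟨1, by simp⟩
    let J : Face (n + 1) := ⟨Finset.univ.erase 0, hne⟩
    have hJ : J.1ᶜ = {0} := by ext i; simp [J]
    have h1 : whitney K (topFace (n + 1)).vertex = formD K (n + 1) (whitney K J.vertex) := by
      have h2 : J.insert 0 = topFace (n + 1) := Subtype.ext (by simp [Face.insert, topFace, J])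
      have h3 : J.below 0 = 0 := by simp [Face.below]
      rw [formD_whitney, hJ, Finset.sum_singleton, h2, h3, pow_zero, one_smul]
    have h2 : ∀ j : Fin (n + 2), j ≠ 0 →
        formIntegral K n (formPull K (Fin.succAbove j) (whitney K J.vertex)) = 0 := by
      intro j hj
      rw [formPull_whitney_face _ (Fin.strictMono_succAbove j).monotone, Finset.sum_eq_zero,
        map_zero]
      intro I hI
      have hI := (Finset.mem_filter.1 hI).2.1
      have : j ∈ I.1.image (Fin.succAbove j) := by rw [hI]; simp [J, hj]
      obtain ⟨a, _, ha⟩ := Finset.mem_image.1 this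
      exact absurd ha (Fin.succAbove_ne j a)
    have h3 : formPull K (Fin.succAbove 0) (whitney K J.vertex) = whitney K (topFace n).vertex := by
      rw [formPull_whitney_face _ (Fin.strictMono_succAbove 0).monotone]
      refine Finset.sum_eq_single_of_mem (topFace n) ?_ fun I hI hI' => ?_
      · rw [Finset.mem_filter]
        refine ⟨Finset.mem_univ _, ?_, ?_⟩
        · ext i
          simp only [topFace, J, Finset.mem_image, Finset.mem_univ, true_and, Finset.mem_erase,
            and_true]
          exact Fin.exists_succAbove_eq_iff
        · simp [topFace, J]
      · have h4 := (Finset.mem_filter.1 hI).2.2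
        have h5 := I.dim_lt hI'
        have h6 := I.card_eq
        simp [J] at h4
        omega
    rw [h1, stokes, Finset.sum_eq_single 0 (fun j _ hj => by rw [h2 j hj, mul_zero]) (by simp), h3,
      ih]
    simp

theorem faceIntegral_whitney [CharZero K] (I J : Face n) :
    faceIntegral K J (whitney K I.vertex) = if I = J then 1 else 0 := by
  rw [faceIntegral_apply, formPull_whitney_face _ J.vertex_strictMono.monotone, map_sum]
  have h1 : ∀ I' : Face J.dim, I' ≠ topFace J.dim →
      formIntegral K J.dim (whitney K I'.vertex) = 0 := fun I' h =>
    formIntegral_of_mem (I'.dim_lt h).ne (whitney_mem I')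
  have h2 : (topFace J.dim).1.image J.vertex = J.1 := J.image_vertex
  split_ifs with h
  · subst h
    rw [Finset.sum_eq_single_of_mem (topFace I.dim) _ fun I' _ h => h1 I' h,
      formIntegral_whitney_topFace]
    rw [Finset.mem_filter]
    exact ⟨Finset.mem_univ _, h2, by simp [topFace, I.card_eq]⟩
  · refine Finset.sum_eq_zero fun I' hI' => h1 I' ?_
    rintro rfl
    exact h (Subtype.ext ((Finset.mem_filter.1 hI').2.1.symm.trans h2))

theorem coneList_mem (v : List (Fin (n + 1))) {d : ℕ} {ω : Form K n} (h : ω ∈ formDeg K n d) :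
    coneList K v ω ∈ formDeg K n (d - v.length) ∧ (d < v.length → coneList K v ω = 0) := by
  induction v generalizing d ω with
  | nil => exact ⟨h, fun h => absurd h (Nat.not_lt_zero _)⟩
  | cons i v ih =>
    have h1 := ih (coneHomotopy_mem i h)
    change coneList K v (coneHomotopy K i ω) ∈ _ ∧ (_ → coneList K v (coneHomotopy K i ω) = 0)
    rw [List.length_cons]
    refine ⟨by rw [show d - (v.length + 1) = d - 1 - v.length by omega]; exact h1.1, fun h2 => ?_⟩
    rcases Nat.eq_zero_or_pos d with rfl | hd
    · rw [coneHomotopy_zero_of_mem i h, map_zero]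
    · exact h1.2 (by omega)

theorem dupont_mem {d : ℕ} {ω : Form K n} (h : ω ∈ formDeg K n d) :
    dupont K n ω ∈ formDeg K n (d - 1) ∧ (d = 0 → dupont K n ω = 0) := by
  have h1 : ∀ I : Face n, whitney K I.vertex * iterHomotopy K I.vertex ω ∈ formDeg K n (d - 1) ∧
      (d = 0 → whitney K I.vertex * iterHomotopy K I.vertex ω = 0) := by
    intro I
    rw [← coneList_ofFn, I.ofFn_vertex]
    have h2 := coneList_mem I.list h
    rw [I.length_list] at h2
    refine ⟨?_, fun hd => by rw [h2.2 (by omega), mul_zero]⟩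
    by_cases h3 : d < I.dim + 1
    · rw [h2.2 h3, mul_zero]
      exact zero_mem _
    · rw [show d - 1 = I.dim + (d - (I.dim + 1)) by omega]
      exact mul_mem_formDeg (whitney_mem I) h2.1
  simp only [dupont, LinearMap.sum_apply, LinearMap.comp_apply, LinearMap.mulLeft_apply]
  exact ⟨sum_mem fun I _ => (h1 I).1, fun hd => Finset.sum_eq_zero fun I _ => (h1 I).2 hd⟩

variable (L : CompleteLInfty.{u} K)

theorem q_one_add (x y : L) : (L.q 1 fun _ => x + y) = (L.q 1 fun _ => x) + L.q 1 fun _ => y := by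
  have := (L.q 1).map_update_add (fun _ => 0) 0 x y
  simp only [Function.update_eq_const_of_subsingleton] at this
  exact this

theorem q_one_smul (c : K) (x : L) : (L.q 1 fun _ => c • x) = c • L.q 1 fun _ => x := by
  have := (L.q 1).map_update_smul (fun _ => 0) 0 c x
  simp only [Function.update_eq_const_of_subsingleton] at this
  exact this

variable (n) in
/-- The differential of cochains as a linear map. -/
def cochainDLin : (Face n → L) →ₗ[K] (Face n → L) where
  toFun := cochainD L
  map_add' α β := by
    ext1 I
    have h2 : ∀ j, (if h : (I.1.erase (I.vertex j)).Nonempty then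
        (-1 : ℤ) ^ (j : ℕ) • (α + β) ⟨_, h⟩ else 0) =
        (if h : (I.1.erase (I.vertex j)).Nonempty then (-1 : ℤ) ^ (j : ℕ) • α ⟨_, h⟩ else 0) +
        if h : (I.1.erase (I.vertex j)).Nonempty then (-1 : ℤ) ^ (j : ℕ) • β ⟨_, h⟩ else 0 := by
      intro j
      split_ifs <;> simp
    change (∑ j, _) + (-1 : ℤ) ^ I.dim • (L.q 1 fun _ => α I + β I) = _ + _
    rw [Finset.sum_congr rfl fun j _ => h2 j, Finset.sum_add_distrib, q_one_add, smul_add,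
      add_add_add_comm]
    rfl
  map_smul' c α := by
    ext1 I
    have h2 : ∀ j, (if h : (I.1.erase (I.vertex j)).Nonempty then
        (-1 : ℤ) ^ (j : ℕ) • (c • α) ⟨_, h⟩ else 0) =
        c • if h : (I.1.erase (I.vertex j)).Nonempty then (-1 : ℤ) ^ (j : ℕ) • α ⟨_, h⟩ else 0 := by
      intro j
      split_ifs
      · simp only [Pi.smul_apply, smul_comm c]
      · simp
    change (∑ j, _) + (-1 : ℤ) ^ I.dim • (L.q 1 fun _ => c • α I) = c • (_ + _)
    rw [Finset.sum_congr rfl fun j _ => h2 j, ← Finset.smul_sum, q_one_smul, smul_add,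
      smul_comm c ((-1 : ℤ) ^ I.dim)]

variable {L}

theorem cochainDLin_apply (α : Face n → L) : cochainDLin n L α = cochainD L α := rfl

theorem whitneyMap_apply (α : Face n → L) :
    whitneyMap L n α = ∑ I : Face n, whitney K I.vertex ⊗ₜ[K] α I := by
  simp [whitneyMap]

theorem integralMap_tmul (ω : Form K n) (l : L) (I : Face n) :
    integralMap L n (ω ⊗ₜ l) I = faceIntegral K I ω • l := by
  simp [integralMap, faceIntegral]

theorem integralMap_whitneyMap [CharZero K] (α : Face n → L) :
    integralMap L n (whitneyMap L n α) = α := by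
  ext1 J
  simp only [whitneyMap_apply, map_sum, Finset.sum_apply, integralMap_tmul, faceIntegral_whitney]
  simp

theorem totalD_tmul {d : ℕ} {ω : Form K n} (h : ω ∈ formDeg K n d) (l : L) :
    totalD L n (ω ⊗ₜ l) = formD K n ω ⊗ₜ l + (-1 : K) ^ d • ω ⊗ₜ[K] L.q 1 fun _ => l := by
  rw [totalD_apply, opLin_zero_tmul _ h]
  rfl

/-- The inclusion by Whitney forms is a morphism of complexes. -/
theorem totalD_whitneyMap (α : Face n → L) :
    totalD L n (whitneyMap L n α) = whitneyMap L n (cochainD L α) := by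
  have h1 : ∀ I : Face n, (whitney K I.vertex ⊗ₜ[K] cochainD L α I : Form K n ⊗[K] L) =
      (∑ j : Fin (I.dim + 1), if h : (I.1.erase (I.vertex j)).Nonempty then
        (-1 : ℤ) ^ (j : ℕ) • (whitney K I.vertex ⊗ₜ[K] α ⟨_, h⟩ : Form K n ⊗[K] L) else 0) +
      (-1 : K) ^ I.dim • whitney K I.vertex ⊗ₜ[K] L.q 1 fun _ => α I := by
    intro I
    have hc : ((-1 : ℤ) ^ I.dim • L.q 1 fun _ => α I) = (-1 : K) ^ I.dim • L.q 1 fun _ => α I := by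
      rw [← Int.cast_smul_eq_zsmul K]; simp
    rw [cochainD, TensorProduct.tmul_add, hc, TensorProduct.tmul_smul, TensorProduct.tmul_sum]
    congr 1
    refine Finset.sum_congr rfl fun j _ => ?_
    split_ifs
    · exact TensorProduct.tmul_smul _ _ _
    · rw [TensorProduct.tmul_zero]
  rw [whitneyMap_apply, whitneyMap_apply, map_sum, Finset.sum_congr rfl fun I _ => h1 I,
    Finset.sum_add_distrib, sum_facets fun I J => (whitney K I.vertex ⊗ₜ[K] α J : Form K n ⊗[K] L),
    ← Finset.sum_add_distrib]
  refine Finset.sum_congr rfl fun I _ => ?_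
  rw [totalD_tmul (whitney_mem I), formD_whitney, TensorProduct.sum_tmul]
  congr 1

/-- The projection by integration is a morphism of complexes, by Stokes' theorem. -/
theorem integralMap_totalD [CharZero K] (x : Form K n ⊗[K] L) :
    integralMap L n (totalD L n x) = cochainD L (integralMap L n x) := by
  rw [← cochainDLin_apply]
  induction x with
  | zero => simp only [map_zero]
  | add x y hx hy => simp only [map_add, hx, hy]
  | tmul ω l =>
    induction ω using form_homogeneous_induction with
    | add x y hx hy => simp only [TensorProduct.add_tmul, map_add, hx, hy]
    | hom d ω h =>
      ext1 I
      rw [totalD_tmul h, map_add, map_smul, cochainDLin_apply, cochainD, Pi.add_apply,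
        Pi.smul_apply, integralMap_tmul, integralMap_tmul, integralMap_tmul]
      rw [q_one_smul, faceIntegral_formD, Finset.sum_smul]
      congr 1
      · refine Finset.sum_congr rfl fun j _ => ?_
        split_ifs
        · rw [integralMap_tmul, ← Int.cast_smul_eq_zsmul K, smul_smul]; simp
        · rw [zero_smul]
      · by_cases hd : d = I.dim
        · rw [hd, ← Int.cast_smul_eq_zsmul K]; simp
        · rw [faceIntegral_of_mem hd h]; simp

variable (L n) in
/-- Dupont's homotopy on `Ω*(Δₙ) ⊗ L`. -/
noncomputable def dupontMap : Form K n ⊗[K] L →ₗ[K] Form K n ⊗[K] L := (dupont K n).rTensor L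

/-- Dupont's homotopy contracts `Ω*(Δₙ) ⊗ L` onto the cochains. -/
theorem dupontMap_totalD [CharZero K] (x : Form K n ⊗[K] L) :
    dupontMap n L (totalD L n x) + totalD L n (dupontMap n L x) + x =
      whitneyMap L n (integralMap L n x) := by
  induction x with
  | zero => simp only [map_zero, add_zero]
  | add x y hx hy => simp only [map_add, ← hx, ← hy]; abel
  | tmul ω l =>
    induction ω using form_homogeneous_induction with
    | add x y hx hy => simp only [TensorProduct.add_tmul, map_add, ← hx, ← hy]; abel
    | hom d ω h =>
      have h1 : ∀ (η : Form K n) (m : L), dupontMap n L (η ⊗ₜ m) = dupont K n η ⊗ₜ m :=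
        fun _ _ => rfl
      have h2 := dupont_mem h
      have h3 : whitneyMap L n (integralMap L n (ω ⊗ₜ l)) =
          (dupont K n (formD K n ω) + formD K n (dupont K n ω) + ω) ⊗ₜ l := by
        rw [eq_sub_iff_add_eq.1 (dupont_formD ω), whitneyMap_apply, TensorProduct.sum_tmul]
        refine Finset.sum_congr rfl fun I _ => ?_
        rw [integralMap_tmul, TensorProduct.tmul_smul, TensorProduct.smul_tmul']
        rfl
      rw [h3, totalD_tmul h, map_add, map_smul, h1, h1, h1, totalD_tmul h2.1,
        TensorProduct.add_tmul, TensorProduct.add_tmul]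
      have h4 : ((-1 : K) ^ d • dupont K n ω ⊗ₜ[K] L.q 1 fun _ => l) +
          ((-1 : K) ^ (d - 1) • dupont K n ω ⊗ₜ[K] L.q 1 fun _ => l) = 0 := by
        cases d with
        | zero => rw [h2.2 rfl, TensorProduct.zero_tmul, smul_zero, add_zero]
        | succ d =>
          rw [← add_smul, Nat.add_sub_cancel, pow_succ, mul_neg_one, neg_add_cancel, zero_smul]
      rw [add_add_add_comm, h4, add_zero]

theorem whitneyMap_mem_deg {k : ℤ} {α : Face n → L} (hα : α ∈ cochainDeg L n k) :
    whitneyMap L n α ∈ tensorDeg L n k := by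
  rw [whitneyMap_apply]
  exact sum_mem fun I _ => Submodule.subset_span
    ⟨I.dim, _, _, whitney_mem I, Submodule.mem_pi.1 hα I trivial, rfl⟩

theorem integralMap_mem_deg {k : ℤ} {x : Form K n ⊗[K] L} (hx : x ∈ tensorDeg L n k) :
    integralMap L n x ∈ cochainDeg L n k := by
  suffices h : tensorDeg L n k ≤ (cochainDeg L n k).comap (integralMap L n) from h hx
  rw [tensorDeg, Submodule.span_le]
  rintro _ ⟨d, ω, l, hω, hl, rfl⟩
  refine Submodule.mem_pi.2 fun I _ => ?_
  rw [integralMap_tmul]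
  by_cases hd : d = I.dim
  · rw [← hd]
    exact Submodule.smul_mem _ _ hl
  · rw [faceIntegral_of_mem hd hω, zero_smul]
    exact zero_mem _

theorem whitneyMap_mem_filt {p : ℕ} {α : Face n → L} (hα : α ∈ cochainFilt L n p) :
    whitneyMap L n α ∈ tensorFilt L n p := by
  rw [whitneyMap_apply]
  exact sum_mem fun I _ => Submodule.apply_mem_map₂ _ trivial (Submodule.mem_pi.1 hα I trivial)

theorem integralMap_mem_filt {p : ℕ} {x : Form K n ⊗[K] L} (hx : x ∈ tensorFilt L n p) :
    integralMap L n x ∈ cochainFilt L n p := by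
  suffices h : tensorFilt L n p ≤ (cochainFilt L n p).comap (integralMap L n) from h hx
  rw [tensorFilt, Submodule.map₂_le]
  intro ω _ l hl
  refine Submodule.mem_pi.2 fun I _ => ?_
  rw [TensorProduct.mk_apply, integralMap_tmul]
  exact Submodule.smul_mem _ _ hl

theorem dupontMap_mem_deg {k : ℤ} {x : Form K n ⊗[K] L} (hx : x ∈ tensorDeg L n k) :
    dupontMap n L x ∈ tensorDeg L n (k + -1) := by
  refine rTensor_mem_deg (dupont K n) (fun d => d - 1) (-1) (fun d ω h => ?_) hx
  have h1 := dupont_mem h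
  refine ⟨h1.1, ?_⟩
  cases d with
  | zero => exact Or.inr (h1.2 rfl)
  | succ d => exact Or.inl (by push_cast [Nat.add_sub_cancel]; ring)

theorem dupontMap_mem_filt {p : ℕ} {x : Form K n ⊗[K] L} (hx : x ∈ tensorFilt L n p) :
    dupontMap n L x ∈ tensorFilt L n p := rTensor_mem_filt _ hx

theorem cochainD_cochainD [CharZero K] {α : Face n → L} (hα : α ∈ cochainDeg L n 1) :
    cochainD L (cochainD L α) = 0 := by
  rw [← integralMap_whitneyMap (cochainD L (cochainD L α)), ← totalD_whitneyMap,
    ← totalD_whitneyMap, totalD_totalD (whitneyMap_mem_deg hα), map_zero]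

end Contraction

/-! ### The transferred structure on the diagonal -/

section Counting

/-- The number of ordered partitions with blocks of given sizes is a multinomial coefficient. -/
theorem card_blocks_eq {m k : ℕ} {i : Fin k → ℕ} (hi : i ∈ Finset.univ.piAntidiag m) :
    (Finset.univ.filter fun π : Fin m → Fin k => (fun j => (block π j).card) = i).card =
      Nat.multinomial Finset.univ i := by
  have h1 : (∑ j : Fin k, (MvPolynomial.X j : MvPolynomial (Fin k) ℕ)) ^ m =
      ∑ π : Fin m → Fin k, ∏ j, MvPolynomial.X j ^ (block π j).card := by
    rw [Fintype.sum_pow]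
    refine Finset.sum_congr rfl fun π _ => ?_
    rw [← Finset.prod_fiberwise' Finset.univ π]
    refine Finset.prod_congr rfl fun j _ => ?_
    rw [Finset.prod_const]
    rfl
  have h2 : ∀ a : Fin k → ℕ, (∏ j, MvPolynomial.X j ^ a j : MvPolynomial (Fin k) ℕ) =
      MvPolynomial.monomial (Finsupp.equivFunOnFinite.symm a) 1 := by
    intro a
    rw [MvPolynomial.monomial_eq, Finsupp.prod_fintype _ _ (by simp)]
    simp
  have h3 : ∀ a : Fin k → ℕ, MvPolynomial.coeff (Finsupp.equivFunOnFinite.symm i)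
      (∏ j, MvPolynomial.X j ^ a j : MvPolynomial (Fin k) ℕ) = if a = i then 1 else 0 := by
    intro a
    rw [h2, MvPolynomial.coeff_monomial]
    simp
  have h4 := congrArg (MvPolynomial.coeff (Finsupp.equivFunOnFinite.symm i))
    (h1.symm.trans (Finset.sum_pow_eq_sum_piAntidiag Finset.univ _ m))
  simp only [MvPolynomial.coeff_sum, h3] at h4
  have h5 : ∀ a : Fin k → ℕ, MvPolynomial.coeff (Finsupp.equivFunOnFinite.symm i)
      ((Nat.multinomial Finset.univ a : MvPolynomial (Fin k) ℕ) *
        ∏ j, MvPolynomial.X j ^ a j) = if a = i then Nat.multinomial Finset.univ a else 0 := by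
    intro a
    rw [← nsmul_eq_mul, MvPolynomial.coeff_smul, h3]
    simp
  simp only [h5] at h4
  rw [Finset.card_filter, h4, Finset.sum_ite_eq' _ i, if_pos hi]

theorem sum_blocks {E : Type*} [AddCommMonoid E] (m k : ℕ) (F : (Fin k → ℕ) → E) :
    ∑ π : Fin m → Fin k, F (fun j => (block π j).card) =
      ∑ i ∈ Finset.univ.piAntidiag m, Nat.multinomial Finset.univ i • F i := by
  rw [← Finset.sum_fiberwise_of_maps_to (s := Finset.univ)
    (t := (Finset.univ : Finset (Fin k)).piAntidiag m)
    (g := fun π : Fin m → Fin k => fun j => (block π j).card)]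
  · refine Finset.sum_congr rfl fun i hi => ?_
    rw [← card_blocks_eq hi, ← Finset.sum_const]
    refine Finset.sum_congr rfl fun π hπ => ?_
    rw [(Finset.mem_filter.1 hπ).2]
  · intro π _
    rw [Finset.mem_piAntidiag]
    refine ⟨?_, fun _ _ => Finset.mem_univ _⟩
    have := Finset.card_eq_sum_card_fiberwise (s := (Finset.univ : Finset (Fin m)))
      (t := Finset.univ) (f := π) (fun _ _ => Finset.mem_univ _)
    rw [Finset.card_univ, Fintype.card_fin] at this
    exact this.symm

theorem lt_of_sum_eq {k m : ℕ} {i : Fin k → ℕ} (hk : 2 ≤ k) (h0 : ∀ j, i j ≠ 0)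
    (hs : ∑ j, i j = m) (j : Fin k) : i j < m := by
  obtain ⟨k, rfl⟩ : ∃ l, k = l + 2 := ⟨k - 2, by omega⟩
  obtain ⟨j', hj'⟩ : ∃ j' : Fin (k + 2), j' ≠ j := exists_ne j
  have h1 : i j + i j' ≤ ∑ j, i j := Finset.add_le_sum (s := Finset.univ) (f := i)
    (fun _ _ => Nat.zero_le _) (Finset.mem_univ j) (Finset.mem_univ j') hj'.symm
  have := Nat.pos_of_ne_zero (h0 j')
  omega

end Counting

section TransferDiagonal

theorem transferSum_zero_degrees {K : Type*} [Field K] {V W : Type*} [AddCommGroup V] [Module K V]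
    [AddCommGroup W] [Module K W] (Q : (n : ℕ) → (Fin n → ℤ) → (Fin n → V) → V) (n : ℕ)
    (f : (m : ℕ) → m < n → (Fin m → ℤ) → (Fin m → W) → V) (w : Fin n → W) :
    transferSum (K := K) Q n f (fun _ => 0) w =
      ∑ k ∈ Finset.range (n - 1), ((k + 2).factorial : K)⁻¹ •
        ∑ π : {π : Fin n → Fin (k + 2) // Function.Surjective π}, Q (k + 2) (fun _ => 0)
          (fun j => f _ (card_block_lt π j) (fun _ => 0) (restrict (block π.1 j) w)) := by
  have h : ∀ (k : ℕ) (π : Fin n → Fin k), blockSign (fun _ => 0) π = 0 := fun k π => by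
    simp [blockSign]
  simp only [transferSum, h, Int.negOnePow_zero, one_smul, Finset.sum_const_zero]
  rfl

variable {K : Type v} [Field K] {L : CompleteLInfty.{u} K} {n : ℕ}

/-- The sum over all ordered partitions into `k ≥ 2` blocks in homotopy transfer, evaluated at the
constant tuple `α` of degree one, divided by `m!`. -/
noncomputable def diagSum (m : ℕ) (α : Face n → L) : Form K n ⊗[K] L :=
  (m.factorial : K)⁻¹ • transferSum (K := K) (formOp L n) m
    (fun m' _ => transferMap (whitneyMap L n) (dupontMap n L) (formOp L n) m') (fun _ => 0)
    (fun _ => α)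

/-- The `m`-th Taylor coefficient of the transferred morphism, evaluated at the constant tuple `α`
of degree one, divided by `m!`. -/
noncomputable def diagMap (m : ℕ) (α : Face n → L) : Form K n ⊗[K] L :=
  (m.factorial : K)⁻¹ • transferMap (whitneyMap L n) (dupontMap n L) (formOp L n) m (fun _ => 0)
    (fun _ => α)

theorem diagMap_one (α : Face n → L) : diagMap 1 α = whitneyMap L n α := by
  rw [diagMap, transferMap, dif_pos rfl, Nat.factorial_one, Nat.cast_one, inv_one, one_smul]

theorem diagMap_of_ne {m : ℕ} (hm : m ≠ 1) (α : Face n → L) :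
    diagMap m α = dupontMap n L (diagSum m α) := by
  rw [diagMap, transferMap, dif_neg hm, diagSum, map_smul]

theorem diagSum_of_le {m : ℕ} (hm : m ≤ 1) (α : Face n → L) : diagSum m α = 0 := by
  rw [diagSum, transferSum, Nat.sub_eq_zero_of_le hm, Finset.sum_range_zero, smul_zero]

theorem diagMap_zero (α : Face n → L) : diagMap 0 α = 0 := by
  rw [diagMap_of_ne zero_ne_one, diagSum_of_le zero_le_one, map_zero]

/-- On the diagonal, the transferred operations of arity at least two are the projections of the
sums over ordered partitions. For `m = 1` the former is the differential and the latter is zero. -/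
theorem cochainOp_diag {m : ℕ} (hm : m ≠ 1) (α : Face n → L) :
    (m.factorial : K)⁻¹ • cochainOp L n m (fun _ => 0) (fun _ => α) =
      integralMap L n (diagSum m α) := by
  rw [cochainOp, transferOp, dif_neg hm, diagSum, map_smul]
  rfl

theorem cochainOp_one (α : Face n → L) :
    cochainOp L n 1 (fun _ => 0) (fun _ => α) = cochainD L α := by
  rw [cochainOp, transferOp, dif_pos rfl]

theorem diagSum_term_eq_zero {k : ℕ} {i : Fin k → ℕ} {j : Fin k} (hj : i j = 0) (α : Face n → L) :
    (extendMulti (Form K n) (L.q k) fun j => tensorParity L n (diagMap (i j) α)) = 0 :=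
  MultilinearMap.map_coord_zero _ j (by rw [hj, diagMap_zero, map_zero])

/-- The sum over ordered partitions depends only on the sizes of the blocks, which are counted by
multinomial coefficients: these cancel the factorials. -/
theorem diagSum_eq [CharZero K] {m N : ℕ} (hm : m ≤ N) (α : Face n → L) : diagSum m α =
    ∑ k ∈ Finset.Icc 2 N, (k.factorial : K)⁻¹ • ∑ i ∈ Finset.univ.piAntidiag m,
      extendMulti (Form K n) (L.q k) fun j => tensorParity L n (diagMap (i j) α) := by
  have h1 : ∀ k, ∑ i ∈ Finset.univ.piAntidiag m, (extendMulti (Form K n) (L.q k) fun j =>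
      tensorParity L n (diagMap (i j) α)) = (m.factorial : K)⁻¹ • ∑ π : Fin m → Fin k,
      extendMulti (Form K n) (L.q k) fun j => tensorParity L n
        (transferMap (whitneyMap L n) (dupontMap n L) (formOp L n) (block π j).card (fun _ => 0)
          (fun _ => α)) := by
    intro k
    rw [sum_blocks m k fun i => extendMulti (Form K n) (L.q k) fun j => tensorParity L n
      (transferMap (whitneyMap L n) (dupontMap n L) (formOp L n) (i j) (fun _ => 0)
        (fun _ => α)), Finset.smul_sum]
    refine Finset.sum_congr rfl fun i hi => ?_
    simp only [diagMap, map_smul]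
    rw [MultilinearMap.map_smul_univ, ← Nat.cast_smul_eq_nsmul K, smul_smul]
    congr 1
    have h2 := Nat.multinomial_spec (s := Finset.univ) (f := i)
    rw [(Finset.mem_piAntidiag.1 hi).1] at h2
    have h3 : (m.factorial : K) ≠ 0 := Nat.cast_ne_zero.2 m.factorial_ne_zero
    have h4 : (∏ j, ((i j).factorial : K)) ≠ 0 := Finset.prod_ne_zero_iff.2 fun j _ =>
      Nat.cast_ne_zero.2 (i j).factorial_ne_zero
    rw [Finset.prod_inv_distrib, inv_eq_iff_eq_inv, mul_inv, inv_inv, ← h2]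
    push_cast
    have h5 : (Nat.multinomial Finset.univ i : K) ≠ 0 := by
      intro h
      rw [← h2, Nat.cast_mul, h, mul_zero] at h3
      exact h3 rfl
    field_simp
  have h2 : ∀ k, (∑ π : {π : Fin m → Fin (k + 2) // Function.Surjective π},
      formOp L n (k + 2) (fun _ => 0)
        (fun j => transferMap (K := K) (whitneyMap L n) (dupontMap n L) (formOp L n)
          (block π.1 j).card (fun _ => 0) (fun _ => α))) = ∑ π : Fin m → Fin (k + 2),
      extendMulti (Form K n) (L.q (k + 2)) fun j => tensorParity L n
        (transferMap (whitneyMap L n) (dupontMap n L) (formOp L n) (block π j).card (fun _ => 0)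
          (fun _ => α)) := by
    intro k
    rw [Finset.sum_congr rfl fun π _ => formOp_zero (k + 2) _,
      ← Finset.sum_subtype (Finset.univ.filter fun π : Fin m → Fin (k + 2) => Function.Surjective π)
        (by simp) fun π => extendMulti (Form K n) (L.q (k + 2)) fun j => tensorParity L n
          (transferMap (whitneyMap L n) (dupontMap n L) (formOp L n) (block π j).card (fun _ => 0)
            (fun _ => α))]
    refine Finset.sum_subset (Finset.subset_univ _) fun π _ hπ => ?_
    have h4 : ¬ Function.Surjective π := by simpa using hπ
    obtain ⟨j, hj⟩ := not_forall.1 h4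
    have h5 : (block π j).card = 0 := by
      rw [Finset.card_eq_zero, block, Finset.filter_eq_empty_iff]
      exact fun a _ h => hj ⟨a, h⟩
    refine MultilinearMap.map_coord_zero _ j ?_
    have h6 := diagMap_zero (K := K) α
    rw [diagMap, Nat.factorial_zero, Nat.cast_one, inv_one, one_smul] at h6
    rw [h5, h6, map_zero]
  have h3 : diagSum m α = ∑ k ∈ Finset.Icc 2 m, (k.factorial : K)⁻¹ •
      ∑ i ∈ Finset.univ.piAntidiag m,
      extendMulti (Form K n) (L.q k) fun j => tensorParity L n (diagMap (i j) α) := by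
    have h4 : Finset.Icc 2 m = Finset.Ico 2 (m + 1) := by ext; simp
    rw [diagSum, transferSum_zero_degrees, h4, Finset.sum_Ico_eq_sum_range, Finset.smul_sum]
    refine Finset.sum_congr rfl fun k _ => ?_
    rw [h1, ← add_comm k 2, ← h2, smul_comm]
    rfl
  rw [h3]
  refine Finset.sum_subset (Finset.Icc_subset_Icc_right hm) fun k hk hk' => ?_
  rw [Finset.sum_eq_zero, smul_zero]
  intro i hi
  obtain ⟨j, hj⟩ : ∃ j, i j = 0 := by
    by_contra! h
    have h4 : k ≤ ∑ j, i j := by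
      have := Finset.card_nsmul_le_sum Finset.univ i 1 fun j _ => Nat.one_le_iff_ne_zero.2 (h j)
      simpa using this
    rw [(Finset.mem_piAntidiag.1 hi).1] at h4
    simp only [Finset.mem_Icc] at hk hk'
    omega
  exact diagSum_term_eq_zero hj α

theorem diagSum_mem_filt_of [CharZero K] {m : ℕ} {α : Face n → L}
    (h : ∀ i < m, diagMap i α ∈ tensorFilt L n i) : diagSum m α ∈ tensorFilt L n m := by
  rw [diagSum_eq le_rfl]
  refine sum_mem fun k hk => Submodule.smul_mem _ _ (sum_mem fun i hi => ?_)
  by_cases h0 : ∃ j, i j = 0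
  · obtain ⟨j, hj⟩ := h0
    rw [diagSum_term_eq_zero hj]
    exact zero_mem _
  · push Not at h0
    have hs : ∑ j, i j = m := (Finset.mem_piAntidiag.1 hi).1
    rw [← hs]
    refine extendMulti_q_mem_filt (fun j => Nat.one_le_iff_ne_zero.2 (h0 j)) fun j =>
      rTensor_mem_filt _ (h _ (lt_of_sum_eq (Finset.mem_Icc.1 hk).1 h0 hs j))

theorem diagMap_mem_filt [CharZero K] (m : ℕ) (α : Face n → L) :
    diagMap m α ∈ tensorFilt L n m := by
  induction m using Nat.strong_induction_on with
  | _ m ih =>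
    by_cases hm : m = 1
    · exact tensorFilt_of_le hm.le _
    · rw [diagMap_of_ne hm]
      exact dupontMap_mem_filt (diagSum_mem_filt_of ih)

theorem diagSum_mem_filt [CharZero K] (m : ℕ) (α : Face n → L) :
    diagSum m α ∈ tensorFilt L n m := diagSum_mem_filt_of fun i _ => diagMap_mem_filt i α

end TransferDiagonal

/-! ### Curvature of cochains -/

section Curvature

variable {K : Type v} [Field K] {L : CompleteLInfty.{u} K} {n : ℕ}

theorem diagSum_mem_deg_of [CharZero K] {m : ℕ} {α : Face n → L}
    (h : ∀ i, diagMap i α ∈ tensorDeg L n 1) :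
    diagSum m α ∈ tensorDeg L n 2 := by
  rw [diagSum_eq le_rfl]
  refine sum_mem fun k hk => Submodule.smul_mem _ _ (sum_mem fun i hi => ?_)
  have := extendMulti_mem_deg (L := L) (n := n) (k := k) (e := fun _ => 0)
    (x := fun j => tensorParity L n (diagMap (i j) α)) fun j => by
      rw [zero_add]; exact tensorParity_mem_deg (h _)
  simpa using this

theorem diagMap_mem_deg [CharZero K] (m : ℕ) {α : Face n → L} (hα : α ∈ cochainDeg L n 1) :
    diagMap m α ∈ tensorDeg L n 1 := by
  induction m using Nat.strong_induction_on with
  | _ m ih =>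
    by_cases hm : m = 1
    · rw [hm, diagMap_one]
      exact whitneyMap_mem_deg hα
    · rw [diagMap_of_ne hm, diagSum_eq le_rfl]
      have h2 : ∑ k ∈ Finset.Icc 2 m, (k.factorial : K)⁻¹ • ∑ i ∈ Finset.univ.piAntidiag m,
          (extendMulti (Form K n) (L.q k) fun j => tensorParity L n (diagMap (i j) α)) ∈
          tensorDeg L n 2 := by
        refine sum_mem fun k hk => Submodule.smul_mem _ _ (sum_mem fun i hi => ?_)
        by_cases h0 : ∃ j, i j = 0
        · obtain ⟨j, hj⟩ := h0
          rw [diagSum_term_eq_zero hj]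
          exact zero_mem _
        · push Not at h0
          have hs : ∑ j, i j = m := (Finset.mem_piAntidiag.1 hi).1
          have hlt := lt_of_sum_eq (Finset.mem_Icc.1 hk).1 h0 hs
          have := extendMulti_mem_deg (L := L) (n := n) (k := k) (e := fun _ => 0)
            (x := fun j => tensorParity L n (diagMap (i j) α)) fun j => by
              rw [zero_add]; exact tensorParity_mem_deg (ih _ (hlt j))
          simpa using this
      have h3 := dupontMap_mem_deg h2
      rwa [show (2 + -1 : ℤ) = 1 by norm_num] at h3

theorem diagSum_mem_deg [CharZero K] (m : ℕ) {α : Face n → L} (hα : α ∈ cochainDeg L n 1) :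
    diagSum m α ∈ tensorDeg L n 2 := diagSum_mem_deg_of fun i => diagMap_mem_deg i hα

/-- The image `∑ f_m(α, …, α) / m!` of `α` under the transferred morphism, truncated. -/
noncomputable def diagPhi (N : ℕ) (α : Face n → L) : Form K n ⊗[K] L :=
  ∑ m ∈ Finset.range (N + 1), diagMap m α

/-- The image of `diagPhi` under the operations of arity at least two, truncated. -/
noncomputable def diagTotal (N : ℕ) (α : Face n → L) : Form K n ⊗[K] L :=
  ∑ m ∈ Finset.range (N + 1), diagSum m α

theorem diagPhi_mem_deg [CharZero K] (N : ℕ) {α : Face n → L} (hα : α ∈ cochainDeg L n 1) :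
    diagPhi N α ∈ tensorDeg L n 1 := sum_mem fun m _ => diagMap_mem_deg m hα

theorem diagPhi_eq {N : ℕ} (hN : 1 ≤ N) (α : Face n → L) :
    diagPhi N α = whitneyMap L n α + dupontMap n L (diagTotal N α) := by
  have h1 : ∀ m, diagMap m α = (if m = 1 then whitneyMap L n α else 0) +
      dupontMap n L (diagSum m α) := by
    intro m
    split_ifs with h
    · rw [h, diagMap_one, diagSum_of_le le_rfl, map_zero, add_zero]
    · rw [zero_add, diagMap_of_ne h]
  rw [diagPhi, diagTotal, Finset.sum_congr rfl fun m _ => h1 m, Finset.sum_add_distrib, map_sum,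
    Finset.sum_ite_eq', if_pos (Finset.mem_range.2 (by omega))]

/-- The truncations of `∑ f_m(α, …, α) / m!` satisfy the recursion of homotopy transfer up to terms
of high filtration. -/
theorem sum_opDiag_diagPhi [CharZero K] (N : ℕ) (α : Face n → L) : ∃ ε ∈ tensorFilt L n (N + 1),
    ∑ k ∈ Finset.Icc 2 N, (k.factorial : K)⁻¹ • opDiag L n k (diagPhi N α) =
      diagTotal N α + ε := by
  let g : (k : ℕ) → (Fin k → ℕ) → Form K n ⊗[K] L := fun k r =>
    extendMulti (Form K n) (L.q k) fun j => tensorParity L n (diagMap (r j) α)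
  let A : (k : ℕ) → Finset (Fin k → ℕ) := fun k => Fintype.piFinset fun _ => Finset.range (N + 1)
  have h1 : ∀ k, opDiag L n k (diagPhi N α) = ∑ r ∈ A k, g k r := by
    intro k
    rw [opDiag, diagPhi, map_sum, MultilinearMap.map_sum_finset]
  have h2 : ∀ k, ∑ r ∈ A k with ∑ j, r j ≤ N, g k r =
      ∑ m ∈ Finset.range (N + 1), ∑ r ∈ Finset.univ.piAntidiag m, g k r := by
    intro k
    rw [← Finset.sum_fiberwise_of_maps_to (t := Finset.range (N + 1))
        (g := fun r : Fin k → ℕ => ∑ j, r j)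
      fun r hr => Finset.mem_range_succ_iff.2 (Finset.mem_filter.1 hr).2]
    refine Finset.sum_congr rfl fun m hm => Finset.sum_congr ?_ fun _ _ => rfl
    ext r
    simp only [A, Finset.mem_filter, Fintype.mem_piFinset, Finset.mem_piAntidiag,
      Finset.mem_range] at hm ⊢
    constructor
    · rintro ⟨_, h⟩
      exact ⟨h, fun _ _ => Finset.mem_univ _⟩
    · rintro ⟨h, _⟩
      have h' : ∑ j, r j = m := h
      refine ⟨⟨fun j => ?_, by omega⟩, h⟩
      have := Finset.single_le_sum (f := r) (fun _ _ => Nat.zero_le _) (Finset.mem_univ j)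
      omega
  have h3 : ∀ k r, N + 1 ≤ ∑ j, r j → g k r ∈ tensorFilt L n (N + 1) := by
    intro k r hr
    by_cases h0 : ∃ j, r j = 0
    · obtain ⟨j, hj⟩ := h0
      have : g k r = 0 := diagSum_term_eq_zero hj α
      rw [this]
      exact zero_mem _
    · push Not at h0
      exact tensorFilt_antitone hr (extendMulti_q_mem_filt
        (fun j => Nat.one_le_iff_ne_zero.2 (h0 j))
        fun j => rTensor_mem_filt _ (diagMap_mem_filt _ α))
  refine ⟨∑ k ∈ Finset.Icc 2 N, (k.factorial : K)⁻¹ • ∑ r ∈ A k with ¬ ∑ j, r j ≤ N, g k r,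
    sum_mem fun k _ => Submodule.smul_mem _ _ (sum_mem fun r hr => h3 k r ?_), ?_⟩
  · have := (Finset.mem_filter.1 hr).2
    omega
  · have h4 : diagTotal N α = ∑ k ∈ Finset.Icc 2 N, (k.factorial : K)⁻¹ •
        ∑ m ∈ Finset.range (N + 1), ∑ r ∈ Finset.univ.piAntidiag m, g k r := by
      rw [diagTotal, Finset.sum_congr rfl fun m hm =>
        diagSum_eq (Finset.mem_range_succ_iff.1 hm) α, Finset.sum_comm]
      simp only [Finset.smul_sum]
      rfl
    rw [h4, ← Finset.sum_add_distrib]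
    refine Finset.sum_congr rfl fun k _ => ?_
    rw [h1, ← h2, ← smul_add, Finset.sum_filter_add_sum_filter_not]

/-- The curvature `∑_{i ≤ N} rᵢ(α, …, α) / i!`, truncated. -/
noncomputable def cochainCurv (N : ℕ) (α : Face n → L) : Face n → L :=
  ∑ i ∈ Finset.Icc 1 N, (i.factorial : K)⁻¹ • cochainOp L n i (fun _ => 0) (fun _ => α)

theorem cochainCurv_eq {N : ℕ} (hN : 1 ≤ N) (α : Face n → L) :
    cochainCurv N α = cochainD L α + integralMap L n (diagTotal N α) := by
  have h1 : ∀ m, (if m = 1 then cochainD L α else 0) + integralMap L n (diagSum m α) =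
      if m = 0 then 0 else (m.factorial : K)⁻¹ • cochainOp L n m (fun _ => 0) (fun _ => α) := by
    intro m
    split_ifs with h h' h'
    · omega
    · rw [h, cochainOp_one, diagSum_of_le le_rfl, map_zero, add_zero, Nat.factorial_one,
        Nat.cast_one, inv_one, one_smul]
    · rw [h', diagSum_of_le zero_le_one, map_zero, add_zero]
    · rw [zero_add, cochainOp_diag h]
  have h2 : cochainD L α = ∑ m ∈ Finset.range (N + 1), if m = 1 then cochainD L α else 0 := by
    rw [Finset.sum_ite_eq', if_pos (Finset.mem_range.2 (by omega))]
  rw [diagTotal, map_sum, h2, ← Finset.sum_add_distrib, Finset.sum_congr rfl fun m _ => h1 m,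
    cochainCurv]
  refine Finset.sum_subset_zero_on_sdiff (fun i hi => ?_) (fun i hi => ?_) fun i hi => ?_
  · exact Finset.mem_range_succ_iff.2 (Finset.mem_Icc.1 hi).2
  · have := Finset.mem_sdiff.1 hi
    simp only [Finset.mem_range, Finset.mem_Icc, not_and] at this
    exact if_pos (by omega)
  · rw [if_neg (by have := Finset.mem_Icc.1 hi; omega)]

/-- The curvature of `diagPhi` in terms of the curvature of `α`. -/
theorem formCurv_diagPhi [CharZero K] {N : ℕ} (hN : 1 ≤ N) (α : Face n → L) :
    ∃ ε ∈ tensorFilt L n (N + 1),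
    formCurv N (diagPhi N α) = totalD L n (diagPhi N α) + diagTotal N α + ε ∧
    formCurv N (diagPhi N α) + dupontMap n L (totalD L n (diagTotal N α)) =
      whitneyMap L n (cochainCurv N α) + ε := by
  obtain ⟨ε, hε, h⟩ := sum_opDiag_diagPhi N α
  have h1 : formCurv N (diagPhi N α) = totalD L n (diagPhi N α) + diagTotal N α + ε := by
    have h2 : Finset.Icc 1 N = insert 1 (Finset.Icc 2 N) := by ext; simp; omega
    rw [formCurv, h2, Finset.sum_insert (by simp), h, Nat.factorial_one, Nat.cast_one, inv_one,
      one_smul, totalD_apply, opLin_self]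
    simp only [add_assoc]
  refine ⟨ε, hε, h1, ?_⟩
  rw [h1, cochainCurv_eq hN, map_add (whitneyMap L n), ← dupontMap_totalD, diagPhi_eq hN, map_add,
    totalD_whitneyMap]
  abel

/-- The Bianchi identity for cochains: if the curvature is in `Fᵖ`, then its differential is in
`F^{p+1}`. -/
theorem cochainD_cochainCurv [CharZero K] {p N : ℕ} (hp : 1 ≤ p) (hpN : p ≤ N) {α : Face n → L}
    (hα : α ∈ cochainDeg L n 1) (h : cochainCurv N α ∈ cochainFilt L n p) :
    cochainD L (cochainCurv N α) ∈ cochainFilt L n (p + 1) := by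
  have hN : 1 ≤ N := hp.trans hpN
  obtain ⟨ε, hε, h1, h2⟩ := formCurv_diagPhi hN α
  -- By the Bianchi identity for forms, the curvature `Q` of the form `diagPhi N α` satisfies
  -- `Q = (small) - h D Q`, and `D Q` lies one step deeper than `Q`: so `Q` is small.
  have hφ := diagPhi_mem_deg N hα
  have h3 : ∀ j, 1 ≤ j → j ≤ N → formCurv N (diagPhi N α) ∈ tensorFilt L n j →
      totalD L n (diagTotal N α) ∈ tensorFilt L n (j + 1) := by
    intro j hj hjN hQ
    have h4 := totalD_formCurv_mem hφ hj hjN hQ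
    rw [h1, map_add, map_add, totalD_totalD hφ, zero_add] at h4
    exact mem_of_add_mem h4 (totalD_mem_filt (tensorFilt_antitone (by omega) hε))
  have h5 : ∀ j, 1 ≤ j → j ≤ p → formCurv N (diagPhi N α) ∈ tensorFilt L n j := by
    intro j hj
    induction j, hj using Nat.le_induction with
    | base => exact fun _ => tensorFilt_of_le le_rfl _
    | succ j hj ih =>
      intro hjp
      have h6 := h3 j hj (by omega) (ih (by omega))
      refine mem_of_add_mem (y := dupontMap n L (totalD L n (diagTotal N α))) ?_
        (dupontMap_mem_filt h6)
      rw [h2]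
      exact add_mem (tensorFilt_antitone hjp (whitneyMap_mem_filt h))
        (tensorFilt_antitone (by omega) hε)
  -- the differential of the curvature of `α` is the projection of that of `diagTotal N α`
  have h7 := h3 p hp hpN (h5 p hp le_rfl)
  rw [cochainCurv_eq hN, ← cochainDLin_apply, map_add, cochainDLin_apply, cochainDLin_apply,
    cochainD_cochainD hα, zero_add, ← integralMap_totalD]
  exact integralMap_mem_filt h7

theorem cochainD_mem_deg [CharZero K] {k : ℤ} {α : Face n → L} (hα : α ∈ cochainDeg L n k) :
    cochainD L α ∈ cochainDeg L n (k + 1) := by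
  rw [← integralMap_whitneyMap (cochainD L α), ← totalD_whitneyMap]
  refine integralMap_mem_deg ?_
  have h := whitneyMap_mem_deg hα
  refine add_mem (tensorD_mem_deg h) ?_
  have := extendMulti_mem_deg (L := L) (n := n) (k := 1) (e := fun _ => k - 1)
    (x := fun _ => tensorParity L n (whitneyMap L n α)) fun j => by
      rw [sub_add_cancel]; exact tensorParity_mem_deg h
  rw [opLin_self]
  rw [Fin.sum_univ_one, show k - 1 + 2 = k + 1 by ring] at this
  exact this

theorem cochainCurv_mem_deg [CharZero K] {N : ℕ} (hN : 1 ≤ N) {α : Face n → L}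
    (hα : α ∈ cochainDeg L n 1) :
    cochainCurv N α ∈ cochainDeg L n 2 := by
  rw [cochainCurv_eq hN]
  have h := cochainD_mem_deg hα
  rw [one_add_one_eq_two] at h
  exact add_mem h
    (integralMap_mem_deg (sum_mem fun m _ => diagSum_mem_deg m hα))

/-- Operations are Lipschitz continuous: a perturbation of the entries in `F^{i_j + s}` changes the
value by an element of `F^{∑ i_j + s}`. -/
theorem extendMulti_perturb [CharZero K] {k s : ℕ} {i : Fin k → ℕ} (hi : ∀ j, 1 ≤ i j)
    {x δ : Fin k → Form K n ⊗[K] L} (hx : ∀ j, x j ∈ tensorFilt L n (i j))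
    (hδ : ∀ j, δ j ∈ tensorFilt L n (i j + s)) : ∃ ε ∈ tensorFilt L n (∑ j, i j + s),
      extendMulti (Form K n) (L.q k) (x + δ) = extendMulti (Form K n) (L.q k) x + ε := by
  rw [MultilinearMap.map_add_univ, ← Finset.add_sum_erase _ _ (Finset.mem_univ Finset.univ),
    Finset.piecewise_univ]
  refine ⟨_, sum_mem fun S hS => ?_, rfl⟩
  obtain ⟨j, hj⟩ : ∃ j, j ∉ S := by
    by_contra! h
    exact (Finset.mem_erase.1 hS).1 (Finset.eq_univ_iff_forall.2 h)
  have h := extendMulti_q_mem_filt (L := L) (n := n) (k := k)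
    (p := fun a => if a = j then i a + s else i a) (x := S.piecewise x δ) (fun a => by
      split_ifs
      · exact (hi a).trans (Nat.le_add_right _ _)
      · exact hi a) fun a => by
      by_cases ha : a ∈ S
      · rw [Finset.piecewise_eq_of_mem _ _ _ ha, if_neg (by rintro rfl; exact hj ha)]
        exact hx a
      · rw [Finset.piecewise_eq_of_notMem _ _ _ ha]
        split_ifs
        · exact hδ a
        · exact tensorFilt_antitone (Nat.le_add_right _ _) (hδ a)
  have h1 : ∑ a, (if a = j then i a + s else i a) = ∑ a, i a + s := by
    have h2 : ∀ a, (if a = j then i a + s else i a) = i a + if a = j then s else 0 := fun a => by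
      split_ifs <;> rfl
    rw [Finset.sum_congr rfl fun a _ => h2 a, Finset.sum_add_distrib, Finset.sum_ite_eq',
      if_pos (Finset.mem_univ j)]
  rwa [h1] at h

/-- The transferred morphism is Lipschitz continuous on the diagonal. -/
theorem diag_perturb [CharZero K] (s : ℕ) {α δ : Face n → L} (hδ : δ ∈ cochainFilt L n (s + 1))
    (m : ℕ) :
    (∃ ε ∈ tensorFilt L n (m + s), diagSum m (α + δ) = diagSum m α + ε) ∧
    ∃ ε ∈ tensorFilt L n (m + s), diagMap m (α + δ) = diagMap m α + ε := by
  induction m using Nat.strong_induction_on with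
  | _ m ih =>
    have h1 : ∃ ε ∈ tensorFilt L n (m + s), diagSum m (α + δ) = diagSum m α + ε := by
      have h2 : ∀ k ∈ Finset.Icc 2 m, ∀ i ∈ (Finset.univ : Finset (Fin k)).piAntidiag m,
          ∃ ε ∈ tensorFilt L n (m + s),
          (extendMulti (Form K n) (L.q k) fun j => tensorParity L n (diagMap (i j) (α + δ))) =
          (extendMulti (Form K n) (L.q k) fun j => tensorParity L n (diagMap (i j) α)) + ε := by
        intro k hk i hi
        by_cases h0 : ∃ j, i j = 0
        · obtain ⟨j, hj⟩ := h0
          exact ⟨0, zero_mem _, by rw [diagSum_term_eq_zero hj, diagSum_term_eq_zero hj, add_zero]⟩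
        · push Not at h0
          have hs : ∑ j, i j = m := (Finset.mem_piAntidiag.1 hi).1
          have hlt := lt_of_sum_eq (Finset.mem_Icc.1 hk).1 h0 hs
          choose ε hε h3 using fun j => (ih (i j) (hlt j)).2
          obtain ⟨η, hη, h4⟩ := extendMulti_perturb (L := L) (n := n)
            (fun j => Nat.one_le_iff_ne_zero.2 (h0 j))
            (x := fun j => tensorParity L n (diagMap (i j) α))
            (δ := fun j => tensorParity L n (ε j))
            (fun j => rTensor_mem_filt _ (diagMap_mem_filt _ _))
            (fun j => rTensor_mem_filt _ (hε j))
          refine ⟨η, hs ▸ hη, ?_⟩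
          rw [← h4]
          congr 1
          ext1 j
          rw [h3, map_add]
          rfl
      choose! ε hε h3 using h2
      refine ⟨∑ k ∈ Finset.Icc 2 m, (k.factorial : K)⁻¹ • ∑ i ∈ Finset.univ.piAntidiag m, ε k i,
        sum_mem fun k hk => Submodule.smul_mem _ _ (sum_mem fun i hi => hε k hk i hi), ?_⟩
      rw [diagSum_eq le_rfl, diagSum_eq le_rfl, ← Finset.sum_add_distrib]
      refine Finset.sum_congr rfl fun k hk => ?_
      rw [Finset.sum_congr rfl (h3 k hk), Finset.sum_add_distrib, smul_add]
    refine ⟨h1, ?_⟩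
    by_cases hm : m = 1
    · subst hm
      exact ⟨whitneyMap L n δ, by rw [add_comm 1 s]; exact whitneyMap_mem_filt hδ,
        by rw [diagMap_one, diagMap_one, map_add]⟩
    · obtain ⟨ε, hε, h⟩ := h1
      exact ⟨dupontMap n L ε, dupontMap_mem_filt hε,
        by rw [diagMap_of_ne hm, diagMap_of_ne hm, h, map_add]⟩

/-- To first order, a perturbation `δ` of `α` changes the curvature by the differential of `δ`. -/
theorem cochainCurv_add [CharZero K] {N p : ℕ} (hN : 1 ≤ N) (hp : 1 ≤ p) (α : Face n → L)
    {δ : Face n → L}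
    (hδ : δ ∈ cochainFilt L n p) :
    cochainCurv N (α + δ) - (cochainCurv N α + cochainD L δ) ∈ cochainFilt L n (p + 1) := by
  obtain ⟨s, rfl⟩ : ∃ s, p = s + 1 := ⟨p - 1, by omega⟩
  have h1 : ∀ m, ∃ ε ∈ tensorFilt L n (s + 1 + 1), diagSum m (α + δ) = diagSum m α + ε := by
    intro m
    by_cases hm : m ≤ 1
    · exact ⟨0, zero_mem _, by rw [diagSum_of_le hm, diagSum_of_le hm, add_zero]⟩
    · obtain ⟨ε, hε, h⟩ := (diag_perturb s (α := α) hδ m).1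
      exact ⟨ε, tensorFilt_antitone (by omega) hε, h⟩
  choose ε hε h using h1
  rw [cochainCurv_eq hN, cochainCurv_eq hN, ← cochainDLin_apply, map_add, cochainDLin_apply,
    cochainDLin_apply, diagTotal, Finset.sum_congr rfl fun m _ => h m, Finset.sum_add_distrib,
    map_add, ← diagTotal]
  have h2 := integralMap_mem_filt (L := L) (n := n)
    (sum_mem (t := Finset.range (N + 1)) fun m _ => hε m)
  convert h2 using 1
  abel

/-- The curvature series converges. -/
theorem cochainCurv_sub_mem [CharZero K] {N M : ℕ} (hN : 1 ≤ N) (h : N ≤ M) (α : Face n → L) :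
    cochainCurv M α - cochainCurv N α ∈ cochainFilt L n (N + 1) := by
  have h1 : diagTotal M α = ∑ m ∈ Finset.range (M + 1) \ Finset.range (N + 1), diagSum m α +
      diagTotal N α :=
    (Finset.sum_sdiff (Finset.range_subset_range.2 (Nat.succ_le_succ h))).symm
  rw [cochainCurv_eq hN, cochainCurv_eq (hN.trans h), add_sub_add_left_eq_sub, h1, map_add,
    add_sub_cancel_right]
  refine integralMap_mem_filt ?_
  refine sum_mem fun m hm => tensorFilt_antitone ?_ (diagSum_mem_filt m α)
  have := Finset.mem_sdiff.1 hm
  simp only [Finset.mem_range] at this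
  omega

theorem cochainFilt_antitone : Antitone (cochainFilt L n) := fun _ _ h _ hx =>
  Submodule.mem_pi.2 fun I hI => L.filt_antitone h (Submodule.mem_pi.1 hx I hI)

/-- A bound for the partial sums which replaces the limit in the Maurer-Cartan equation. -/
theorem mem_mcCochains [CharZero K] {α : Face n → L} : α ∈ mcCochains L n ↔
    α ∈ cochainDeg L n 1 ∧ ∀ N, 1 ≤ N → cochainCurv N α ∈ cochainFilt L n (N + 1) := by
  refine and_congr_right fun hα => ⟨fun h N hN => ?_, fun h p => ⟨max p 1, fun m hm => ?_⟩⟩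
  · obtain ⟨M, hM⟩ := h (N + 1)
    have h1 := hM (max M N) (le_max_left _ _)
    have h2 := cochainCurv_sub_mem hN (le_max_right M N) α
    have h3 := sub_mem h1 h2
    rwa [← cochainCurv, sub_sub_cancel] at h3
  · have := h m ((le_max_right _ _).trans hm)
    exact cochainFilt_antitone (by have := (le_max_left p 1).trans hm; omega) this

theorem cochainPull_cochainCurv {m : ℕ} (θ : Fin (m + 1) → Fin (n + 1)) (hθ : Monotone θ) (N : ℕ)
    (α : Face n → L) :
    cochainPull (K := K) θ (cochainCurv N α) = cochainCurv N (cochainPull (K := K) θ α) := by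
  simp only [cochainCurv, map_sum, map_smul, cochainPull_cochainOp L θ hθ]

end Curvature

/-! ### Filling horns of cochains -/

section Horns

variable {K : Type v} [Field K] {L : CompleteLInfty.{u} K} {n : ℕ}

/-- The facet opposite to the vertex `i`. -/
def missFace (i : Fin (n + 2)) : Face (n + 1) :=
  ⟨Finset.univ.erase i, by rw [← Finset.card_pos]; simp⟩

theorem missFace_injective : Function.Injective (missFace (n := n)) := by
  intro i j h
  by_contra hne
  have h1 : i ∈ (missFace j).1 := Finset.mem_erase.2 ⟨hne, Finset.mem_univ _⟩
  rw [← h] at h1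
  exact (Finset.mem_erase.1 h1).1 rfl

theorem topFace_ne_missFace (i : Fin (n + 2)) : topFace (n + 1) ≠ missFace i := by
  intro h
  have h1 : i ∈ (topFace (n + 1)).1 := Finset.mem_univ i
  rw [h] at h1
  exact (Finset.mem_erase.1 h1).1 rfl

theorem dim_missFace (i : Fin (n + 2)) : (missFace i).dim = n := by simp [missFace, Face.dim]

theorem cochainD_topFace (α : Face (n + 1) → L) : cochainD L α (topFace (n + 1)) =
    ∑ i : Fin (n + 2), (-1 : ℤ) ^ (i : ℕ) • α (missFace i) +
      (-1 : ℤ) ^ (topFace (n + 1)).dim • L.q 1 fun _ => α (topFace (n + 1)) := by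
  rw [cochainD]
  congr 1
  rw [(topFace (n + 1)).sum_vertex fun a i => if h : ((topFace (n + 1)).1.erase i).Nonempty then
    (-1 : ℤ) ^ a • α ⟨_, h⟩ else 0]
  refine Finset.sum_congr rfl fun i _ => ?_
  have h1 : (topFace (n + 1)).below i = i := by
    rw [Face.below, topFace, Finset.filter_gt_eq_Iio, Fin.card_Iio]
  refine (dif_pos (missFace i).2).trans ?_
  rw [h1]
  rfl

theorem q_one_mem_filt {p : ℕ} {x : L} (hx : x ∈ L.filt p) : (L.q 1 fun _ => x) ∈ L.filt p := by
  rcases Nat.eq_zero_or_pos p with rfl | hp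
  · exact L.filt_antitone (Nat.zero_le 1) (by rw [L.filt_one]; trivial)
  · have := L.q_filt 1 (fun _ => p) (fun _ => x) (fun _ => hp) fun _ => hx
    rwa [Fin.sum_univ_one] at this

theorem mem_filt_of_le {p : ℕ} (hp : p ≤ 1) (x : L) : x ∈ L.filt p :=
  L.filt_antitone hp (by rw [L.filt_one]; trivial)

/-- Every face other than the top one and the one opposite to `i` is contained in a facet
opposite to another vertex. -/
theorem exists_facet {i : Fin (n + 2)} {J : Face (n + 1)} (h1 : J ≠ topFace (n + 1))
    (h2 : J ≠ missFace i) : ∃ j, j ≠ i ∧ ∃ J' : Face n, J'.1.image (Fin.succAbove j) = J.1 := by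
  obtain ⟨j, hj, hji⟩ : ∃ j, j ∉ J.1 ∧ j ≠ i := by
    by_contra! h
    by_cases hi : i ∈ J.1
    · refine h1 (Subtype.ext (Finset.eq_univ_iff_forall.2 fun j => ?_))
      by_contra hj
      exact hj (h j hj ▸ hi)
    · refine h2 (Subtype.ext ?_)
      ext j
      simp only [missFace, Finset.mem_erase, Finset.mem_univ, and_true]
      exact ⟨fun hj hji => hi (hji ▸ hj), fun hji => by_contra fun hj => hji (h j hj)⟩
  have h3 : (J.1.preimage (Fin.succAbove j) Fin.succAbove_right_injective.injOn).image
      (Fin.succAbove j) = J.1 := by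
    ext a
    rw [Finset.mem_image]
    constructor
    · rintro ⟨b, hb, rfl⟩
      exact Finset.mem_preimage.1 hb
    · intro ha
      obtain ⟨b, rfl⟩ := Fin.exists_succAbove_eq (x := a) (y := j) (by rintro rfl; exact hj ha)
      exact ⟨b, Finset.mem_preimage.2 ha, rfl⟩
  have h4 := J.2
  rw [← h3] at h4
  exact ⟨j, hji, ⟨_, Finset.image_nonempty.1 h4⟩, h3⟩

theorem cochainPull_succAbove (j : Fin (n + 2)) (α : Face (n + 1) → L) (J' : Face n) :
    cochainPull (K := K) (Fin.succAbove j) α J' =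
      α ⟨J'.1.image (Fin.succAbove j), J'.2.image _⟩ := by
  change (if _ then _ else _) = _
  rw [if_pos (Finset.card_image_of_injective _ Fin.succAbove_right_injective)]

theorem cochainPull_congr {i : Fin (n + 2)} {α β : Face (n + 1) → L}
    (h : ∀ J, J ≠ topFace (n + 1) → J ≠ missFace i → α J = β J) {j : Fin (n + 2)} (hj : j ≠ i) :
    cochainPull (K := K) (Fin.succAbove j) α = cochainPull (K := K) (Fin.succAbove j) β := by
  ext1 J'
  rw [cochainPull_succAbove, cochainPull_succAbove]
  have h1 : j ∉ J'.1.image (Fin.succAbove j) := fun h => by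
    obtain ⟨a, _, ha⟩ := Finset.mem_image.1 h
    exact Fin.succAbove_ne j a ha
  refine h _ (fun h2 => h1 ?_) fun h2 => h1 ?_
  · rw [show J'.1.image (Fin.succAbove j) = _ from congrArg Subtype.val h2]
    exact Finset.mem_univ j
  · rw [show J'.1.image (Fin.succAbove j) = _ from congrArg Subtype.val h2]
    exact Finset.mem_erase.2 ⟨hj, Finset.mem_univ j⟩

theorem single_mem_filt {I : Face n} {p : ℕ} {z : L} (hz : z ∈ L.filt p) :
    (Pi.single I z : Face n → L) ∈ cochainFilt L n p := by
  refine Submodule.mem_pi.2 fun J _ => ?_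
  by_cases h : J = I
  · subst h
    rwa [Pi.single_eq_same]
  · rw [Pi.single_eq_of_ne h]
    exact zero_mem _

theorem cochainD_single_topFace (i : Fin (n + 2)) (z : L) :
    cochainD L (Pi.single (missFace i) z) (topFace (n + 1)) = (-1 : ℤ) ^ (i : ℕ) • z := by
  rw [cochainD_topFace, Pi.single_eq_of_ne (topFace_ne_missFace i)]
  have h : (L.q 1 fun _ => (0 : L)) = 0 := (L.q 1).map_zero
  rw [h, smul_zero, add_zero, Finset.sum_eq_single i, Pi.single_eq_same]
  · intro j _ hj
    rw [Pi.single_eq_of_ne fun h => hj (missFace_injective h), smul_zero]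
  · exact fun h => absurd (Finset.mem_univ i) h

theorem update_add_single (β : Face n → L) (I : Face n) (y z : L) :
    Function.update β I (y + z) = Function.update β I y + Pi.single I z := by
  ext J
  by_cases h : J = I
  · subst h
    simp
  · simp [h]

variable [CharZero K]

/-- If the curvature is small on all faces but the facet opposite to `i`, then it is small on that
one too, by the Bianchi identity on the top face. -/
theorem cochainCurv_mem_of_horn {N : ℕ} {i : Fin (n + 2)} {α : Face (n + 1) → L}
    (hα : α ∈ cochainDeg L (n + 1) 1)
    (h : ∀ J, J ≠ missFace i → cochainCurv N α J ∈ L.filt (N + 1)) :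
    cochainCurv N α ∈ cochainFilt L (n + 1) (N + 1) := by
  suffices hs : ∀ p, p ≤ N → cochainCurv N α ∈ cochainFilt L (n + 1) (p + 1) from hs N le_rfl
  intro p
  induction p with
  | zero => exact fun _ => Submodule.mem_pi.2 fun J _ => mem_filt_of_le le_rfl _
  | succ p ih =>
    intro hp
    have h1 := Submodule.mem_pi.1 (cochainD_cochainCurv (Nat.le_add_left 1 p) hp hα
      (ih (by omega))) (topFace (n + 1)) trivial
    have h' : ∀ J, J ≠ missFace i → cochainCurv N α J ∈ L.filt (p + 1 + 1) := fun J hJ =>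
      L.filt_antitone (by omega) (h J hJ)
    rw [cochainD_topFace, ← Finset.add_sum_erase _ _ (Finset.mem_univ i),
      add_assoc ((-1 : ℤ) ^ (i : ℕ) • _)] at h1
    have h2 : ∑ j ∈ Finset.univ.erase i, (-1 : ℤ) ^ (j : ℕ) • cochainCurv N α (missFace j) ∈
        L.filt (p + 1 + 1) := sum_mem fun j hj => zsmul_mem (h' _ fun hji =>
          (Finset.mem_erase.1 hj).1 (missFace_injective hji)) _
    have h3 : (-1 : ℤ) ^ (topFace (n + 1)).dim •
        (L.q 1 fun _ => cochainCurv N α (topFace (n + 1))) ∈ L.filt (p + 1 + 1) :=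
      zsmul_mem (q_one_mem_filt (h' _ (topFace_ne_missFace i))) _
    have h4 := zsmul_mem ((add_mem_cancel_right (add_mem h2 h3)).1 h1) ((-1 : ℤ) ^ (i : ℕ))
    rw [smul_smul, ← mul_pow, neg_one_mul, neg_neg, one_pow, one_smul] at h4
    refine Submodule.mem_pi.2 fun J _ => ?_
    by_cases hJ : J = missFace i
    · rw [hJ]
      exact h4
    · exact h' J hJ

/-- A Maurer-Cartan cochain is determined by its values on all faces but one facet: to first order,
a change on this facet changes the curvature on the top face by the same amount up to sign. -/
theorem mcCochains_ext {i : Fin (n + 2)} {α α' : Face (n + 1) → L} (hα : α ∈ mcCochains L (n + 1))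
    (hα' : α' ∈ mcCochains L (n + 1)) (h : ∀ J, J ≠ missFace i → α J = α' J) : α = α' := by
  rw [mem_mcCochains] at hα hα'
  set z := α' (missFace i) - α (missFace i) with hz
  have h1 : α' = α + Pi.single (missFace i) z := by
    ext J
    by_cases hJ : J = missFace i
    · rw [hJ, Pi.add_apply, Pi.single_eq_same, hz, add_sub_cancel]
    · rw [Pi.add_apply, Pi.single_eq_of_ne hJ, add_zero, h J hJ]
  have h2 : ∀ p, z ∈ L.filt (p + 1) := by
    intro p
    induction p with
    | zero => exact mem_filt_of_le le_rfl _
    | succ p ih =>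
      have h3 := cochainCurv_add (N := p + 1) (Nat.le_add_left 1 p) (Nat.le_add_left 1 p) α
        (single_mem_filt (I := missFace i) ih)
      rw [← h1, ← sub_sub] at h3
      have h4 := sub_mem (sub_mem (hα'.2 (p + 1) (Nat.le_add_left 1 p))
        (hα.2 (p + 1) (Nat.le_add_left 1 p))) h3
      rw [sub_sub_cancel] at h4
      have h5 := zsmul_mem (Submodule.mem_pi.1 h4 (topFace (n + 1)) trivial) ((-1 : ℤ) ^ (i : ℕ))
      rwa [cochainD_single_topFace, smul_smul, ← mul_pow, neg_one_mul, neg_neg, one_pow,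
        one_smul] at h5
  have h3 : z = 0 := by
    refine L.separated (1 - (missFace i).dim) z ?_ fun p => L.filt_antitone (Nat.le_succ p) (h2 p)
    exact sub_mem (Submodule.mem_pi.1 hα'.1 _ trivial) (Submodule.mem_pi.1 hα.1 _ trivial)
  rw [h1, h3, Pi.single_zero, add_zero]

/-- Horns of Maurer-Cartan cochains can be filled, with a prescribed value on the top face. -/
theorem exists_mcCochains {i : Fin (n + 2)} {β : Face (n + 1) → L}
    (hβ : β ∈ cochainDeg L (n + 1) 1)
    (h : ∀ j, j ≠ i → cochainPull (K := K) (Fin.succAbove j) β ∈ mcCochains L n) :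
    ∃ α ∈ mcCochains L (n + 1), ∀ J, J ≠ missFace i → α J = β J := by
  -- Newton iteration for the value on the missing facet: the correction is, up to sign, the
  -- curvature on the top face
  obtain ⟨s, hs0, hs⟩ : ∃ s : ℕ → L, s 0 = β (missFace i) ∧ ∀ p, s (p + 1) = s p +
      -((-1 : ℤ) ^ (i : ℕ) •
        cochainCurv (p + 1) (Function.update β (missFace i) (s p)) (topFace (n + 1))) :=
    ⟨fun p => Nat.rec (β (missFace i)) (fun p y => y + -((-1 : ℤ) ^ (i : ℕ) •
      cochainCurv (p + 1) (Function.update β (missFace i) y) (topFace (n + 1)))) p, rfl,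
      fun _ => rfl⟩
  have hdeg : ∀ y ∈ L.deg (1 - (missFace i).dim),
      Function.update β (missFace i) y ∈ cochainDeg L (n + 1) 1 := by
    intro y hy
    refine Submodule.mem_pi.2 fun J _ => ?_
    by_cases hJ : J = missFace i
    · subst hJ
      rwa [Function.update_self]
    · rw [Function.update_of_ne hJ]
      exact Submodule.mem_pi.1 hβ J trivial
  have hsdeg : ∀ p, s p ∈ L.deg (1 - (missFace i).dim) := by
    intro p
    induction p with
    | zero => rw [hs0]; exact Submodule.mem_pi.1 hβ _ trivial
    | succ p ih =>
      rw [hs]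
      refine add_mem ih (neg_mem (zsmul_mem ?_ _))
      have := Submodule.mem_pi.1 (cochainCurv_mem_deg (Nat.le_add_left 1 p) (hdeg _ ih))
        (topFace (n + 1)) trivial
      rw [dim_topFace] at this
      rwa [dim_missFace, show (1 - n : ℤ) = 2 - ((n + 1 : ℕ) : ℤ) by push_cast; ring]
  -- the curvature on the top face tends to zero
  have hsub : ∀ {N p : ℕ}, 1 ≤ N → p ≤ N + 1 → ∀ M, N ≤ M → ∀ (α : Face (n + 1) → L) J,
      cochainCurv M α J ∈ L.filt p ↔ cochainCurv N α J ∈ L.filt p := by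
    intro N p hN hp M hM α J
    have h1 := L.filt_antitone hp (Submodule.mem_pi.1 (cochainCurv_sub_mem hN hM α) J trivial)
    exact ⟨fun h2 => by simpa using sub_mem h2 h1, fun h2 => by simpa using add_mem h1 h2⟩
  have hcurv : ∀ p, cochainCurv (p + 1) (Function.update β (missFace i) (s (p + 1)))
      (topFace (n + 1)) ∈ L.filt (p + 1) := by
    intro p
    induction p with
    | zero => exact mem_filt_of_le le_rfl _
    | succ p ih =>
      have h1 := (hsub (Nat.le_add_left 1 p) (Nat.le_succ _) (p + 1 + 1) (Nat.le_succ _) _ _).2 ih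
      have h2 := Submodule.mem_pi.1 (cochainCurv_add (N := p + 1 + 1) (Nat.le_add_left 1 _)
        (Nat.le_add_left 1 p) (Function.update β (missFace i) (s (p + 1)))
        (single_mem_filt (I := missFace i) (neg_mem (zsmul_mem h1 ((-1 : ℤ) ^ (i : ℕ))))))
        (topFace (n + 1)) trivial
      rw [← update_add_single, ← hs] at h2
      simp only [Pi.sub_apply, Pi.add_apply] at h2
      rw [cochainD_single_topFace, smul_neg, smul_smul, ← mul_pow, neg_one_mul, neg_neg, one_pow,
        one_smul, add_neg_cancel, sub_zero] at h2
      exact h2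
  have hstep : ∀ p, s (p + 1) - s p ∈ L.filt p := by
    intro p
    rw [hs, add_sub_cancel_left]
    cases p with
    | zero => exact mem_filt_of_le zero_le_one _
    | succ p =>
      exact neg_mem (zsmul_mem
        ((hsub (Nat.le_add_left 1 p) (Nat.le_succ _) (p + 1 + 1) (Nat.le_succ _) _ _).2
          (hcurv p)) _)
  obtain ⟨y, hy, hys⟩ := L.complete _ s hsdeg hstep
  have hyα := hdeg y hy
  set α := Function.update β (missFace i) y with hα
  have hαβ : ∀ J, J ≠ missFace i → α J = β J := fun J hJ => Function.update_of_ne hJ _ _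
  refine ⟨α, mem_mcCochains.2 ⟨hyα, fun N hN =>
    cochainCurv_mem_of_horn hyα (i := i) fun J hJ => ?_⟩, hαβ⟩
  by_cases hJt : J = topFace (n + 1)
  · rw [hJt, ← hsub hN le_rfl (N + 1) (Nat.le_succ N)]
    have h1 := hys (N + 1)
    have h2 := Submodule.mem_pi.1 (cochainCurv_add (N := N + 1) (Nat.le_add_left 1 N)
      (Nat.le_add_left 1 N) (Function.update β (missFace i) (s (N + 1)))
      (single_mem_filt (I := missFace i) h1)) (topFace (n + 1)) trivial
    rw [← update_add_single, add_sub_cancel, ← hα] at h2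
    simp only [Pi.sub_apply, Pi.add_apply] at h2
    rw [cochainD_single_topFace] at h2
    have h3 := add_mem (L.filt_antitone (Nat.le_succ _) h2)
      (add_mem (hcurv N) (zsmul_mem h1 ((-1 : ℤ) ^ (i : ℕ))))
    rwa [sub_add_cancel] at h3
  · obtain ⟨j, hj, J', hJ'⟩ := exists_facet hJt hJ
    have h1 : cochainPull (K := K) (Fin.succAbove j) α = cochainPull (K := K) (Fin.succAbove j) β :=
      cochainPull_congr (i := i) (fun J _ hJ => hαβ J hJ) hj
    have h2 := Submodule.mem_pi.1 ((mem_mcCochains.1 (h j hj)).2 N hN) J' trivial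
    rw [← h1, ← cochainPull_cochainCurv _ (Fin.strictMono_succAbove j).monotone,
      cochainPull_succAbove] at h2
    have h3 : (⟨J'.1.image (Fin.succAbove j), J'.2.image _⟩ : Face (n + 1)) = J := Subtype.ext hJ'
    rwa [h3] at h2

end Horns

/-! ### Kan fibrations -/

section Kan

open Simplicial

variable {K : Type v} [Field K] {L M : CompleteLInfty.{u} K} {n : ℕ}

variable (L n) in
theorem zero_mem_mcCochains : (0 : Face n → L) ∈ mcCochains L n := by
  -- apply naturality to the zero morphism, which is strict
  let z : StrictHom L L := ⟨0, fun _ _ _ => zero_mem _, fun _ _ _ _ => zero_mem _, fun k x => by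
    rcases Nat.eq_zero_or_pos k with rfl | hk
    · rw [L.q_zero]
      rfl
    · have : Nonempty (Fin k) := ⟨⟨0, hk⟩⟩
      exact (L.q k).map_zero.symm⟩
  have h : ∀ k, cochainOp L n k (fun _ => 0) (fun _ => (0 : Face n → L)) = 0 := fun k =>
    (push_cochainOp z k (fun _ => 0) fun _ => 0).symm
  refine ⟨zero_mem _, fun p => ⟨0, fun i _ => ?_⟩⟩
  simp only [h, smul_zero, Finset.sum_const_zero]
  exact zero_mem _

/-- The Maurer-Cartan cochain classified by a map from the standard simplex, by Yoneda. -/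
noncomputable def classifyingCochain (φ : Δ[n] ⟶ (delInfty K).obj L) : Face n → L :=
  (SSet.yonedaEquiv φ : mcCochains L n).1

theorem classifyingCochain_mem (φ : Δ[n] ⟶ (delInfty K).obj L) :
    classifyingCochain φ ∈ mcCochains L n :=
  (SSet.yonedaEquiv φ : mcCochains L n).2

theorem classifyingCochain_injective :
    Function.Injective (classifyingCochain : (Δ[n] ⟶ (delInfty K).obj L) → _) := fun _ _ h =>
  SSet.yonedaEquiv.injective (Subtype.ext h)

theorem exists_classifyingCochain_eq {α : Face n → L} (hα : α ∈ mcCochains L n) :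
    ∃ φ : Δ[n] ⟶ (delInfty K).obj L, classifyingCochain φ = α := by
  obtain ⟨φ, hφ⟩ := SSet.yonedaEquiv.surjective
    (show ((delInfty K).obj L).obj (Opposite.op (SimplexCategory.mk n)) from ⟨α, hα⟩)
  exact ⟨φ, congrArg (fun x : mcCochains L n => x.1) hφ⟩

theorem classifyingCochain_map_comp {m : ℕ} (θ : SimplexCategory.mk m ⟶ SimplexCategory.mk n)
    (φ : Δ[n] ⟶ (delInfty K).obj L) : classifyingCochain (SSet.stdSimplex.map θ ≫ φ) =
      cochainPull (K := K) θ.toOrderHom (classifyingCochain φ) :=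
  (congrArg Subtype.val (SSet.yonedaEquiv_naturality θ φ)).symm

theorem classifyingCochain_δ_comp (j : Fin (n + 2)) (φ : Δ[n + 1] ⟶ (delInfty K).obj L)
    (J : Face n) : classifyingCochain (SSet.stdSimplex.δ j ≫ φ) J =
      classifyingCochain φ ⟨J.1.image (Fin.succAbove j), J.2.image _⟩ :=
  (congrFun (classifyingCochain_map_comp (SimplexCategory.δ j) φ) J).trans
    (cochainPull_succAbove j _ J)

theorem classifyingCochain_comp_map (φ : Δ[n] ⟶ (delInfty K).obj L) (f : L ⟶ M) (J : Face n) :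
    classifyingCochain (φ ≫ (delInfty K).map f) J = StrictHom.toLin f (classifyingCochain φ J) :=
  rfl

/-- The value of a cochain on a face is the value on the top face of its pull-back along the
inclusion of that face. -/
theorem classifyingCochain_apply {d : ℕ} (J : Face n) (hJ : J.1.card = d + 1)
    (φ : Δ[n] ⟶ (delInfty K).obj L) : classifyingCochain φ J =
      classifyingCochain (SSet.stdSimplex.map (SimplexCategory.Hom.mk
        (J.1.orderEmbOfFin hJ).toOrderHom : SimplexCategory.mk d ⟶ SimplexCategory.mk n) ≫ φ)
        (topFace d) := by
  rw [classifyingCochain_map_comp]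
  have h1 : (topFace d).1.image (J.1.orderEmbOfFin hJ) = J.1 := J.1.image_orderEmbOfFin_univ hJ
  have h2 : ((topFace d).1.image (J.1.orderEmbOfFin hJ)).card = (topFace d).1.card :=
    Finset.card_image_of_injective _ (J.1.orderEmbOfFin hJ).injective
  refine Eq.symm ((if_pos h2).trans ?_)
  exact congrArg _ (Subtype.ext h1)

variable {i : Fin (n + 2)}

/-- The cochains on the facets of a horn agree on common faces. -/
theorem classifyingCochain_horn (g : (Λ[n + 1, i] : SSet.{u}) ⟶ (delInfty K).obj L)
    {j j' : Fin (n + 2)} (hj : j ≠ i) (hj' : j' ≠ i) {J J' : Face n}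
    (h : J.1.image (Fin.succAbove j) = J'.1.image (Fin.succAbove j')) :
    classifyingCochain (SSet.horn.ι i j hj ≫ g) J =
      classifyingCochain (SSet.horn.ι i j' hj' ≫ g) J' := by
  have hc : J'.1.card = J.dim + 1 := by
    rw [← J.card_eq, ← Finset.card_image_of_injective J.1 Fin.succAbove_right_injective, h,
      Finset.card_image_of_injective J'.1 Fin.succAbove_right_injective]
  rw [classifyingCochain_apply J J.card_eq, classifyingCochain_apply J' hc, ← Category.assoc,
    ← Category.assoc]
  congr 2
  rw [← cancel_mono (SSet.Subcomplex.ι _), Category.assoc, Category.assoc, SSet.horn.ι_ι,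
    SSet.horn.ι_ι]
  refine (SSet.stdSimplex.map_comp _ (SimplexCategory.δ j)).symm.trans
    ((congrArg SSet.stdSimplex.map ?_).trans (SSet.stdSimplex.map_comp _ (SimplexCategory.δ j')))
  ext a : 3
  have hs : (J.1.image (Fin.succAbove j)).card = J.dim + 1 := by
    rw [Finset.card_image_of_injective J.1 Fin.succAbove_right_injective, J.card_eq]
  have e1 := Finset.orderEmbOfFin_unique hs (f := Fin.succAbove j ∘ J.1.orderEmbOfFin J.card_eq)
    (fun x => Finset.mem_image_of_mem _ (J.1.orderEmbOfFin_mem _ _))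
    ((Fin.strictMono_succAbove j).comp (J.1.orderEmbOfFin _).strictMono)
  have e2 := Finset.orderEmbOfFin_unique hs (f := Fin.succAbove j' ∘ J'.1.orderEmbOfFin hc)
    (fun x => by
      rw [h]
      exact Finset.mem_image_of_mem _ (J'.1.orderEmbOfFin_mem _ _))
    ((Fin.strictMono_succAbove j').comp (J'.1.orderEmbOfFin _).strictMono)
  exact congrFun (e1.trans e2.symm) a

theorem horn_ι_comp_eq_iff {X : SSet.{u}} {g : (Λ[n + 1, i] : SSet.{u}) ⟶ X} {φ : Δ[n + 1] ⟶ X} :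
    Λ[n + 1, i].ι ≫ φ = g ↔
      ∀ j (hj : j ≠ i), SSet.stdSimplex.δ j ≫ φ = SSet.horn.ι i j hj ≫ g := by
  constructor
  · rintro rfl j hj
    rw [SSet.horn.ι_ι_assoc]
  · intro h
    refine SSet.horn.hom_ext' fun j hj => ?_
    rw [SSet.horn.ι_ι_assoc, h j hj]

variable [CharZero K]

/-- Every horn has a filler with a prescribed value on the top face. -/
theorem exists_horn_filler (g : (Λ[n + 1, i] : SSet.{u}) ⟶ (delInfty K).obj L) {x : L}
    (hx : x ∈ L.deg (-n)) : ∃ φ : Δ[n + 1] ⟶ (delInfty K).obj L,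
      Λ[n + 1, i].ι ≫ φ = g ∧ classifyingCochain φ (topFace (n + 1)) = x := by
  classical
  obtain ⟨β, hβ0, hβ1, hβ⟩ : ∃ β : Face (n + 1) → L, β (topFace (n + 1)) = x ∧
      β (missFace i) = 0 ∧ ∀ j (hj : j ≠ i) (J : Face n),
        β ⟨J.1.image (Fin.succAbove j), J.2.image _⟩ =
          classifyingCochain (SSet.horn.ι i j hj ≫ g) J := by
    have hne : ∀ j (J : Face n), j ∉ J.1.image (Fin.succAbove j) := fun j J h => by
      obtain ⟨a, _, ha⟩ := Finset.mem_image.1 h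
      exact Fin.succAbove_ne j a ha
    refine ⟨fun I => if I = topFace (n + 1) then x else if h : ∃ (j : Fin (n + 2)) (_ : j ≠ i)
      (J : Face n), J.1.image (Fin.succAbove j) = I.1 then
        classifyingCochain (SSet.horn.ι i h.choose h.choose_spec.choose ≫ g)
          h.choose_spec.choose_spec.choose else 0, if_pos rfl, ?_, fun j hj J => ?_⟩
    · refine (if_neg (topFace_ne_missFace i).symm).trans (dif_neg ?_)
      rintro ⟨j, hj, J, h⟩
      refine hne j J ?_
      rw [h]
      exact Finset.mem_erase.2 ⟨hj, Finset.mem_univ j⟩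
    · have h1 : (⟨J.1.image (Fin.succAbove j), J.2.image _⟩ : Face (n + 1)) ≠ topFace (n + 1) :=
        fun h => hne j J (by
          rw [show J.1.image (Fin.succAbove j) = _ from congrArg Subtype.val h]
          exact Finset.mem_univ j)
      have h2 : ∃ (j' : Fin (n + 2)) (_ : j' ≠ i) (J' : Face n),
        J'.1.image (Fin.succAbove j') = J.1.image (Fin.succAbove j) := ⟨j, hj, J, rfl⟩
      refine (if_neg h1).trans ((dif_pos h2).trans ?_)
      exact classifyingCochain_horn g _ hj h2.choose_spec.choose_spec.choose_spec
  have hpull : ∀ j (hj : j ≠ i), cochainPull (K := K) (Fin.succAbove j) β =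
      classifyingCochain (SSet.horn.ι i j hj ≫ g) := fun j hj => by
    ext1 J
    rw [cochainPull_succAbove, hβ j hj]
  have hdeg : β ∈ cochainDeg L (n + 1) 1 := by
    refine Submodule.mem_pi.2 fun J _ => ?_
    by_cases h1 : J = topFace (n + 1)
    · rw [h1, hβ0, dim_topFace]
      convert hx using 2
      push_cast
      ring
    by_cases h2 : J = missFace i
    · rw [h2, hβ1]
      exact zero_mem _
    obtain ⟨j, hj, J', h⟩ := exists_facet h1 h2
    obtain rfl : J = ⟨J'.1.image (Fin.succAbove j), J'.2.image _⟩ := Subtype.ext h.symm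
    rw [hβ j hj]
    have h3 := Submodule.mem_pi.1 (classifyingCochain_mem (SSet.horn.ι i j hj ≫ g)).1 J' trivial
    simpa only [Face.dim, Finset.card_image_of_injective _ Fin.succAbove_right_injective] using h3
  obtain ⟨α, hα, h⟩ := exists_mcCochains hdeg fun j hj => by
    rw [hpull j hj]
    exact classifyingCochain_mem _
  obtain ⟨φ, rfl⟩ := exists_classifyingCochain_eq hα
  refine ⟨φ, horn_ι_comp_eq_iff.2 fun j hj => classifyingCochain_injective ?_,
    (h _ (topFace_ne_missFace i)).trans hβ0⟩
  rw [← hpull j hj, ← cochainPull_congr (fun J _ hJ => h J hJ) hj]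
  exact classifyingCochain_map_comp (SimplexCategory.δ j) φ

/-- A filler of a horn is determined by its value on the top face. -/
theorem horn_filler_ext {φ ψ : Δ[n + 1] ⟶ (delInfty K).obj L}
    (h : Λ[n + 1, i].ι ≫ φ = Λ[n + 1, i].ι ≫ ψ)
    (htop : classifyingCochain φ (topFace (n + 1)) = classifyingCochain ψ (topFace (n + 1))) :
    φ = ψ := by
  refine classifyingCochain_injective (mcCochains_ext (i := i) (classifyingCochain_mem φ)
    (classifyingCochain_mem ψ) fun J hJ => ?_)
  by_cases h1 : J = topFace (n + 1)
  · rw [h1, htop]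
  obtain ⟨j, hj, J', h2⟩ := exists_facet h1 hJ
  obtain rfl : J = ⟨J'.1.image (Fin.succAbove j), J'.2.image _⟩ := Subtype.ext h2.symm
  rw [← classifyingCochain_δ_comp, ← classifyingCochain_δ_comp, ← SSet.horn.ι_ι i j hj,
    Category.assoc, Category.assoc, h]

variable (L) in
theorem kanComplex_delInfty : SSet.KanComplex ((delInfty K).obj L) := by
  refine SSet.KanComplex.iff.2 fun n i f hf => ?_
  obtain ⟨φ, hφ, -⟩ := exists_horn_filler hf.desc (zero_mem (L.deg (-n)))
  exact ⟨φ, fun j hj => (horn_ι_comp_eq_iff.1 hφ j hj).trans (hf.ι_desc j hj)⟩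

/-- A lifting is obtained by filling the horn with a lift of the value on the top face. -/
theorem fibration_delInfty_map (f : L ⟶ M)
    (hf : ∀ k : ℤ, k ≤ 0 → ∀ y ∈ M.deg k, ∃ x ∈ L.deg k, StrictHom.toLin f x = y) :
    HomotopicalAlgebra.Fibration ((delInfty K).map f) := by
  refine (SSet.modelCategoryQuillen.fibration_iff _).2 fun _ _ p hp => ?_
  simp only [SSet.modelCategoryQuillen.J, MorphismProperty.iSup_iff] at hp
  obtain ⟨n, ⟨i⟩⟩ := hp
  refine ⟨fun {t b} sq => ?_⟩
  have hy := Submodule.mem_pi.1 (classifyingCochain_mem b).1 (topFace (n + 1)) trivial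
  rw [dim_topFace, show (1 : ℤ) - ((n + 1 : ℕ) : ℤ) = -n by push_cast; ring] at hy
  obtain ⟨x, hx, hxy⟩ := hf _ (by omega) _ hy
  obtain ⟨φ, hφ, htop⟩ := exists_horn_filler t hx
  refine ⟨⟨⟨φ, hφ, horn_filler_ext (i := i) ?_ ?_⟩⟩⟩
  · rw [← Category.assoc, hφ, sq.w]
  · rw [classifyingCochain_comp_map, htop, hxy]

/-- The value on the top face of an `(n+1)`-simplex has degree `-n` and can be prescribed for a
simplex of `Del_∞(M)` whose `0`-horn is trivial; lifting this simplex lifts the value. -/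
theorem exists_of_fibration (f : L ⟶ M) [HomotopicalAlgebra.Fibration ((delInfty K).map f)]
    {k : ℤ} (hk : k ≤ 0) {y : M} (hy : y ∈ M.deg k) : ∃ x ∈ L.deg k, StrictHom.toLin f x = y := by
  obtain ⟨n, rfl⟩ : ∃ n : ℕ, k = -n := ⟨k.natAbs, by omega⟩
  obtain ⟨φ, hφ⟩ := exists_classifyingCochain_eq (zero_mem_mcCochains L (n + 1))
  obtain ⟨ψ, hψ, htop⟩ := exists_horn_filler
    (Λ[n + 1, 0].ι ≫ φ ≫ (delInfty K).map f) hy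
  have sq : CommSq (Λ[n + 1, 0].ι ≫ φ) Λ[n + 1, 0].ι ((delInfty K).map f) ψ :=
    ⟨by rw [hψ, Category.assoc]⟩
  refine ⟨classifyingCochain sq.lift (topFace (n + 1)), ?_, ?_⟩
  · have h := Submodule.mem_pi.1 (classifyingCochain_mem sq.lift).1 (topFace (n + 1)) trivial
    rwa [dim_topFace, show (1 : ℤ) - ((n + 1 : ℕ) : ℤ) = -n by push_cast; ring] at h
  · rw [← classifyingCochain_comp_map, sq.fac_right, htop]

end Kan

end DeligneGetzler

theorem corollary2p8 {K : Type v} [Field K] [CharZero K] :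
    (∀ (L M : DeligneGetzler.CompleteLInfty.{u} K) (f : L ⟶ M),
      HomotopicalAlgebra.Fibration ((DeligneGetzler.delInfty K).map f) ↔
        ∀ k : ℤ, k ≤ 0 → ∀ y ∈ M.deg k, ∃ x ∈ L.deg k, DeligneGetzler.StrictHom.toLin f x = y) ∧
    ∀ L : DeligneGetzler.CompleteLInfty.{u} K,
      SSet.KanComplex ((DeligneGetzler.delInfty K).obj L) :=
  ⟨fun _ _ f => ⟨fun _ _ hk _ hy => DeligneGetzler.exists_of_fibration f hk hy,
    DeligneGetzler.fibration_delInfty_map f⟩, fun L => DeligneGetzler.kanComplex_delInfty L⟩
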